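/- **Setting.** Let $d\in\mathbb N$, $T>0$ and $\mathcal I=\{1,\dots,d\}$. On a probability space let $\{IA_i(l)\}_{l\ge1}$, $i\in\mathcal I$, be $d$ independent sequences of i.i.d. positive random variables with mean $1$ and finite variance $\sigma_{IA,i}^2$, and let $\{ST_i(l)\}_{l\ge1}$, $i\in\mathcal I$, be $d$ independent sequences of i.i.d. positive random variables with mean $1$ and finite variance $\sigma_{ST,i}^2$. For $n\ge1$ let $b_n,\lambda_i^n,\mu_i^n>0$ satisfy $b_n\to\infty$, $b_n/\sqrt n\to0$, $\lambda^n_i/n\to\lambda_i\in(0,\infty)$, $\mu_i^n/n\to\mu_i\in(0,\infty)$, $(\lambda_i^n-n\lambda_i)/(b_n\sqrt n)\to\tilde\lambda_i\in\mathbb R$, $(\mu_i^n-n\mu_i)/(b_n\sqrt n)\to\tilde\mu_i\in\mathbb R$, and let $\sum_i\rho_i=1$ where $\rho_i=\lambda_i/\mu_i$. Put $$A_i^n(t)=\sup\Big\{l\ge0:\sum_{k=1}^l\tfrac{IA_i(k)}{\lambda_i^n}\le t\Big\},\qquad S_i^n(t)=\sup\Big\{l\ge0:\sum_{k=1}^l\tfrac{ST_i(k)}{\mu_i^n}\le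 t\Big\},$$ $\tilde A_i^n(t)=(A_i^n(t)-\lambda_i^nt)/(b_n\sqrt n)$ and $\tilde S_i^n(t)=(S_i^n(t)-\mu_i^nt)/(b_n\sqrt n)$. A control $B^n$ with right-continuous paths with left limits (RCLL), values in $\{x\in[0,1]^d:\sum_ix_i\le1\}$, yields $$T_i^n(t)=\int_0^tB_i^n(s)\,ds,\qquad Q_i^n(t)=A_i^n(t)-S_i^n(T_i^n(t)),\qquad \tilde Q_i^n=Q_i^n/(b_n\sqrt n).$$ It is *admissible* if it is adapted (up to null sets) to $\sigma\{A_i^n(s),S_i^n(T_i^n(s)):i\in\mathcal I,s\le t\}$ and, almost surely, $Q_i^n(t)=0$ implies $B_i^n(t)=0$ for all $i$ and $t\ge0$. Let $C_i:\mathbb R_+\to\mathbb R_+$, $i\in\mathcal I$, be strictly increasing, strictly convex and continuously differentiable, with $C_i(0)=C_i'(0)=0$ and $C_i(x)\le u_1x$ for all $x\ge0$ and some constant $u_1$; let $C(x)=\sum_iC_i(x_i)$ and $$J^n(B^n)=\frac1{b_n^2}\log\mathbb E\Big[\exp\Big(b_n^2\int_0^TC(\tilde Q^n(t))\,dt\Big)\Big].$$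 **Rate function and assumptions.** For RCLL $\psi=(\psi^{(1)},\psi^{(2)}):[0,T]\to\mathbb R^{2d}$ let $$\mathbb I(\psi)=\sum_i\frac1{2\lambda_i\sigma_{IA,i}^2}\int_0^T(\dot\psi_i^{(1)})^2ds+\sum_i\frac1{2\mu_i\sigma_{ST,i}^2}\int_0^T(\dot\psi_i^{(2)})^2ds$$ if $\psi$ is absolutely continuous with $\psi(0)=0$ (with the conventions $0/0=0$ and $x/0=\infty$ for $x>0$), and $\mathbb I(\psi)=\infty$ otherwise. Assume: 1. $(\tilde A^n,\tilde S^n)$ satisfies the large deviation principle with speed $b_n^{-2}$ and rate function $\mathbb I$ in $\mathcal D([0,T],\mathbb R^{2d})$ with the Skorokhod $J_1$ topology: $\liminf_n b_n^{-2}\log\mathbb P((\tilde A^n,\tilde S^n)\in G)\ge-\inf_G\mathbb I$ for open $G$ and $\limsup_n b_n^{-2}\log\mathbb P((\tilde A^n,\tilde S^n)\in F)\le-\inf_F\mathbb I$ for closed $F$. 2. For every constant $u$, $\limsup_n b_n^{-2}\log\mathbb E\big[e^{b_n^2u(\|\tilde A^n\|_T+\|\tilde S^n\|_T)}\big]<\infty$,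 where $\|f\|_T=\sup_{t\in[0,T]}\|f(t)\|$. **The game.** Let $\theta_i=1/\mu_i$ and $y_i=\tilde\lambda_i-\rho_i\tilde\mu_i$. Let $\mathcal P$ be the set of continuous $\psi=(\psi^{(1)},\psi^{(2)}):[0,T]\to\mathbb R^{2d}$ with $\psi(0)=0$, and $\mathcal E$ the set of continuous $\zeta:[0,T]\to\mathbb R^d$ for which $\theta\cdot\zeta$ is nondecreasing and starts from $0$, both with the uniform topology. Let $\rho[\psi^{(2)}]_i(t)=\psi^{(2)}_i(\rho_it)$ and, for $(\psi,\zeta)\in\mathcal P\times\mathcal E$, $$\varphi_i(t)=y_it+\psi^{(1)}_i(t)-\rho[\psi^{(2)}]_i(t)+\zeta_i(t),\qquad c(\psi,\zeta)=\int_0^TC(\varphi(t))\,dt-\mathbb I(\psi).$$ Let $\mathcal A$ be the set of Borel measurable $\alpha:\mathcal P\to\mathcal E$ that are causal (if $(\psi^{(1)},\rho[\psi^{(2)}])$ and $(\tilde\psi^{(1)},\rho[\tilde\psi^{(2)}])$ agree on $[0,t]$, then $\alpha[\psi]$ and $\alpha[\tilde\psi]$ agree on $[0,t]$) and for which $\varphi_i(t)\ge0$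 for all $i$ and $t\in[0,T]$ whenever $\psi\in\mathcal P$ and $\zeta=\alpha[\psi]$. The value of the game is $V=\inf_{\alpha\in\mathcal A}\sup_{\psi\in\mathcal P}c(\psi,\alpha[\psi])$. **Theorem.** Let $\mathcal Q_i$ be the set of $q\in\mathbb R_+^d\setminus\{0\}$ for which $i$ is the smallest maximizer of $j\mapsto\mu_jC_j'(q_j)$. For each $n\ge1$ the preemptive generalized $c\mu$ rule $$B_i^{*,n}(t)=1_{\{\tilde Q^n(t)\in\mathcal Q_i\}},\qquad i\in\mathcal I,\ t\ge0,$$ where $\tilde Q^n$ is the scaled queue length under $B^{*,n}$ itself, determines an RCLL process $B^{*,n}$, uniquely up to null sets, and it is an admissible control. The value $V$ is finite, and $B^{*,n}$ is asymptotically optimal: $$\lim_{n\to\infty}J^n(B^{*,n})=V.$$ -/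

import Mathlib

open Filter Topology MeasureTheory ProbabilityTheory
open scoped ENNReal

noncomputable section

/-- Deterministic data of the sequence of `d`-class single-server queues. -/
structure QueueParams (d : ℕ) where
  /-- time horizon `T` -/
  T : ℝ
  /-- the sequence `b_n` -/
  b : ℕ → ℝ
  /-- arrival rates `λ^n_i` of the `n`-th system -/
  lamN : ℕ → Fin d → ℝ
  /-- service rates `μ^n_i` of the `n`-th system -/
  muN : ℕ → Fin d → ℝ
  /-- first order limits `λ_i`, `μ_i` -/
  lam : Fin d → ℝ
  mu : Fin d → ℝ
  /-- second order limits `λ̃_i`, `μ̃_i` -/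
  lamT : Fin d → ℝ
  muT : Fin d → ℝ
  /-- variances of the normalized interarrival and service times -/
  varIA : Fin d → ℝ
  varST : Fin d → ℝ
  /-- cost functions `C_i`; only their values on `[0, ∞)` matter -/
  C : Fin d → ℝ → ℝ

namespace QueueParams

variable {d : ℕ} (M : QueueParams d)

/-- Traffic intensity `ρ_i = λ_i / μ_i`. -/
def rho (i : Fin d) : ℝ := M.lam i / M.mu i

/-- `θ_i = 1 / μ_i`. -/
def theta (i : Fin d) : ℝ := (M.mu i)⁻¹

/-- `y_i = λ̃_i - ρ_i μ̃_i`. -/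
def y (i : Fin d) : ℝ := M.lamT i - M.rho i * M.muT i

/-- The moderate deviation scaling factor `b_n √n`. -/
def scale (n : ℕ) : ℝ := M.b n * Real.sqrt n

/-- Derivative `C_i'` on `[0, ∞)` (one-sided at `0`). -/
def dC (i : Fin d) (x : ℝ) : ℝ := derivWithin (M.C i) (Set.Ici 0) x

/-- Total cost `C(x) = ∑ C_i(x_i)`. -/
def cost (x : Fin d → ℝ) : ℝ := ∑ i, M.C i (x i)

/-- Moderate deviation heavy traffic (critical load) conditions on the parameters. -/
structure HeavyTraffic : Prop where
  T_pos : 0 < M.T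
  b_pos : ∀ n, 1 ≤ n → 0 < M.b n
  b_tendsto : Tendsto M.b atTop atTop
  b_div_sqrt : Tendsto (fun n : ℕ => M.b n / Real.sqrt n) atTop (𝓝 0)
  lamN_pos : ∀ n, 1 ≤ n → ∀ i, 0 < M.lamN n i
  muN_pos : ∀ n, 1 ≤ n → ∀ i, 0 < M.muN n i
  lam_pos : ∀ i, 0 < M.lam i
  mu_pos : ∀ i, 0 < M.mu i
  lam_lim : ∀ i, Tendsto (fun n : ℕ => M.lamN n i / n) atTop (𝓝 (M.lam i))
  mu_lim : ∀ i, Tendsto (fun n : ℕ => M.muN n i / n) atTop (𝓝 (M.mu i))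
  lamT_lim : ∀ i,
    Tendsto (fun n : ℕ => (M.lamN n i - n * M.lam i) / M.scale n) atTop (𝓝 (M.lamT i))
  muT_lim : ∀ i,
    Tendsto (fun n : ℕ => (M.muN n i - n * M.mu i) / M.scale n) atTop (𝓝 (M.muT i))
  critical : ∑ i, M.rho i = 1

/-- Conditions on the cost functions `C_i : [0, ∞) → [0, ∞)`. -/
structure CostConditions : Prop where
  strictMono : ∀ i, StrictMonoOn (M.C i) (Set.Ici 0)
  strictConvex : ∀ i, StrictConvexOn ℝ (Set.Ici 0) (M.C i)
  nonneg : ∀ i x, 0 ≤ x → 0 ≤ M.C i x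
  contDiff : ∀ i, ContDiffOn ℝ 1 (M.C i) (Set.Ici 0)
  zero : ∀ i, M.C i 0 = 0
  deriv_zero : ∀ i, M.dC i 0 = 0
  linear_growth : ∃ u : ℝ, ∀ i x, 0 ≤ x → M.C i x ≤ u * x

end QueueParams

/-- `d` independent sequences of i.i.d. positive square integrable random variables; those of the
`i`-th sequence have mean `1` and variance `v i`. -/
structure IsRenewalInput {Ω : Type*} [MeasurableSpace Ω] (Pr : Measure Ω) {d : ℕ}
    (X : Fin d → ℕ → Ω → ℝ) (v : Fin d → ℝ) : Prop where
  measurable : ∀ i l, Measurable (X i l)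
  pos : ∀ i l, ∀ᵐ ω ∂Pr, 0 < X i l ω
  indep : iIndepFun (fun p : Fin d × ℕ => X p.1 p.2) Pr
  ident : ∀ i l, IdentDistrib (X i l) (X i 0) Pr Pr
  memLp : ∀ i l, MemLp (X i l) 2 Pr
  mean : ∀ i l, ∫ ω, X i l ω ∂Pr = 1
  var : ∀ i l, variance (X i l) Pr = v i

/-- Renewal counting function `sup {l ≥ 0 : ∑_{k=1}^l X(k) / r ≤ t}` (the sequence `X` is indexed
from `0`). -/
def renewalCount (r : ℝ) (X : ℕ → ℝ) (t : ℝ) : ℕ :=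
  sSup {l : ℕ | ∑ k ∈ Finset.range l, X k / r ≤ t}

/-! ### The controlled queue, for one sample of the primitive data -/

namespace QueueParams

variable {d : ℕ} (M : QueueParams d)

/-- Arrival counts `A^n_i(t)`; `ia i` is the sequence of class-`i` interarrival times. -/
def arr (n : ℕ) (ia : Fin d → ℕ → ℝ) (t : ℝ) (i : Fin d) : ℝ :=
  renewalCount (M.lamN n i) (ia i) t

/-- Potential service counts `S^n_i(t)`; `st i` is the sequence of class-`i` service times. -/
def srv (n : ℕ) (st : Fin d → ℕ → ℝ) (t : ℝ) (i : Fin d) : ℝ :=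
  renewalCount (M.muN n i) (st i) t

/-- Cumulative effort `T^n_i(t) = ∫_0^t B_i(s) ds`. -/
def effort (B : ℝ → Fin d → ℝ) (t : ℝ) (i : Fin d) : ℝ := ∫ s in (0 : ℝ)..t, B s i

/-- Departure counts `D^n_i(t) = S^n_i(T^n_i(t))`. -/
def dep (n : ℕ) (st : Fin d → ℕ → ℝ) (B : ℝ → Fin d → ℝ) (t : ℝ) (i : Fin d) : ℝ :=
  M.srv n st (effort B t i) i

/-- Queue lengths `Q^n_i(t) = A^n_i(t) - D^n_i(t)`. -/
def queue (n : ℕ) (ia st : Fin d → ℕ → ℝ) (B : ℝ → Fin d → ℝ) (t : ℝ) (i : Fin d) : ℝ :=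
  M.arr n ia t i - M.dep n st B t i

/-- Scaled queue lengths `Q̃^n`. -/
def queueT (n : ℕ) (ia st : Fin d → ℕ → ℝ) (B : ℝ → Fin d → ℝ) (t : ℝ) (i : Fin d) : ℝ :=
  M.queue n ia st B t i / M.scale n

/-- Centered and scaled arrivals `Ã^n`. -/
def arrT (n : ℕ) (ia : Fin d → ℕ → ℝ) (t : ℝ) (i : Fin d) : ℝ :=
  (M.arr n ia t i - M.lamN n i * t) / M.scale n

/-- Centered and scaled potential services `S̃^n`. -/
def srvT (n : ℕ) (st : Fin d → ℕ → ℝ) (t : ℝ) (i : Fin d) : ℝ :=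
  (M.srv n st t i - M.muN n i * t) / M.scale n

/-- The region `𝒬_i`: nonzero `q ∈ ℝ_+^d` for which `i` is the smallest maximizer of
`j ↦ μ_j C_j'(q_j)`. -/
def region (i : Fin d) : Set (Fin d → ℝ) :=
  {q | (∀ j, 0 ≤ q j) ∧ q ≠ 0 ∧ (∀ j, M.mu j * M.dC j (q j) ≤ M.mu i * M.dC i (q i)) ∧
    ∀ j, j < i → M.mu j * M.dC j (q j) < M.mu i * M.dC i (q i)}

end QueueParams

/-- Right-continuity with finite left limits on `[0, ∞)`. -/
def IsRCLL {E : Type*} [TopologicalSpace E] (f : ℝ → E) : Prop :=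
  (∀ t, 0 ≤ t → ContinuousWithinAt f (Set.Ici t) t) ∧
    ∀ t, 0 < t → ∃ l, Tendsto f (𝓝[<] t) (𝓝 l)

/-! ### Control processes -/

section Controls

variable {Ω : Type*} {d : ℕ} (M : QueueParams d)

/-- The information `σ{A^n_i(s), S^n_i(T^n_i(s)) : i, s ≤ t}` generated under the control `B`. -/
abbrev infoSigma (IA ST : Fin d → ℕ → Ω → ℝ) (n : ℕ) (B : Ω → ℝ → Fin d → ℝ) (t : ℝ) :
    MeasurableSpace Ω :=
  ⨆ s ∈ Set.Icc (0 : ℝ) t, ⨆ i : Fin d,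
    MeasurableSpace.comap (fun ω => M.arr n (fun j l => IA j l ω) s i) inferInstance ⊔
    MeasurableSpace.comap (fun ω => M.dep n (fun j l => ST j l ω) (B ω) s i) inferInstance

variable [MeasurableSpace Ω] (Pr : Measure Ω)

/-- Admissible controls of the `n`-th system. Path properties hold almost surely and the control
is adapted up to null sets. -/
structure IsAdmissible (IA ST : Fin d → ℕ → Ω → ℝ) (n : ℕ) (B : Ω → ℝ → Fin d → ℝ) :
    Prop where
  aemeasurable : ∀ t, 0 ≤ t → AEMeasurable (fun ω => B ω t) Pr
  rcll : ∀ᵐ ω ∂Pr, IsRCLL (B ω)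
  mem_simplex : ∀ᵐ ω ∂Pr, ∀ t, 0 ≤ t → (∀ i, 0 ≤ B ω t i) ∧ ∑ i, B ω t i ≤ 1
  adapted : ∀ t, 0 ≤ t →
    ∃ g : Ω → Fin d → ℝ, Measurable[infoSigma M IA ST n B t] g ∧ (fun ω => B ω t) =ᵐ[Pr] g
  idle_empty : ∀ᵐ ω ∂Pr, ∀ t, 0 ≤ t → ∀ i,
    M.queue n (fun j l => IA j l ω) (fun j l => ST j l ω) (B ω) t i = 0 → B ω t i = 0

open Classical in
/-- `B` is the preemptive generalized `cμ` rule of the `n`-th system: almost surely,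
`B_i(t) = 1{Q̃^n(t) ∈ 𝒬_i}` for all `t ≥ 0` and `i`, where `Q̃^n` is the scaled queue length
produced by `B` itself. -/
def IsGenCMuRule (IA ST : Fin d → ℕ → Ω → ℝ) (n : ℕ) (B : Ω → ℝ → Fin d → ℝ) : Prop :=
  ∀ᵐ ω ∂Pr, IsRCLL (B ω) ∧ ∀ t, 0 ≤ t → ∀ i,
    B ω t i =
      if M.queueT n (fun j l => IA j l ω) (fun j l => ST j l ω) (B ω) t ∈ M.region i
      then 1 else 0

/-- The risk-sensitive cost `J^n(B) = b_n⁻² log 𝔼 exp (b_n² ∫_0^T C(Q̃^n(t)) dt)`, with values in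
the extended reals. -/
def riskCost (IA ST : Fin d → ℕ → Ω → ℝ) (n : ℕ) (B : Ω → ℝ → Fin d → ℝ) : EReal :=
  (((M.b n ^ 2)⁻¹ : ℝ) : EReal) * ENNReal.log (∫⁻ ω, ENNReal.ofReal (Real.exp (M.b n ^ 2 *
    ∫ t in (0 : ℝ)..M.T,
      M.cost (M.queueT n (fun j l => IA j l ω) (fun j l => ST j l ω) (B ω) t))) ∂Pr)

end Controls

/-! ### The Skorokhod space and the rate function -/

/-- `𝒟([0,T], E)`: right-continuous functions with left limits. -/
structure SkorokhodPath (T : ℝ) (E : Type*) [TopologicalSpace E] where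
  toFun : Set.Icc (0 : ℝ) T → E
  right_cont : ∀ t, ContinuousWithinAt toFun (Set.Ici t) t
  left_lim : ∀ t, ∃ l, Tendsto toFun (𝓝[<] t) (𝓝 l)

/-- `ψ'` lies in the open ball of radius `r` around `ψ` for the Skorokhod `J₁` metric
`inf_g max (sup_{s<t} |log ((g t - g s)/(t - s))|) (sup_t ‖ψ' t - ψ (g t)‖)`, the infimum being over
the increasing bijections `g` of `[0,T]`. (The induced topology does not depend on the choice of
the norm on a finite-dimensional `E`.) -/
def SkorokhodPath.InBall {T : ℝ} {E : Type*} [NormedAddCommGroup E]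
    (ψ : SkorokhodPath T E) (r : ℝ) (ψ' : SkorokhodPath T E) : Prop :=
  ∃ g : Set.Icc (0 : ℝ) T ≃o Set.Icc (0 : ℝ) T, ∃ c < r,
    (∀ s t : Set.Icc (0 : ℝ) T, s < t →
      |Real.log (((g t : ℝ) - (g s : ℝ)) / ((t : ℝ) - (s : ℝ)))| ≤ c) ∧
    ∀ t, ‖ψ'.toFun t - ψ.toFun (g t)‖ ≤ c

/-- The Skorokhod `J₁` topology. -/
instance SkorokhodPath.instTopologicalSpace {T : ℝ} {E : Type*} [NormedAddCommGroup E] :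
    TopologicalSpace (SkorokhodPath T E) where
  IsOpen G := ∀ ψ ∈ G, ∃ r > 0, ∀ ψ', ψ.InBall r ψ' → ψ' ∈ G
  isOpen_univ := fun _ _ => ⟨1, one_pos, fun _ _ => trivial⟩
  isOpen_inter := by
    intro G H hG hH ψ hψ
    obtain ⟨r, hr, h⟩ := hG ψ hψ.1
    obtain ⟨r', hr', h'⟩ := hH ψ hψ.2
    refine ⟨min r r', lt_min hr hr', ?_⟩
    rintro ψ' ⟨g, c, hc, h1, h2⟩
    exact ⟨h ψ' ⟨g, c, hc.trans_le (min_le_left _ _), h1, h2⟩,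
      h' ψ' ⟨g, c, hc.trans_le (min_le_right _ _), h1, h2⟩⟩
  isOpen_sUnion := by
    rintro S hS ψ ⟨G, hG, hψ⟩
    obtain ⟨r, hr, h⟩ := hS G hG ψ hψ
    exact ⟨r, hr, fun ψ' hψ' => ⟨G, hG, h ψ' hψ'⟩⟩

open Classical in
/-- A function on `[0,T]` as a function on `ℝ` (its values off `[0,T]` are irrelevant). -/
def extendZero {T : ℝ} {E : Type*} [Zero E] (f : Set.Icc (0 : ℝ) T → E) (t : ℝ) : E :=
  if h : t ∈ Set.Icc (0 : ℝ) T then f ⟨t, h⟩ else 0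

/-- `ψ(0) = 0` and `ψ` is absolutely continuous on `[0,T]`. -/
def IsAC₀ {T : ℝ} {d : ℕ} (ψ : Set.Icc (0 : ℝ) T → Fin d → ℝ) : Prop :=
  (∀ t : Set.Icc (0 : ℝ) T, (t : ℝ) = 0 → ψ t = 0) ∧
    AbsolutelyContinuousOnInterval (extendZero ψ) 0 T

open Classical in
/-- `∑_i (1 / (2 v_i)) ∫_0^T ψ̇_i² ds` if `ψ ∈ 𝒜𝒞₀`, and `∞` otherwise. If `v_i = 0`, the `i`-th term
is `0` or `∞` according to whether `ψ̇_i` vanishes a.e. or not (in `[0,∞]`, `0 / 0 = 0` and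
`x / 0 = ∞` for `x > 0`). -/
def rateOne {T : ℝ} {d : ℕ} (v : Fin d → ℝ) (ψ : Set.Icc (0 : ℝ) T → Fin d → ℝ) : ℝ≥0∞ :=
  if IsAC₀ ψ then
    ∑ i, (∫⁻ s in Set.Icc (0 : ℝ) T,
        ENNReal.ofReal (deriv (fun t => extendZero ψ t i) s ^ 2)) / ENNReal.ofReal (2 * v i)
  else ∞

namespace QueueParams

variable {d : ℕ} (M : QueueParams d)

/-- The rate function `𝕀(ψ) = 𝕀₁(ψ⁽¹⁾) + 𝕀₂(ψ⁽²⁾)`, with variance parameters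
`λ_i σ²_{IA,i}` and `μ_i σ²_{ST,i}`. -/
def rate (ψ : Set.Icc (0 : ℝ) M.T → (Fin d → ℝ) × (Fin d → ℝ)) : ℝ≥0∞ :=
  rateOne (fun i => M.lam i * M.varIA i) (fun t => (ψ t).1) +
    rateOne (fun i => M.mu i * M.varST i) (fun t => (ψ t).2)

end QueueParams

section Assumptions

variable {Ω : Type*} [MeasurableSpace Ω] (Pr : Measure Ω) {d : ℕ} (M : QueueParams d)
  (IA ST : Fin d → ℕ → Ω → ℝ)

/-- The event `{(Ã^n, S̃^n) ∈ G}` for a set `G` of paths in `𝒟([0,T], ℝ^{2d})`. -/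
def pathEvent (n : ℕ) (G : Set (SkorokhodPath M.T ((Fin d → ℝ) × (Fin d → ℝ)))) : Set Ω :=
  {ω | ∃ ψ ∈ G, ∀ t : Set.Icc (0 : ℝ) M.T,
    ψ.toFun t = (M.arrT n (fun j l => IA j l ω) t, M.srvT n (fun j l => ST j l ω) t)}

/-- `(Ã^n, S̃^n)` satisfies the large deviation principle with speed `b_n⁻²` and rate function `𝕀` in
`𝒟([0,T], ℝ^{2d})`. -/
def ModerateLDP : Prop :=
  (∀ G : Set (SkorokhodPath M.T ((Fin d → ℝ) × (Fin d → ℝ))), IsOpen G →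
    -(⨅ ψ ∈ G, (M.rate ψ.toFun : EReal)) ≤
      liminf (fun n : ℕ => (((M.b n ^ 2)⁻¹ : ℝ) : EReal) *
        ENNReal.log (Pr (pathEvent M IA ST n G))) atTop) ∧
  (∀ F : Set (SkorokhodPath M.T ((Fin d → ℝ) × (Fin d → ℝ))), IsClosed F →
    limsup (fun n : ℕ => (((M.b n ^ 2)⁻¹ : ℝ) : EReal) *
        ENNReal.log (Pr (pathEvent M IA ST n F))) atTop ≤
      -(⨅ ψ ∈ F, (M.rate ψ.toFun : EReal)))

/-- `‖f‖_T = sup_{t ∈ [0,T]} ‖f(t)‖` with the Euclidean norm. -/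
def supNorm (T : ℝ) (f : ℝ → Fin d → ℝ) : ℝ :=
  ⨆ t : Set.Icc (0 : ℝ) T, Real.sqrt (∑ i, f t i ^ 2)

/-- For every constant `u`,
`limsup_n b_n⁻² log 𝔼 exp (b_n² u (‖Ã^n‖_T + ‖S̃^n‖_T)) < ∞`. -/
def ExpMomentBound : Prop :=
  ∀ u : ℝ, limsup (fun n : ℕ => (((M.b n ^ 2)⁻¹ : ℝ) : EReal) *
    ENNReal.log (∫⁻ ω, ENNReal.ofReal (Real.exp (M.b n ^ 2 * u *
      (supNorm M.T (M.arrT n (fun j l => IA j l ω)) +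
        supNorm M.T (M.srvT n (fun j l => ST j l ω))))) ∂Pr)) atTop < ⊤

end Assumptions

/-! ### The differential game -/

namespace QueueParams

variable {d : ℕ} (M : QueueParams d)

/-- `𝒫 = 𝒞₀([0,T], ℝ^{2d})` with the uniform topology. -/
abbrev PathP : Type :=
  {ψ : C(Set.Icc (0 : ℝ) M.T, (Fin d → ℝ) × (Fin d → ℝ)) //
    ∀ t : Set.Icc (0 : ℝ) M.T, (t : ℝ) = 0 → ψ t = 0}

/-- `ℰ`: continuous `ζ` with `θ · ζ` starting from zero and nondecreasing; uniform topology. -/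
abbrev PathE : Type :=
  {ζ : C(Set.Icc (0 : ℝ) M.T, Fin d → ℝ) //
    (∀ t : Set.Icc (0 : ℝ) M.T, (t : ℝ) = 0 → ∑ i, M.theta i * ζ t i = 0) ∧
    Monotone fun t => ∑ i, M.theta i * ζ t i}

/-- The time change `ρ[ψ]_i(t) = ψ_i(ρ_i t)`. -/
def rhoMap (ψ : Set.Icc (0 : ℝ) M.T → Fin d → ℝ) (t : Set.Icc (0 : ℝ) M.T) (i : Fin d) : ℝ :=
  extendZero ψ (M.rho i * t) i

/-- The dynamics `φ = y ι + ψ⁽¹⁾ - ρ[ψ⁽²⁾] + ζ`. -/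
def dynamics (ψ : M.PathP) (ζ : M.PathE) (t : Set.Icc (0 : ℝ) M.T) (i : Fin d) : ℝ :=
  M.y i * t + (ψ.1 t).1 i - M.rhoMap (fun s => (ψ.1 s).2) t i + ζ.1 t i

/-- Strategies: Borel measurable causal maps `𝒫 → ℰ`. -/
structure IsStrategy (α : M.PathP → M.PathE) : Prop where
  measurable : Measurable[borel M.PathP, borel M.PathE] α
  causal : ∀ (ψ ψ' : M.PathP) (t : Set.Icc (0 : ℝ) M.T),
    (∀ s ≤ t, (ψ.1 s).1 = (ψ'.1 s).1 ∧
      M.rhoMap (fun r => (ψ.1 r).2) s = M.rhoMap (fun r => (ψ'.1 r).2) s) →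
    ∀ s ≤ t, (α ψ).1 s = (α ψ').1 s

/-- Admissible strategies keep the dynamics nonnegative. -/
def IsAdmissibleStrategy (α : M.PathP → M.PathE) : Prop :=
  M.IsStrategy α ∧ ∀ ψ t i, 0 ≤ M.dynamics ψ (α ψ) t i

/-- The payoff `c(ψ,ζ) = ∫_0^T C(φ(t)) dt - 𝕀(ψ)`. -/
def gameCost (ψ : M.PathP) (ζ : M.PathE) : EReal :=
  ((∫ t in (0 : ℝ)..M.T, M.cost (extendZero (M.dynamics ψ ζ) t) : ℝ) : EReal) -
    (M.rate ψ.1 : EReal)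

/-- The value `V = inf_α sup_ψ c(ψ, α[ψ])` of the game. -/
def gameValue : EReal :=
  ⨅ α : {α : M.PathP → M.PathE // M.IsAdmissibleStrategy α}, ⨆ ψ : M.PathP,
    M.gameCost ψ (α.1 ψ)

end QueueParams

end

/-! ### Last exit times and counting functions -/

/-! The workload, that is the `θ`-weighted sum of the queue lengths, reduces the problem to one
dimension. Since the traffic intensities sum to one, the large drifts of the classes cancel in it,
and what remains is the free fluctuation plus a multiple of the accumulated idle time. Under a rule
that never idles while work is present, the idle time grows only at zero workload, so the workload
is the Skorokhod reflection of its free part (`IsCMuPath.workload_eq_reflected`). In the game,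
minimality of the reflection shows that no admissible strategy achieves a smaller workload.

For a fixed workload, the cheapest distribution over the classes equalizes the marginal costs `μ_i
C_i'` (`IsOptimalAlloc.marg_le`); this allocation and its cost increase with the workload. Hence the
strategy that reflects the workload and distributes it optimally is best against every path
separately, no exchange of infimum and supremum is needed, and the value is the supremum over paths
of optimal cost minus rate (`gameValue_eq_pathValue`).

The generalized `cμ` rule imitates this strategy by state space collapse. A class below its optimal
share has a smaller marginal cost than some other class (`exists_marg_lt`), so it is not served and
its queue grows at a rate of order `r = √n / b_n`, which tends to infinity; deficits therefore close
almost instantly (`IsCMuPath.alloc_sub_le`). The same large factor forces the cumulative efforts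
towards `ρ_i t`, which produces the time change in the game. The resulting tracking estimate
`exists_abs_sub_alloc_reflected_le` is deterministic and uniform over paths with a common modulus `κ
+ L |t - s|`, and sublevel sets of the rate function have such moduli for every `κ`.

The limit of the risk-sensitive costs then follows by a Varadhan argument. The lower bound looks at
samples near one almost optimal path; the upper bound slices the cost into levels, bounds each level
by the large deviation principle (`eventually_measure_le_sampleCost`) and controls the tail by the
exponential moments. The control itself is built event by event; unit jumps and finitely many events
in bounded time give existence, uniqueness, measurability and nonnegative queues. -/

theorem exists_last_time {P : ℝ → Prop} (h0 : P 0) {t : ℝ} (ht : 0 ≤ t) :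
    ∃ τ, 0 ≤ τ ∧ τ ≤ t ∧ (∀ u, τ < u → u ≤ t → ¬ P u) ∧
      ∀ η > 0, ∃ s, 0 ≤ s ∧ s ≤ τ ∧ τ - η < s ∧ P s := by
  -- `P` is not assumed closed, so the supremum of this set need not satisfy `P`; only approximation
  -- from the left is available. The applications compensate by Lipschitz continuity of the effort.
  set A : Set ℝ := {s | 0 ≤ s ∧ s ≤ t ∧ P s}
  have hne : A.Nonempty := ⟨0, le_rfl, ht, h0⟩
  have hbdd : BddAbove A := ⟨t, fun s hs => hs.2.1⟩
  refine ⟨sSup A, le_csSup hbdd ⟨le_rfl, ht, h0⟩, csSup_le hne fun s hs => hs.2.1, ?_, ?_⟩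
  · intro u hu hut hP
    have h1 : 0 ≤ sSup A := le_csSup hbdd ⟨le_rfl, ht, h0⟩
    exact absurd (le_csSup hbdd (show u ∈ A from ⟨by linarith, hut, hP⟩)) (not_le.2 hu)
  · intro η hη
    obtain ⟨s, hs, hlt⟩ := exists_lt_of_lt_csSup hne (show sSup A - η < sSup A by linarith)
    exact ⟨s, hs.1, le_csSup hbdd hs, hlt, hs.2.2⟩

/-- Counting functions with unit jumps, started at zero. -/
structure IsCounting (N : ℝ → ℕ) : Prop where
  mono : Monotone N
  zero : N 0 = 0
  right_const : ∀ t, 0 ≤ t → ∃ ε > 0, ∀ s, t ≤ s → s < t + ε → N s = N t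
  -- Unit jumps, phrased without left limits: values at most `m` arbitrarily close before `v` leave
  -- at most `m + 1` at `v`.
  jump : ∀ v m, 0 ≤ v → (∀ η > 0, ∃ u, v - η < u ∧ N u ≤ m) → N v ≤ m + 1

/-- Positive sequences with divergent partial sums. -/
structure IsRenewalSeq (X : ℕ → ℝ) : Prop where
  pos : ∀ k, 0 < X k
  tendsto : Tendsto (fun m => ∑ k ∈ Finset.range m, X k) atTop atTop

namespace IsRenewalSeq

variable {X : ℕ → ℝ} {r : ℝ}

theorem sum_div_strictMono (hX : IsRenewalSeq X) (hr : 0 < r) :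
    StrictMono fun m => ∑ k ∈ Finset.range m, X k / r := by
  refine strictMono_nat_of_lt_succ fun m => ?_
  rw [Finset.sum_range_succ]
  linarith [div_pos (hX.pos m) hr]

theorem bddAbove (hX : IsRenewalSeq X) (hr : 0 < r) (t : ℝ) :
    BddAbove {l : ℕ | ∑ k ∈ Finset.range l, X k / r ≤ t} := by
  obtain ⟨m, hm⟩ := (hX.tendsto.eventually_gt_atTop (t * r)).exists
  refine ⟨m, fun l hl => ?_⟩
  by_contra hlt
  have h1 := (hX.sum_div_strictMono hr).monotone (not_le.1 hlt).le
  simp only [← Finset.sum_div] at h1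
  have h2 : (∑ k ∈ Finset.range l, X k) / r ≤ t := by
    rw [Finset.sum_div]; exact hl
  have h3 := (div_le_iff₀ hr).1 (h1.trans h2)
  linarith

/-- The partial sums increase strictly, so the set of admissible indices is an initial segment. The
case `m = 0`, `t < 0` is excluded because the set is then empty and `sSup` takes the default value
`0`. -/
theorem le_renewalCount_iff (hX : IsRenewalSeq X) (hr : 0 < r) {m : ℕ} {t : ℝ}
    (hm : 1 ≤ m ∨ 0 ≤ t) :
    m ≤ renewalCount r X t ↔ ∑ k ∈ Finset.range m, X k / r ≤ t := by
  unfold renewalCount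
  constructor
  · intro h
    rcases Set.eq_empty_or_nonempty {l : ℕ | ∑ k ∈ Finset.range l, X k / r ≤ t} with he | hne
    · rw [he] at h
      simp only [csSup_empty, bot_eq_zero', nonpos_iff_eq_zero] at h
      subst h
      simpa using hm
    · have h1 := Nat.sSup_mem hne (hX.bddAbove hr t)
      exact ((hX.sum_div_strictMono hr).monotone h).trans h1
  · intro h
    exact le_csSup (hX.bddAbove hr t) h

theorem renewalCount_lt_iff (hX : IsRenewalSeq X) (hr : 0 < r) {m : ℕ} {t : ℝ}
    (hm : 1 ≤ m ∨ 0 ≤ t) :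
    renewalCount r X t < m ↔ t < ∑ k ∈ Finset.range m, X k / r := by
  rw [← not_le, ← not_le, hX.le_renewalCount_iff hr hm]

theorem isCounting (hX : IsRenewalSeq X) (hr : 0 < r) : IsCounting (renewalCount r X) := by
  have hmono : Monotone (renewalCount r X) := by
    intro s t hst
    rcases Nat.eq_zero_or_pos (renewalCount r X s) with h | h
    · omega
    · rw [hX.le_renewalCount_iff hr (Or.inl h)]
      exact ((hX.le_renewalCount_iff hr (Or.inl h)).1 le_rfl).trans hst
  refine ⟨hmono, ?_, ?_, ?_⟩
  · have h : renewalCount r X 0 < 1 := by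
      rw [hX.renewalCount_lt_iff hr (Or.inl le_rfl)]
      simpa using div_pos (hX.pos 0) hr
    omega
  · intro t ht
    have h := (hX.renewalCount_lt_iff hr (m := renewalCount r X t + 1) (t := t)
      (Or.inl (by omega))).1 (by omega)
    refine ⟨_, sub_pos.2 h, fun s hts hs => le_antisymm ?_ (hmono hts)⟩
    have h2 := (hX.renewalCount_lt_iff hr (m := renewalCount r X t + 1) (t := s)
      (Or.inl (by omega))).2 (by linarith)
    omega
  · intro v m hv h
    have h1 : v ≤ ∑ k ∈ Finset.range (m + 1), X k / r := by
      by_contra hlt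
      obtain ⟨u, hu, hum⟩ := h _ (sub_pos.2 (not_le.1 hlt))
      have h2 := (hX.le_renewalCount_iff hr (m := m + 1) (t := u) (Or.inl (by omega))).2
        (by linarith)
      omega
    -- Positivity of the next increment rules out a double jump: the renewal epoch `m + 2` lies
    -- strictly after `v`.
    have h3 := (hX.sum_div_strictMono hr) (Nat.lt_succ_self (m + 1))
    have h4 := (hX.renewalCount_lt_iff hr (m := m + 2) (t := v) (Or.inl (by omega))).2
      (lt_of_le_of_lt h1 h3)
    omega

end IsRenewalSeq

/-- A sample of the primitive data with positive entries and divergent partial sums. -/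
def IsRenewalSample {d : ℕ} (x : Fin d → ℕ → ℝ) : Prop := ∀ i, IsRenewalSeq (x i)

/-- By the strong law the averages tend to one, so the partial sums diverge almost surely. -/
theorem IsRenewalInput.ae_isRenewalSample {Ω : Type*} [MeasurableSpace Ω] {Pr : Measure Ω}
    [IsProbabilityMeasure Pr] {d : ℕ} {X : Fin d → ℕ → Ω → ℝ} {v : Fin d → ℝ}
    (h : IsRenewalInput Pr X v) : ∀ᵐ ω ∂Pr, IsRenewalSample fun i l => X i l ω := by
  unfold IsRenewalSample
  rw [ae_all_iff]
  intro i
  have hpos : ∀ᵐ ω ∂Pr, ∀ l, 0 < X i l ω := ae_all_iff.2 (h.pos i)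
  have hlln := strong_law_ae_real (μ := Pr) (X i)
    ((h.memLp i 0).integrable (by norm_num))
    (fun k l hkl => h.indep.indepFun (i := (i, k)) (j := (i, l)) (by simpa using hkl)) (h.ident i)
  filter_upwards [hpos, hlln] with ω h1 h2
  refine ⟨h1, ?_⟩
  rw [h.mean i 0] at h2
  have h3 : Tendsto (fun m : ℕ => (m : ℝ) * ((∑ k ∈ Finset.range m, X i k ω) / m)) atTop atTop :=
    tendsto_natCast_atTop_atTop.atTop_mul_pos one_pos h2
  refine h3.congr' ?_
  filter_upwards [eventually_gt_atTop 0] with m hm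
  field_simp

/-- The time is allowed to be random: the count reaches `m` exactly when the `m`-th partial sum is
at most `τ`, and this event compares two measurable functions. Service counts are later evaluated at
random efforts. -/
theorem measurable_renewalCount {α : Type*} [MeasurableSpace α] {X : ℕ → α → ℝ} {r : ℝ}
    (hr : 0 < r) (hX : ∀ k, Measurable (X k)) (hren : ∀ a, IsRenewalSeq fun k => X k a)
    {τ : α → ℝ} (hτ : Measurable τ) :
    Measurable fun a => renewalCount r (fun k => X k a) (τ a) := by
  refine measurable_of_Ici fun m => ?_
  rcases Nat.eq_zero_or_pos m with rfl | hm
  · simp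
  · have : (fun a => renewalCount r (fun k => X k a) (τ a)) ⁻¹' Set.Ici m =
        {a | ∑ k ∈ Finset.range m, X k a / r ≤ τ a} := by
      ext a
      exact (hren a).le_renewalCount_iff hr (Or.inl hm)
    rw [this]
    exact measurableSet_le (Finset.measurable_sum _ fun k _ => (hX k).div_const r) hτ

/-! ### The cost functions and the optimal allocation of workload -/

namespace QueueParams

variable {d : ℕ} {M : QueueParams d}

theorem HeavyTraffic.theta_pos (hM : M.HeavyTraffic) (i : Fin d) : 0 < M.theta i :=
  inv_pos.2 (hM.mu_pos i)

theorem HeavyTraffic.mu_mul_theta (hM : M.HeavyTraffic) (i : Fin d) :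
    M.mu i * M.theta i = 1 := mul_inv_cancel₀ (hM.mu_pos i).ne'

theorem HeavyTraffic.rho_pos (hM : M.HeavyTraffic) (i : Fin d) : 0 < M.rho i :=
  div_pos (hM.lam_pos i) (hM.mu_pos i)

theorem HeavyTraffic.rho_le_one (hM : M.HeavyTraffic) (i : Fin d) : M.rho i ≤ 1 := by
  rw [← hM.critical]
  exact Finset.single_le_sum (fun j _ => (hM.rho_pos j).le) (Finset.mem_univ i)

theorem HeavyTraffic.nonempty (hM : M.HeavyTraffic) : Nonempty (Fin d) := by
  by_contra h
  rw [not_nonempty_iff] at h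
  have := hM.critical
  simp at this

theorem CostConditions.differentiableOn (hC : M.CostConditions) (i : Fin d) :
    DifferentiableOn ℝ (M.C i) (Set.Ici 0) :=
  (hC.contDiff i).differentiableOn one_ne_zero

theorem CostConditions.dC_continuousOn (hC : M.CostConditions) (i : Fin d) :
    ContinuousOn (M.dC i) (Set.Ici 0) :=
  (hC.contDiff i).continuousOn_derivWithin (uniqueDiffOn_Ici 0) le_rfl

theorem CostConditions.dC_strictMonoOn (hC : M.CostConditions) (i : Fin d) :
    StrictMonoOn (M.dC i) (Set.Ici 0) :=
  (hC.strictConvex i).strictMonoOn_derivWithin (hC.differentiableOn i)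

theorem CostConditions.dC_pos_iff (hC : M.CostConditions) (i : Fin d) {x : ℝ} (hx : 0 ≤ x) :
    0 < M.dC i x ↔ 0 < x := by
  have h := (hC.dC_strictMonoOn i).lt_iff_lt Set.self_mem_Ici (Set.mem_Ici.2 hx)
  rwa [hC.deriv_zero i] at h

/-- A common Lipschitz constant of the cost functions. -/
theorem CostConditions.exists_lipschitz (hC : M.CostConditions) :
    ∃ u : ℝ, 0 ≤ u ∧ ∀ i x y, 0 ≤ x → 0 ≤ y → |M.C i x - M.C i y| ≤ u * |x - y| := by
  obtain ⟨u, hu⟩ := hC.linear_growth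
  refine ⟨max u 0, le_max_right _ _, ?_⟩
  have key : ∀ i x y, 0 ≤ x → x < y → |M.C i x - M.C i y| ≤ max u 0 * |x - y| := by
    intro i x y hx hxy
    have hmono := (hC.strictMono i) (Set.mem_Ici.2 hx) (Set.mem_Ici.2 (hx.trans hxy.le)) hxy
    rw [abs_sub_comm, abs_of_pos (sub_pos.2 hmono), abs_sub_comm, abs_of_pos (sub_pos.2 hxy)]
    rw [← div_le_iff₀ (sub_pos.2 hxy)]
    set S := (M.C i y - M.C i x) / (y - x) with hS
    have hSpos : 0 < S := div_pos (sub_pos.2 hmono) (sub_pos.2 hxy)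
    by_contra hlt
    push Not at hlt
    have hSu : u < S := lt_of_le_of_lt (le_max_left _ _) hlt
    -- If a chord had slope `S > u`, convexity would give `C z ≥ S (z - y)`, which exceeds the
    -- linear bound `u z` as soon as `z > S y / (S - u)`.
    set z := max (y + 1) (S * y / (S - u) + 1)
    have hz1 : y + 1 ≤ z := le_max_left _ _
    have hz2 : S * y / (S - u) + 1 ≤ z := le_max_right _ _
    have h1 := (hC.strictConvex i).convexOn.slope_mono_adjacent (Set.mem_Ici.2 hx)
      (Set.mem_Ici.2 (by linarith : (0 : ℝ) ≤ z)) hxy (by linarith : y < z)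
    rw [← hS, le_div_iff₀ (by linarith)] at h1
    have h2 := hu i z (by linarith)
    have h3 := hC.nonneg i y (by linarith)
    have h4 : S * y / (S - u) < z := by linarith
    rw [div_lt_iff₀ (by linarith)] at h4
    nlinarith
  intro i x y hx hy
  rcases lt_trichotomy x y with h | h | h
  · exact key i x y hx h
  · simp [h]
  · rw [abs_sub_comm, abs_sub_comm x y]
    exact key i y x hy h

theorem CostConditions.continuous_C_max (hC : M.CostConditions) (i : Fin d) :
    Continuous fun x => M.C i (max x 0) :=
  (hC.contDiff i).continuousOn.comp_continuous (continuous_id.max continuous_const)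
    fun _ => Set.mem_Ici.2 (le_max_right _ _)

variable (M) in
/-- The marginal cost `μ_i C_i'` as a function on the line. -/
noncomputable def marg (i : Fin d) (x : ℝ) : ℝ := M.mu i * M.dC i (max x 0)

theorem marg_of_nonneg (i : Fin d) {x : ℝ} (hx : 0 ≤ x) : M.marg i x = M.mu i * M.dC i x := by
  rw [marg, max_eq_left hx]

theorem CostConditions.marg_continuous (hC : M.CostConditions) (i : Fin d) :
    Continuous (M.marg i) :=
  ((hC.dC_continuousOn i).comp_continuous (continuous_id.max continuous_const)
    fun _ => Set.mem_Ici.2 (le_max_right _ _)).const_smul (M.mu i)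

theorem CostConditions.marg_zero (hC : M.CostConditions) (i : Fin d) : M.marg i 0 = 0 := by
  simp [marg, hC.deriv_zero]

theorem CostConditions.marg_lt_iff (hC : M.CostConditions) (hM : M.HeavyTraffic) (i : Fin d)
    {x y : ℝ} (hx : 0 ≤ x) (hy : 0 ≤ y) : M.marg i x < M.marg i y ↔ x < y := by
  rw [marg_of_nonneg i hx, marg_of_nonneg i hy, mul_lt_mul_iff_right₀ (hM.mu_pos i)]
  exact (hC.dC_strictMonoOn i).lt_iff_lt hx hy

theorem CostConditions.marg_le_iff (hC : M.CostConditions) (hM : M.HeavyTraffic) (i : Fin d)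
    {x y : ℝ} (hx : 0 ≤ x) (hy : 0 ≤ y) : M.marg i x ≤ M.marg i y ↔ x ≤ y := by
  rw [← not_lt, hC.marg_lt_iff hM i hy hx, not_lt]

variable (M) in
/-- `q` minimizes the cost among nonnegative vectors with workload `w`. -/
def IsOptimalAlloc (w : ℝ) (q : Fin d → ℝ) : Prop :=
  (∀ i, 0 ≤ q i) ∧ ∑ i, M.theta i * q i = w ∧
    ∀ q' : Fin d → ℝ, (∀ i, 0 ≤ q' i) → ∑ i, M.theta i * q' i = w → M.cost q ≤ M.cost q'

/-- The feasible vectors form a compact set, contained in the box with sides `[0, μ_i w]`. -/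
theorem exists_isOptimalAlloc (hM : M.HeavyTraffic) (hC : M.CostConditions) {w : ℝ}
    (hw : 0 ≤ w) : ∃ q, M.IsOptimalAlloc w q := by
  set K : Set (Fin d → ℝ) := {q | (∀ i, 0 ≤ q i) ∧ ∑ i, M.theta i * q i = w}
  have hK : IsCompact K := by
    refine IsCompact.of_isClosed_subset
      (isCompact_univ_pi fun i => isCompact_Icc (a := (0 : ℝ)) (b := M.mu i * w)) ?_ ?_
    · have h : K = Set.Ici 0 ∩ {q | ∑ i, M.theta i * q i = w} := by
        ext q
        rfl
      rw [h]
      exact isClosed_Ici.inter (isClosed_eq (by fun_prop) continuous_const)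
    · intro q hq i _
      refine ⟨hq.1 i, ?_⟩
      have h1 : M.theta i * q i ≤ w := by
        rw [← hq.2]
        exact Finset.single_le_sum (f := fun i => M.theta i * q i)
          (fun j _ => mul_nonneg (hM.theta_pos j).le (hq.1 j)) (Finset.mem_univ i)
      have h2 := mul_le_mul_of_nonneg_left h1 (hM.mu_pos i).le
      rwa [← mul_assoc, hM.mu_mul_theta, one_mul] at h2
  obtain ⟨i₀⟩ := hM.nonempty
  have hne : K.Nonempty := by
    refine ⟨fun i => if i = i₀ then M.mu i₀ * w else 0, fun i => ?_, ?_⟩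
    · dsimp only
      split_ifs
      · exact mul_nonneg (hM.mu_pos _).le hw
      · exact le_rfl
    · simp only [mul_ite, mul_zero, Finset.sum_ite_eq', Finset.mem_univ, if_true]
      rw [← mul_assoc, mul_comm (M.theta i₀), hM.mu_mul_theta, one_mul]
  have hcont : ContinuousOn M.cost K := by
    refine continuousOn_finsetSum _ fun i _ => ?_
    exact (hC.contDiff i).continuousOn.comp (continuous_apply i).continuousOn fun q hq => hq.1 i
  obtain ⟨q, hq, hmin⟩ := hK.exists_isMinOn hne hcont
  exact ⟨q, hq.1, hq.2, fun q' h1 h2 => hmin ⟨h1, h2⟩⟩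

/-- First-order condition: if class `i` had the larger marginal cost, shifting a little workload
from `i` to `j` would lower the cost. As `i` and `j` are arbitrary, all marginal costs agree. There
is no boundary case, because marginal costs vanish at zero. -/
theorem IsOptimalAlloc.marg_le (hM : M.HeavyTraffic) (hC : M.CostConditions) {w : ℝ}
    {q : Fin d → ℝ} (hq : M.IsOptimalAlloc w q) (i j : Fin d) :
    M.marg i (q i) ≤ M.marg j (q j) := by
  by_contra hlt
  push Not at hlt
  have hij : i ≠ j := by
    rintro rfl
    exact lt_irrefl _ hlt
  have hqi : 0 < q i := by
    rcases (hq.1 i).lt_or_eq with h | h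
    · exact h
    · have h1 : 0 ≤ M.marg j (q j) := by
        rw [← hC.marg_zero j]
        exact (hC.marg_le_iff hM j le_rfl (hq.1 j)).2 (hq.1 j)
      rw [← h, hC.marg_zero] at hlt
      linarith
  -- By continuity the strict order of the marginals survives a small shift; the derivatives at the
  -- shifted endpoints then bound the loss and the gain by convexity.
  have hev : ∀ᶠ t in 𝓝[>] (0 : ℝ), M.marg j (q j + M.mu j * t) < M.marg i (q i - M.mu i * t) ∧
      0 < q i - M.mu i * t := by
    refine Filter.Eventually.filter_mono nhdsWithin_le_nhds (Filter.Eventually.and ?_ ?_)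
    · refine ContinuousAt.eventually_lt ?_ ?_ (by simpa using hlt)
      · exact ((hC.marg_continuous j).comp (by fun_prop :
          Continuous fun t => q j + M.mu j * t)).continuousAt
      · exact ((hC.marg_continuous i).comp (by fun_prop :
          Continuous fun t => q i - M.mu i * t)).continuousAt
    · exact ContinuousAt.eventually_lt continuousAt_const (by fun_prop) (by simpa using hqi)
  obtain ⟨t, ⟨h1, h2⟩, ht⟩ := (hev.and self_mem_nhdsWithin).exists
  replace ht : 0 < t := ht
  have hmi := mul_pos (hM.mu_pos i) ht
  have hmj := mul_pos (hM.mu_pos j) ht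
  have hqj := hq.1 j
  have e1 : M.dC i (q i - M.mu i * t) * (M.mu i * t) ≤ M.C i (q i) - M.C i (q i - M.mu i * t) := by
    have h := (hC.strictConvex i).convexOn.derivWithin_le_slope (x := q i - M.mu i * t) (y := q i)
      h2.le hqi.le (by linarith) (hC.differentiableOn i _ h2.le)
    rw [slope_def_field, le_div_iff₀ (by linarith)] at h
    unfold dC
    linarith
  have e2 : M.C j (q j + M.mu j * t) - M.C j (q j) ≤ M.dC j (q j + M.mu j * t) * (M.mu j * t) := by
    have h := (hC.strictConvex j).convexOn.slope_le_derivWithin (x := q j) (y := q j + M.mu j * t)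
      hqj (by simp only [Set.mem_Ici]; linarith) (by linarith)
      (hC.differentiableOn j _ (by simp only [Set.mem_Ici]; linarith))
    rw [slope_def_field, div_le_iff₀ (by linarith)] at h
    unfold dC
    linarith
  rw [marg_of_nonneg j (by linarith), marg_of_nonneg i h2.le] at h1
  -- Removing `μ_i t` from class `i` and adding `μ_j t` to class `j` preserves the workload, as `μ_k
  -- θ_k = 1`.
  set q' := Function.update (Function.update q i (q i - M.mu i * t)) j (q j + M.mu j * t) with hq'
  have hsum : ∀ F : Fin d → ℝ → ℝ, ∑ k, F k (q' k) = ∑ k, F k (q k) +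
      (F i (q i - M.mu i * t) - F i (q i)) + (F j (q j + M.mu j * t) - F j (q j)) := by
    intro F
    have h : ∀ k, F k (q' k) = F k (q k) +
        (if k = i then F i (q i - M.mu i * t) - F i (q i) else 0) +
        (if k = j then F j (q j + M.mu j * t) - F j (q j) else 0) := by
      intro k
      by_cases hkj : k = j
      · subst hkj
        simp [hq', hij.symm]
      · by_cases hki : k = i
        · subst hki
          simp [hq', hkj]
        · simp [hq', hkj, hki]
    simp_rw [h, Finset.sum_add_distrib]
    simp
  have hle := hq.2.2 q' (fun k => ?_) ?_
  · unfold cost at hle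
    rw [hsum M.C] at hle
    nlinarith
  · by_cases hkj : k = j
    · subst hkj
      simp only [hq', Function.update_self]
      linarith
    · by_cases hki : k = i
      · subst hki
        simp only [hq', Function.update_of_ne hkj, Function.update_self]
        exact h2.le
      · simpa [hq', hkj, hki] using hq.1 k
  · rw [hsum fun k x => M.theta k * x, hq.2.1]
    have h3 := hM.mu_mul_theta i
    have h4 := hM.mu_mul_theta j
    linear_combination (-t) * h3 + t * h4

/-- Equality of the marginal costs propagates a strict inequality in one coordinate to all
coordinates, which contradicts the order of the workloads. For equal workloads this is uniqueness.
-/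
theorem IsOptimalAlloc.le_of_le (hM : M.HeavyTraffic) (hC : M.CostConditions) {w w' : ℝ}
    {q q' : Fin d → ℝ} (hq : M.IsOptimalAlloc w q) (hq' : M.IsOptimalAlloc w' q') (hw : w ≤ w')
    (i : Fin d) : q i ≤ q' i := by
  by_contra hlt
  push Not at hlt
  have h1 : ∀ j, q' j < q j := by
    intro j
    rw [← hC.marg_lt_iff hM j (hq'.1 j) (hq.1 j)]
    calc M.marg j (q' j) ≤ M.marg i (q' i) := hq'.marg_le hM hC j i
      _ < M.marg i (q i) := (hC.marg_lt_iff hM i (hq'.1 i) (hq.1 i)).2 hlt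
      _ ≤ M.marg j (q j) := hq.marg_le hM hC i j
  have h2 : ∑ j, M.theta j * q' j < ∑ j, M.theta j * q j :=
    Finset.sum_lt_sum_of_nonempty ⟨i, Finset.mem_univ i⟩
      fun j _ => mul_lt_mul_of_pos_left (h1 j) (hM.theta_pos j)
  rw [hq.2.1, hq'.2.1] at h2
  linarith

variable (M) in
/-- The optimal allocation of the workload `w⁺`. -/
noncomputable def alloc (w : ℝ) : Fin d → ℝ := Classical.epsilon (M.IsOptimalAlloc (max w 0))

variable (M) in
/-- The optimal cost of the workload `w⁺`. -/
noncomputable def optCost (w : ℝ) : ℝ := M.cost (M.alloc w)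

variable (hM : M.HeavyTraffic) (hC : M.CostConditions)
include hM hC

theorem alloc_spec (w : ℝ) : M.IsOptimalAlloc (max w 0) (M.alloc w) :=
  Classical.epsilon_spec (exists_isOptimalAlloc hM hC (le_max_right w 0))

theorem alloc_nonneg (w : ℝ) (i : Fin d) : 0 ≤ M.alloc w i := (alloc_spec hM hC w).1 i

theorem sum_theta_alloc {w : ℝ} (hw : 0 ≤ w) : ∑ i, M.theta i * M.alloc w i = w := by
  rw [(alloc_spec hM hC w).2.1, max_eq_left hw]

theorem alloc_mono {w w' : ℝ} (h : w ≤ w') (i : Fin d) : M.alloc w i ≤ M.alloc w' i :=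
  (alloc_spec hM hC w).le_of_le hM hC (alloc_spec hM hC w') (max_le_max_right 0 h) i

/-- All coordinates increase and their `θ`-weighted increments add up to at most `w' - w`, so none
can exceed `μ_i (w' - w)`. This makes the allocation Lipschitz. -/
theorem alloc_sub_le {w w' : ℝ} (h : w ≤ w') (i : Fin d) :
    M.alloc w' i - M.alloc w i ≤ M.mu i * (w' - w) := by
  have h1 : M.theta i * (M.alloc w' i - M.alloc w i) ≤
      ∑ j, M.theta j * (M.alloc w' j - M.alloc w j) :=
    Finset.single_le_sum (f := fun j => M.theta j * (M.alloc w' j - M.alloc w j))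
      (fun j _ => mul_nonneg (hM.theta_pos j).le (sub_nonneg.2 (alloc_mono hM hC h j)))
      (Finset.mem_univ i)
  simp_rw [mul_sub, Finset.sum_sub_distrib] at h1
  rw [(alloc_spec hM hC w).2.1, (alloc_spec hM hC w').2.1, ← mul_sub] at h1
  have h2 : max w' 0 - max w 0 ≤ w' - w := by
    rcases max_cases w' 0 with h3 | h3 <;> rcases max_cases w 0 with h4 | h4 <;> linarith
  have h3 := mul_le_mul_of_nonneg_left (h1.trans h2) (hM.mu_pos i).le
  rwa [← mul_assoc, hM.mu_mul_theta, one_mul] at h3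

theorem abs_alloc_sub_le (w w' : ℝ) (i : Fin d) :
    |M.alloc w i - M.alloc w' i| ≤ M.mu i * |w - w'| := by
  rcases le_total w w' with h | h
  · rw [abs_sub_comm, abs_sub_comm w, abs_of_nonneg (sub_nonneg.2 (alloc_mono hM hC h i)),
      abs_of_nonneg (sub_nonneg.2 h)]
    exact alloc_sub_le hM hC h i
  · rw [abs_of_nonneg (sub_nonneg.2 (alloc_mono hM hC h i)), abs_of_nonneg (sub_nonneg.2 h)]
    exact alloc_sub_le hM hC h i

theorem continuous_alloc : Continuous M.alloc := by
  refine continuous_pi fun i => ?_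
  refine (LipschitzWith.of_dist_le_mul (K := ⟨M.mu i, (hM.mu_pos i).le⟩) fun w w' => ?_).continuous
  exact abs_alloc_sub_le hM hC w w' i

theorem alloc_zero (i : Fin d) : M.alloc 0 i = 0 := by
  have h := sum_theta_alloc hM hC (le_refl (0 : ℝ))
  rw [Finset.sum_eq_zero_iff_of_nonneg fun j _ =>
    mul_nonneg (hM.theta_pos j).le (alloc_nonneg hM hC 0 j)] at h
  exact (mul_eq_zero.1 (h i (Finset.mem_univ i))).resolve_left (hM.theta_pos i).ne'

theorem optCost_le_cost {q : Fin d → ℝ} (hq : ∀ i, 0 ≤ q i) :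
    M.optCost (∑ i, M.theta i * q i) ≤ M.cost q := by
  refine (alloc_spec hM hC _).2.2 q hq ?_
  rw [max_eq_left]
  exact Finset.sum_nonneg fun i _ => mul_nonneg (hM.theta_pos i).le (hq i)

theorem optCost_mono : Monotone M.optCost := by
  intro w w' h
  unfold optCost cost
  refine Finset.sum_le_sum fun i _ => ?_
  exact (hC.strictMono i).monotoneOn (alloc_nonneg hM hC w i) (alloc_nonneg hM hC w' i)
    (alloc_mono hM hC h i)

theorem optCost_nonneg (w : ℝ) : 0 ≤ M.optCost w := by
  unfold optCost cost
  exact Finset.sum_nonneg fun i _ => hC.nonneg i _ (alloc_nonneg hM hC w i)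

/-- The link between rule and optimum: a deficit in class `i` forces an excess in some class `j`,
and the marginals agree at the optimal allocation. Hence the `cμ` rule does not serve a class that
is below its share. -/
theorem exists_marg_lt {q : Fin d → ℝ} (hq : ∀ i, 0 ≤ q i) {i : Fin d}
    (hlt : q i < M.alloc (∑ j, M.theta j * q j) i) :
    ∃ j, M.marg i (q i) < M.marg j (q j) := by
  set w := ∑ j, M.theta j * q j with hw
  have hw0 : 0 ≤ w := Finset.sum_nonneg fun i _ => mul_nonneg (hM.theta_pos i).le (hq i)
  obtain ⟨j, hj⟩ : ∃ j, M.alloc w j < q j := by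
    by_contra hno
    push Not at hno
    have h1 : ∑ j, M.theta j * q j < ∑ j, M.theta j * M.alloc w j :=
      Finset.sum_lt_sum (fun j _ => mul_le_mul_of_nonneg_left (hno j) (hM.theta_pos j).le)
        ⟨i, Finset.mem_univ i, mul_lt_mul_of_pos_left hlt (hM.theta_pos i)⟩
    rw [sum_theta_alloc hM hC hw0] at h1
    exact lt_irrefl _ h1
  refine ⟨j, ?_⟩
  have ha := alloc_nonneg hM hC w
  calc M.marg i (q i) < M.marg i (M.alloc w i) := (hC.marg_lt_iff hM i (hq i) (ha i)).2 hlt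
    _ ≤ M.marg j (M.alloc w j) := (alloc_spec hM hC w).marg_le hM hC i j
    _ < M.marg j (q j) := (hC.marg_lt_iff hM j (ha j) (hq j)).2 hj

end QueueParams

/-! ### The one-dimensional Skorokhod map -/

/-- The regulator `sup_{s ≤ t} (-x(s))⁺`. -/
noncomputable def regulator (x : ℝ → ℝ) (t : ℝ) : ℝ :=
  sSup ((fun s => max (-x s) 0) '' Set.Icc 0 t)

/-- The Skorokhod map on the half-line. -/
noncomputable def reflected (x : ℝ → ℝ) (t : ℝ) : ℝ := x t + regulator x t

section Skorokhod

variable {x x' : ℝ → ℝ} {K c s t T : ℝ}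

theorem regulator_le (ht : 0 ≤ t) (hc : 0 ≤ c) (h : ∀ s, 0 ≤ s → s ≤ t → -x s ≤ c) :
    regulator x t ≤ c := by
  refine csSup_le ⟨_, 0, ⟨le_rfl, ht⟩, rfl⟩ ?_
  rintro _ ⟨s, hs, rfl⟩
  exact max_le (h s hs.1 hs.2) hc

/-- The bound `K` guarantees that the supremum is a true one and not the default value on an
unbounded set. -/
theorem max_neg_le_regulator (hx : ∀ s, 0 ≤ s → s ≤ T → |x s| ≤ K) (htT : t ≤ T) (hs : 0 ≤ s)
    (hst : s ≤ t) : max (-x s) 0 ≤ regulator x t := by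
  refine le_csSup ⟨max K 0, ?_⟩ ⟨s, ⟨hs, hst⟩, rfl⟩
  rintro _ ⟨u, hu, rfl⟩
  exact max_le_max_right 0 (neg_le.1 (abs_le.1 (hx u hu.1 (hu.2.trans htT))).1)

theorem neg_le_regulator (hx : ∀ s, 0 ≤ s → s ≤ T → |x s| ≤ K) (htT : t ≤ T) (hs : 0 ≤ s)
    (hst : s ≤ t) : -x s ≤ regulator x t :=
  (le_max_left _ _).trans (max_neg_le_regulator hx htT hs hst)

/-- No boundedness is needed, since the default value of `sSup` is zero. -/
theorem regulator_nonneg : 0 ≤ regulator x t :=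
  Real.sSup_nonneg (by rintro _ ⟨s, -, rfl⟩; exact le_max_right _ _)

theorem reflected_nonneg (hx : ∀ s, 0 ≤ s → s ≤ T → |x s| ≤ K) (ht : 0 ≤ t) (htT : t ≤ T) :
    0 ≤ reflected x t := by
  have := neg_le_regulator hx htT ht le_rfl
  unfold reflected
  linarith

theorem regulator_mono (hx : ∀ s, 0 ≤ s → s ≤ T → |x s| ≤ K) (hs : 0 ≤ s) (hst : s ≤ t)
    (htT : t ≤ T) : regulator x s ≤ regulator x t :=
  regulator_le hs regulator_nonneg fun _ hu hus => neg_le_regulator hx htT hu (hus.trans hst)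

theorem regulator_congr (h : ∀ s, 0 ≤ s → s ≤ t → x s = x' s) : regulator x t = regulator x' t := by
  unfold regulator
  congr 1
  refine Set.image_congr fun s hs => ?_
  rw [h s hs.1 hs.2]

theorem regulator_zero (h : x 0 = 0) : regulator x 0 = 0 := by
  simp [regulator, h]

theorem regulator_le_add (hx' : ∀ s, 0 ≤ s → s ≤ T → |x' s| ≤ K) (ht : 0 ≤ t) (htT : t ≤ T)
    (h : ∀ s, 0 ≤ s → s ≤ t → |x s - x' s| ≤ c) : regulator x t ≤ regulator x' t + c := by
  have hc : 0 ≤ c := (abs_nonneg _).trans (h 0 le_rfl ht)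
  refine regulator_le ht (add_nonneg regulator_nonneg hc) fun s hs hst => ?_
  have h1 := neg_le_regulator hx' htT hs hst
  have h2 := (abs_le.1 (h s hs hst)).1
  linarith

theorem abs_reflected_sub_le {K' : ℝ} (hx : ∀ s, 0 ≤ s → s ≤ T → |x s| ≤ K)
    (hx' : ∀ s, 0 ≤ s → s ≤ T → |x' s| ≤ K') (ht : 0 ≤ t) (htT : t ≤ T)
    (h : ∀ s, 0 ≤ s → s ≤ t → |x s - x' s| ≤ c) :
    |reflected x t - reflected x' t| ≤ 2 * c := by
  have h1 := regulator_le_add hx' ht htT h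
  have h2 := regulator_le_add hx ht htT (x := x') (c := c)
    fun s hs hst => by rw [abs_sub_comm]; exact h s hs hst
  have h3 := abs_le.1 (h t ht le_rfl)
  unfold reflected
  rw [abs_le]
  constructor <;> linarith [h3.1, h3.2]

theorem reflected_le (hx : ∀ s, 0 ≤ s → s ≤ T → |x s| ≤ K) (ht : 0 ≤ t) (htT : t ≤ T) :
    reflected x t ≤ 2 * K := by
  have hK : 0 ≤ K := (abs_nonneg _).trans (hx t ht htT)
  have h1 : regulator x t ≤ K := regulator_le ht hK fun s hs hst =>
    neg_le.1 (abs_le.1 (hx s hs (hst.trans htT))).1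
  have h2 := (abs_le.1 (hx t ht htT)).2
  unfold reflected
  linarith

/-- At time `s` the regulator already dominates `-x s`, so afterwards it can grow only by the
further descent of the path. -/
theorem regulator_sub_le (hx : ∀ s, 0 ≤ s → s ≤ T → |x s| ≤ K) (hs : 0 ≤ s) (hst : s ≤ t)
    (htT : t ≤ T) (h : ∀ u, s ≤ u → u ≤ t → |x u - x s| ≤ c) :
    regulator x t - regulator x s ≤ c := by
  have hc : 0 ≤ c := (abs_nonneg _).trans (h s le_rfl hst)
  rw [sub_le_iff_le_add]
  refine regulator_le (hs.trans hst) (add_nonneg hc regulator_nonneg) fun u hu hut => ?_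
  rcases le_total u s with hus | hsu
  · have := neg_le_regulator hx (hst.trans htT) hu hus
    linarith
  · have h1 := neg_le_regulator hx (hst.trans htT) hs le_rfl
    have h2 := (abs_le.1 (h u hsu hut)).1
    linarith

theorem continuousOn_regulator (hx : ContinuousOn x (Set.Icc 0 T)) :
    ContinuousOn (regulator x) (Set.Icc 0 T) := by
  obtain ⟨K, hK⟩ := isCompact_Icc.exists_bound_of_continuousOn hx
  have hb : ∀ s, 0 ≤ s → s ≤ T → |x s| ≤ K := fun s h1 h2 => hK s ⟨h1, h2⟩
  have huc := isCompact_Icc.uniformContinuousOn_of_continuous hx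
  rw [Metric.uniformContinuousOn_iff] at huc
  rw [Metric.continuousOn_iff]
  have key : ∀ ε > 0, ∃ δ > 0, ∀ s t, 0 ≤ s → s ≤ t → t ≤ T → t - s < δ →
      |regulator x t - regulator x s| ≤ ε := by
    intro ε hε
    obtain ⟨δ, hδ, h⟩ := huc ε hε
    refine ⟨δ, hδ, fun s t hs hst htT hd => ?_⟩
    rw [abs_of_nonneg (sub_nonneg.2 (regulator_mono hb hs hst htT))]
    refine regulator_sub_le hb hs hst htT fun u hsu hut => ?_
    refine (h u ⟨hs.trans hsu, hut.trans htT⟩ s ⟨hs, hst.trans htT⟩ ?_).le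
    rw [Real.dist_eq, abs_of_nonneg (sub_nonneg.2 hsu)]
    linarith
  intro t ht ε hε
  obtain ⟨δ, hδ, h⟩ := key (ε / 2) (half_pos hε)
  refine ⟨δ, hδ, fun s hs hd => ?_⟩
  rw [Real.dist_eq] at hd ⊢
  have hd' := abs_lt.1 hd
  rcases le_total s t with hst | hst
  · have := h s t hs.1 hst ht.2 (by linarith)
    rw [abs_sub_comm]
    linarith
  · have := h t s ht.1 hst hs.2 (by linarith)
    linarith

theorem continuousOn_reflected (hx : ContinuousOn x (Set.Icc 0 T)) :
    ContinuousOn (reflected x) (Set.Icc 0 T) := hx.add (continuousOn_regulator hx)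

/-- Minimality of the Skorokhod map. -/
theorem reflected_le_of_nonneg {y : ℝ → ℝ} (ht : 0 ≤ t) (hy0 : 0 ≤ y 0)
    (hy : ∀ s, 0 ≤ s → s ≤ t → y s ≤ y t) (hw : ∀ s, 0 ≤ s → s ≤ t → 0 ≤ x s + y s) :
    reflected x t ≤ x t + y t := by
  have h : regulator x t ≤ y t := regulator_le ht (hy0.trans (hy 0 le_rfl ht)) fun s hs hst => by
    linarith [hy s hs hst, hw s hs hst]
  unfold reflected
  linarith

/-- Uniqueness of the Skorokhod decomposition when the regulator is Lipschitz. -/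
theorem eq_reflected {y : ℝ → ℝ} {L : ℝ} (hx : ∀ s, 0 ≤ s → s ≤ T → |x s| ≤ K) (ht : 0 ≤ t)
    (htT : t ≤ T) (hx0 : x 0 = 0) (hy0 : y 0 = 0) (hL : 0 ≤ L)
    (hmono : ∀ s u, 0 ≤ s → s ≤ u → y s ≤ y u)
    (hlip : ∀ s u, 0 ≤ s → s ≤ u → y u - y s ≤ L * (u - s))
    (hw : ∀ s, 0 ≤ s → 0 ≤ x s + y s)
    (hflat : ∀ s u, 0 ≤ s → s ≤ u → (∀ v, s < v → v ≤ u → x v + y v ≠ 0) → y u = y s) :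
    x t + y t = reflected x t := by
  refine le_antisymm ?_
    (reflected_le_of_nonneg ht hy0.ge (fun s hs hst => hmono s t hs hst) fun s hs _ => hw s hs)
  -- After the last zero `τ` of `x + y` the process `y` is constant. At zeros just before `τ`, `y =
  -- -x` is dominated by the regulator, and the Lipschitz bound carries this over to `τ`.
  obtain ⟨τ, hτ0, hτt, hpos, hnear⟩ :=
    exists_last_time (P := fun s => x s + y s = 0) (by simp [hx0, hy0]) ht
  have h1 : y t = y τ := hflat τ t hτ0 hτt hpos
  have h2 : y τ ≤ regulator x t := by
    refine le_of_forall_pos_le_add fun ε hε => ?_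
    have hL1 : 0 < L + 1 := by linarith
    obtain ⟨s, hs, hsτ, hη, hP⟩ := hnear (ε / (L + 1)) (div_pos hε hL1)
    have h3 := neg_le_regulator hx htT hs (hsτ.trans hτt)
    have h4 := hlip s τ hs hsτ
    have h5 : L * (τ - s) ≤ ε := by
      have h6 : τ - s ≤ ε / (L + 1) := by linarith
      rw [le_div_iff₀ hL1] at h6
      nlinarith
    linarith
  unfold reflected
  linarith

end Skorokhod

/-! ### State space collapse for a single path -/

namespace QueueParams

variable {d : ℕ} (M : QueueParams d)

/-- The path properties of the scaled queue length `q` under the generalized `cμ` rule with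
cumulative effort `e`, primitive fluctuations `ξ` and drift factor `r`. -/
structure IsCMuPath (r : ℝ) (q ξ e : ℝ → Fin d → ℝ) : Prop where
  eq : ∀ t i, 0 ≤ t → q t i = ξ t i + r * (M.lam i * t - M.mu i * e t i)
  nonneg : ∀ t i, 0 ≤ t → 0 ≤ q t i
  xi_zero : ∀ i, ξ 0 i = 0
  e_zero : ∀ i, e 0 i = 0
  e_mono : ∀ s t i, 0 ≤ s → s ≤ t → e s i ≤ e t i
  e_sum : ∀ s t, 0 ≤ s → s ≤ t → ∑ i, (e t i - e s i) ≤ t - s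
  busy : ∀ s t, 0 ≤ s → s ≤ t → (∀ u, s < u → u ≤ t → q u ≠ 0) → ∑ i, (e t i - e s i) = t - s
  priority : ∀ s t i, 0 ≤ s → s ≤ t →
    (∀ u, s < u → u ≤ t → ∃ j, M.marg i (q u i) < M.marg j (q u j)) → e t i = e s i

/-- Total of the `θ_i`. -/
noncomputable def thetaSum : ℝ := ∑ i, M.theta i

/-- The constant of the one-sided collapse estimate. -/
noncomputable def collapseConst (i : Fin d) : ℝ := 2 * M.mu i * M.thetaSum + 1

/-- The constant of the two-sided collapse estimate. -/
noncomputable def collapseConst₂ (i : Fin d) : ℝ :=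
  M.collapseConst i + M.mu i * ∑ j, M.theta j * M.collapseConst j

/-- The constant of the tracking estimate. -/
noncomputable def trackConst (i : Fin d) : ℝ :=
  M.collapseConst₂ i * 6 + M.mu i * (2 * (M.thetaSum * (4 + 2 * M.T)))

/-- The free workload `θ · (y t + ψ⁽¹⁾(t) - ρ[ψ⁽²⁾](t))`. -/
noncomputable def freeWork (ψ₁ ψ₂ : ℝ → Fin d → ℝ) (t : ℝ) : ℝ :=
  ∑ i, M.theta i * (M.y i * t + ψ₁ t i - ψ₂ (M.rho i * t) i)

variable {M}

theorem HeavyTraffic.thetaSum_nonneg (hM : M.HeavyTraffic) : 0 ≤ M.thetaSum :=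
  Finset.sum_nonneg fun i _ => (hM.theta_pos i).le

theorem HeavyTraffic.collapseConst_pos (hM : M.HeavyTraffic) (i : Fin d) :
    0 < M.collapseConst i := by
  have := mul_nonneg (hM.mu_pos i).le hM.thetaSum_nonneg
  unfold collapseConst
  linarith

theorem abs_sum_theta_le (hM : M.HeavyTraffic) {z : Fin d → ℝ} {c : ℝ} (h : ∀ i, |z i| ≤ c) :
    |∑ i, M.theta i * z i| ≤ M.thetaSum * c := by
  unfold thetaSum
  rw [Finset.sum_mul]
  refine (Finset.abs_sum_le_sum_abs _ _).trans (Finset.sum_le_sum fun i _ => ?_)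
  rw [abs_mul, abs_of_pos (hM.theta_pos i)]
  exact mul_le_mul_of_nonneg_left (h i) (hM.theta_pos i).le

theorem HeavyTraffic.le_mu_mul (hM : M.HeavyTraffic) {z : Fin d → ℝ} (hz : ∀ i, 0 ≤ z i)
    (i : Fin d) : z i ≤ M.mu i * ∑ j, M.theta j * z j := by
  have h1 : M.theta i * z i ≤ ∑ j, M.theta j * z j :=
    Finset.single_le_sum (f := fun j => M.theta j * z j)
      (fun j _ => mul_nonneg (hM.theta_pos j).le (hz j)) (Finset.mem_univ i)
  have h2 := mul_le_mul_of_nonneg_left h1 (hM.mu_pos i).le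
  rwa [← mul_assoc, hM.mu_mul_theta, one_mul] at h2

/-! ### Reflection of the workload and collapse onto the optimal allocation -/

namespace IsCMuPath

variable {r : ℝ} {q ξ e : ℝ → Fin d → ℝ}

theorem e_lip (h : M.IsCMuPath r q ξ e) {s t : ℝ} (hs : 0 ≤ s) (hst : s ≤ t) (i : Fin d) :
    e t i - e s i ≤ t - s :=
  (Finset.single_le_sum (f := fun j => e t j - e s j)
    (fun j _ => sub_nonneg.2 (h.e_mono s t j hs hst)) (Finset.mem_univ i)).trans
    (h.e_sum s t hs hst)

theorem e_nonneg (h : M.IsCMuPath r q ξ e) {t : ℝ} (ht : 0 ≤ t) (i : Fin d) : 0 ≤ e t i := by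
  rw [← h.e_zero i]
  exact h.e_mono 0 t i le_rfl ht

theorem e_le (h : M.IsCMuPath r q ξ e) {t : ℝ} (ht : 0 ≤ t) (i : Fin d) : e t i ≤ t := by
  have := h.e_lip le_rfl ht i
  rw [h.e_zero i] at this
  linarith

/-- Critical load: `∑ ρ_i = 1` turns the weighted drift into `r` times the idle time `t - ∑ e_i`. -/
theorem workload_eq (h : M.IsCMuPath r q ξ e) (hM : M.HeavyTraffic) {t : ℝ} (ht : 0 ≤ t) :
    ∑ i, M.theta i * q t i = ∑ i, M.theta i * ξ t i + r * (t - ∑ i, e t i) := by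
  have h1 : ∀ i, M.theta i * q t i =
      M.theta i * ξ t i + r * (M.rho i * t) - r * e t i := by
    intro i
    rw [h.eq t i ht]
    have h2 := hM.mu_mul_theta i
    have h3 : M.rho i = M.lam i * M.theta i := rfl
    rw [h3]
    linear_combination (-(r * e t i)) * h2
  simp_rw [h1, Finset.sum_sub_distrib, Finset.sum_add_distrib, ← Finset.mul_sum, ← Finset.sum_mul]
  rw [hM.critical]
  ring

/-- The scaled idle time is nondecreasing, Lipschitz and constant while the workload is positive,
hence it is the regulator. The way the effort is split enters only through `ξ`. -/
theorem workload_eq_reflected (h : M.IsCMuPath r q ξ e) (hM : M.HeavyTraffic) (hr : 0 ≤ r)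
    {K T : ℝ} (hx : ∀ s, 0 ≤ s → s ≤ T → |∑ i, M.theta i * ξ s i| ≤ K) {t : ℝ} (ht : 0 ≤ t)
    (htT : t ≤ T) :
    ∑ i, M.theta i * q t i = reflected (fun s => ∑ i, M.theta i * ξ s i) t := by
  rw [h.workload_eq hM ht]
  have hsum : ∀ s u, ∑ i, (e u i - e s i) = ∑ i, e u i - ∑ i, e s i :=
    fun s u => Finset.sum_sub_distrib _ _
  refine eq_reflected (y := fun t => r * (t - ∑ i, e t i)) (L := r) hx ht htT (by simp [h.xi_zero])
    (by simp [h.e_zero]) hr ?_ ?_ ?_ ?_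
  · intro s u hs hsu
    have := h.e_sum s u hs hsu
    rw [hsum] at this
    exact mul_le_mul_of_nonneg_left (by linarith) hr
  · intro s u hs hsu
    have h1 : ∑ i, e s i ≤ ∑ i, e u i := Finset.sum_le_sum fun i _ => h.e_mono s u i hs hsu
    rw [← mul_sub]
    exact mul_le_mul_of_nonneg_left (by linarith) hr
  · intro s hs
    rw [← h.workload_eq hM hs]
    exact Finset.sum_nonneg fun i _ => mul_nonneg (hM.theta_pos i).le (h.nonneg s i hs)
  · intro s u hs hsu hne
    have := h.busy s u hs hsu fun v hv hvu hq => by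
      have h1 := hne v hv hvu
      rw [← h.workload_eq hM (hs.trans hv.le)] at h1
      exact h1 (by simp [hq])
    rw [hsum] at this
    have h2 : u - ∑ i, e u i = s - ∑ i, e s i := by linarith
    simp only [h2]

section Modulus

variable {κ L T : ℝ}

theorem abs_xi_le (h : M.IsCMuPath r q ξ e) (hL : 0 ≤ L)
    (hmod : ∀ s t i, 0 ≤ s → s ≤ t → t ≤ T → |ξ t i - ξ s i| ≤ κ + L * (t - s)) {t : ℝ}
    (ht : 0 ≤ t) (htT : t ≤ T) (i : Fin d) : |ξ t i| ≤ κ + L * T := by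
  have h1 := hmod 0 t i le_rfl ht htT
  rw [h.xi_zero i, sub_zero, sub_zero] at h1
  have := mul_le_mul_of_nonneg_left htT hL
  linarith

/-- Since the last time at which class `i` had its share, it has received no service. Up to
fluctuations of size `κ + L (t - s)` it has gained `r λ_i (t - s)`, while its share has grown by at
most `2 μ_i thetaSum (κ + L (t - s))`. The hypothesis on `r` makes the drift absorb everything
proportional to `t - s`, and a multiple of `κ` is left. -/
theorem alloc_sub_le (h : M.IsCMuPath r q ξ e) (hM : M.HeavyTraffic) (hC : M.CostConditions)
    (hr : 0 < r) (hL : 0 ≤ L)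
    (hmod : ∀ s t i, 0 ≤ s → s ≤ t → t ≤ T → |ξ t i - ξ s i| ≤ κ + L * (t - s)) (i : Fin d)
    (hrL : M.collapseConst i * L ≤ r * M.lam i) {t : ℝ} (ht : 0 ≤ t) (htT : t ≤ T) :
    M.alloc (∑ j, M.theta j * q t j) i - q t i ≤ M.collapseConst i * κ := by
  have hbd : ∀ s, 0 ≤ s → s ≤ T → |∑ i, M.theta i * ξ s i| ≤ M.thetaSum * (κ + L * T) :=
    fun s hs hsT => abs_sum_theta_le hM fun i => h.abs_xi_le hL hmod hs hsT i
  obtain ⟨τ, hτ0, hτt, hlow, hnear⟩ :=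
    exists_last_time (P := fun s => M.alloc (∑ j, M.theta j * q s j) i ≤ q s i) (by
      have h1 : ∀ j, q 0 j = 0 := fun j => by simp [h.eq 0 j le_rfl, h.xi_zero, h.e_zero]
      simp [h1, QueueParams.alloc_zero hM hC]) ht
  have he : e t i = e τ i := h.priority τ t i hτ0 hτt fun u hu hut =>
    exists_marg_lt hM hC (fun j => h.nonneg u j (hτ0.trans hu.le)) (not_le.1 (hlow u hu hut))
  refine le_of_forall_pos_le_add fun ε hε => ?_
  have hμ := hM.mu_pos i
  -- The good time `s` is chosen so close to `τ` that service during `[s, τ]` changes the queue by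
  -- at most `ε`.
  obtain ⟨s, hs, hsτ, hη, hP⟩ := hnear (ε / (r * M.mu i)) (div_pos hε (mul_pos hr hμ))
  have hst := hsτ.trans hτt
  have h1 : r * M.mu i * (τ - s) ≤ ε := by
    have h2 : τ - s ≤ ε / (r * M.mu i) := by linarith
    rwa [le_div_iff₀' (mul_pos hr hμ)] at h2
  have h2 : r * M.mu i * (e τ i - e s i) ≤ ε :=
    (mul_le_mul_of_nonneg_left (h.e_lip hs hsτ i) (mul_pos hr hμ).le).trans h1
  have h3 : ∀ u, s ≤ u → u ≤ t → |∑ j, M.theta j * ξ u j - ∑ j, M.theta j * ξ s j| ≤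
      M.thetaSum * (κ + L * (t - s)) := by
    intro u hsu hut
    rw [← Finset.sum_sub_distrib]
    simp_rw [← mul_sub]
    refine abs_sum_theta_le hM fun j => (hmod s u j hs hsu (hut.trans htT)).trans ?_
    have := mul_le_mul_of_nonneg_left (sub_le_sub_right hut s) hL
    linarith
  -- The factor 2 counts the increment of the free path and that of its regulator.
  have h4 : ∑ j, M.theta j * q t j - ∑ j, M.theta j * q s j ≤
      2 * (M.thetaSum * (κ + L * (t - s))) := by
    rw [h.workload_eq_reflected hM hr.le hbd ht htT,
      h.workload_eq_reflected hM hr.le hbd hs (hst.trans htT)]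
    have h5 := regulator_sub_le hbd hs hst htT h3
    have h6 := (abs_le.1 (h3 t hst le_rfl)).2
    unfold reflected
    linarith
  have h5 : M.alloc (∑ j, M.theta j * q t j) i ≤ M.alloc (∑ j, M.theta j * q s j) i +
      M.mu i * (2 * (M.thetaSum * (κ + L * (t - s)))) := by
    have h0 : 0 ≤ 2 * (M.thetaSum * (κ + L * (t - s))) :=
      mul_nonneg zero_le_two ((abs_nonneg _).trans (h3 s le_rfl hst))
    rcases le_total (∑ j, M.theta j * q t j) (∑ j, M.theta j * q s j) with hle | hle
    · have h7 := alloc_mono hM hC hle i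
      have h8 := mul_nonneg hμ.le h0
      linarith
    · have h7 := QueueParams.alloc_sub_le hM hC hle i
      have h8 := mul_le_mul_of_nonneg_left h4 hμ.le
      linarith
  have h6 := (abs_le.1 (hmod s t i hs hst htT)).1
  have h7 := h.eq t i ht
  have h8 := h.eq s i hs
  have h9 := mul_le_mul_of_nonneg_right hrL (sub_nonneg.2 hst)
  rw [he] at h7
  unfold collapseConst at h9 ⊢
  nlinarith

/-- Queue and allocation carry the same workload, so an excess in one class is balanced by deficits
in the others, which the one-sided estimate bounds. -/
theorem abs_sub_alloc_le (h : M.IsCMuPath r q ξ e) (hM : M.HeavyTraffic) (hC : M.CostConditions)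
    (hr : 0 < r) (hL : 0 ≤ L) (hκ : 0 ≤ κ)
    (hmod : ∀ s t i, 0 ≤ s → s ≤ t → t ≤ T → |ξ t i - ξ s i| ≤ κ + L * (t - s))
    (hrL : ∀ i, M.collapseConst i * L ≤ r * M.lam i) {t : ℝ} (ht : 0 ≤ t) (htT : t ≤ T)
    (i : Fin d) :
    |q t i - M.alloc (∑ j, M.theta j * q t j) i| ≤ M.collapseConst₂ i * κ := by
  have h1 := fun j => h.alloc_sub_le hM hC hr hL hmod j (hrL j) ht htT
  set w := ∑ j, M.theta j * q t j with hw
  have hw0 : 0 ≤ w :=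
    Finset.sum_nonneg fun j _ => mul_nonneg (hM.theta_pos j).le (h.nonneg t j ht)
  have hcs : 0 ≤ ∑ j, M.theta j * M.collapseConst j := Finset.sum_nonneg fun j _ =>
    mul_nonneg (hM.theta_pos j).le (hM.collapseConst_pos j).le
  -- The slacks in the one-sided estimate are nonnegative, and their weighted sum is a multiple of
  -- `κ` because the workloads cancel; hence every single slack is of order `κ`.
  have h2 := hM.le_mu_mul (z := fun j => M.collapseConst j * κ - (M.alloc w j - q t j))
    (fun j => sub_nonneg.2 (h1 j)) i
  have h3 : ∑ j, M.theta j * (M.collapseConst j * κ - (M.alloc w j - q t j)) =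
      (∑ j, M.theta j * M.collapseConst j) * κ := by
    simp_rw [mul_sub, Finset.sum_sub_distrib]
    rw [sum_theta_alloc hM hC hw0, ← hw, Finset.sum_mul]
    simp [mul_assoc]
  rw [h3] at h2
  have h4 := mul_nonneg (hM.collapseConst_pos i).le hκ
  have h5 := mul_nonneg (mul_nonneg (hM.mu_pos i).le hcs) hκ
  unfold collapseConst₂
  rw [abs_le]
  constructor <;> nlinarith [h1 i]

/-- The deviation of the effort from `ρ_i t`, multiplied by `r μ_i`, is the difference of two
bounded quantities. For large `r` the effort is therefore nearly `ρ_i t`. -/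
theorem abs_effort_sub_le (h : M.IsCMuPath r q ξ e) (hM : M.HeavyTraffic)
    (hr : 0 < r) (hL : 0 ≤ L)
    (hmod : ∀ s t i, 0 ≤ s → s ≤ t → t ≤ T → |ξ t i - ξ s i| ≤ κ + L * (t - s)) {t : ℝ}
    (ht : 0 ≤ t) (htT : t ≤ T) (i : Fin d) :
    r * |e t i - M.rho i * t| ≤
      M.theta i * ((1 + M.mu i * (2 * M.thetaSum)) * (κ + L * T)) := by
  have hbd : ∀ s, 0 ≤ s → s ≤ T → |∑ i, M.theta i * ξ s i| ≤ M.thetaSum * (κ + L * T) :=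
    fun s hs hsT => abs_sum_theta_le hM fun i => h.abs_xi_le hL hmod hs hsT i
  have hμ := hM.mu_pos i
  have h1 : r * (e t i - M.rho i * t) = M.theta i * (ξ t i - q t i) := by
    have h2 := h.eq t i ht
    have h3 := hM.mu_mul_theta i
    have h4 : M.rho i = M.lam i * M.theta i := rfl
    rw [h4, h2]
    linear_combination (-(r * e t i)) * h3
  have h2 : q t i ≤ M.mu i * (2 * (M.thetaSum * (κ + L * T))) := by
    refine (hM.le_mu_mul (fun j => h.nonneg t j ht) i).trans (mul_le_mul_of_nonneg_left ?_ hμ.le)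
    rw [h.workload_eq_reflected hM hr.le hbd ht htT]
    exact reflected_le hbd ht htT
  rw [← abs_of_pos hr, ← abs_mul, h1, abs_mul, abs_of_pos (hM.theta_pos i)]
  refine mul_le_mul_of_nonneg_left ?_ (hM.theta_pos i).le
  have h3 := abs_le.1 (h.abs_xi_le hL hmod ht htT i)
  have h4 := h.nonneg t i ht
  have h5 : 0 ≤ M.mu i * (2 * (M.thetaSum * (κ + L * T))) := h4.trans h2
  rw [abs_le]
  constructor <;> nlinarith [h3.1, h3.2]

end Modulus

end IsCMuPath

/-- If the primitive fluctuations are close to a path with controlled modulus, then the queue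
lengths are close to the optimal allocation of the reflected workload of that path. -/
theorem exists_abs_sub_alloc_reflected_le (hM : M.HeavyTraffic) (hC : M.CostConditions)
    {κ L K : ℝ} (hκ : 0 < κ) (hL : 0 ≤ L) (hK : 0 ≤ K) :
    ∃ r₀ : ℝ, ∀ r ≥ r₀, ∀ (q e a s ψ₁ ψ₂ : ℝ → Fin d → ℝ) (l m : Fin d → ℝ),
      M.IsCMuPath r q (fun t i => a t i - s (e t i) i + l i * t - m i * e t i) e →
      (∀ t i, 0 ≤ t → t ≤ M.T → |a t i - ψ₁ t i| ≤ κ) →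
      (∀ t i, 0 ≤ t → t ≤ M.T → |s t i - ψ₂ t i| ≤ κ) →
      (∀ u v i, 0 ≤ u → u ≤ M.T → 0 ≤ v → v ≤ M.T → |ψ₁ v i - ψ₁ u i| ≤ κ + L * |v - u|) →
      (∀ u v i, 0 ≤ u → u ≤ M.T → 0 ≤ v → v ≤ M.T → |ψ₂ v i - ψ₂ u i| ≤ κ + L * |v - u|) →
      (∀ i, |l i| ≤ K) → (∀ i, |m i| ≤ K) →
      (∀ i, |l i - M.lamT i| ≤ κ) → (∀ i, |m i - M.muT i| ≤ κ) →
      ∀ t i, 0 ≤ t → t ≤ M.T →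
        |q t i - M.alloc (reflected (M.freeWork ψ₁ ψ₂) t) i| ≤ M.trackConst i * κ := by
  -- One `L` comes from each of the two paths and one `K` from each of the two drift terms.
  set L' := 2 * L + 2 * K with hL'
  have hL'0 : 0 ≤ L' := by positivity
  -- `D i` is the bound of `abs_effort_sub_le` for the modulus of `ξ`. The third requirement on `r`
  -- makes `(L + K) |e_i - ρ_i u|` at most `κ`. The threshold depends on the paths only through `κ`,
  -- `L` and `K`.
  set D : Fin d → ℝ := fun i =>
    M.theta i * ((1 + M.mu i * (2 * M.thetaSum)) * (6 * κ + L' * M.T)) with hD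
  obtain ⟨r₀, hr₀⟩ : ∃ r₀ : ℝ, ∀ r ≥ r₀, 0 < r ∧ (∀ i, M.collapseConst i * L' ≤ r * M.lam i) ∧
      ∀ i, (L + K) * D i ≤ r * κ := by
    refine eventually_atTop.1 ((eventually_gt_atTop 0).and (Filter.Eventually.and ?_ ?_))
    · exact eventually_all.2 fun i =>
        (tendsto_id.atTop_mul_const (hM.lam_pos i)).eventually_ge_atTop _
    · exact eventually_all.2 fun i => (tendsto_id.atTop_mul_const hκ).eventually_ge_atTop _
  refine ⟨r₀, fun r hr q e a s ψ₁ ψ₂ l m h ha hs hψ₁ hψ₂ hlK hmK hl hm t i ht htT => ?_⟩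
  obtain ⟨hr0, hrL, hrD⟩ := hr₀ r hr
  set ξ : ℝ → Fin d → ℝ := fun t i => a t i - s (e t i) i + l i * t - m i * e t i with hξ
  -- Of the `6 κ`, four come from replacing `a` and `s` by the paths at both endpoints, and two from
  -- the moduli of the paths.
  have hmod : ∀ u v i, 0 ≤ u → u ≤ v → v ≤ M.T → |ξ v i - ξ u i| ≤ 6 * κ + L' * (v - u) := by
    intro u v i hu huv hvT
    have hv := hu.trans huv
    have huT := huv.trans hvT
    have e1 := h.e_nonneg hu i
    have e2 := (h.e_le hu i).trans huT
    have e3 := h.e_nonneg hv i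
    have e4 := (h.e_le hv i).trans hvT
    have e5 := h.e_mono u v i hu huv
    have e6 := h.e_lip hu huv i
    have b1 := hψ₁ u v i hu huT hv hvT
    rw [abs_of_nonneg (sub_nonneg.2 huv)] at b1
    have b2 := hψ₂ (e u i) (e v i) i e1 e2 e3 e4
    rw [abs_of_nonneg (sub_nonneg.2 e5)] at b2
    have b3 : |l i * (v - u)| ≤ K * (v - u) := by
      rw [abs_mul, abs_of_nonneg (sub_nonneg.2 huv)]
      exact mul_le_mul_of_nonneg_right (hlK i) (sub_nonneg.2 huv)
    have b4 : |m i * (e v i - e u i)| ≤ K * (v - u) := by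
      rw [abs_mul, abs_of_nonneg (sub_nonneg.2 e5)]
      exact mul_le_mul (hmK i) e6 (sub_nonneg.2 e5) hK
    have b5 := mul_le_mul_of_nonneg_left e6 hL
    have a1 := abs_le.1 (ha u i hu huT)
    have a2 := abs_le.1 (ha v i hv hvT)
    have a3 := abs_le.1 (hs (e u i) i e1 e2)
    have a4 := abs_le.1 (hs (e v i) i e3 e4)
    have c1 := abs_le.1 b1
    have c2 := abs_le.1 b2
    have c3 := abs_le.1 b3
    have c4 := abs_le.1 b4
    simp only [hξ, hL']
    rw [abs_le]
    constructor <;> linarith [a1.1, a1.2, a2.1, a2.2, a3.1, a3.2, a4.1, a4.2, c1.1, c1.2, c2.1,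
      c2.2, c3.1, c3.2, c4.1, c4.2]
  -- The four terms `κ` come from `a`, from `s`, from the modulus of `ψ₂`, and from the error of the
  -- effort in time change and drift; `2 T κ` comes from the two drift parameters.
  have hclose : ∀ u i, 0 ≤ u → u ≤ M.T →
      |ξ u i - (M.y i * u + ψ₁ u i - ψ₂ (M.rho i * u) i)| ≤ (4 + 2 * M.T) * κ := by
    intro u i hu huT
    have e1 := h.e_nonneg hu i
    have e2 := h.e_le hu i
    have hρu : 0 ≤ M.rho i * u := mul_nonneg (hM.rho_pos i).le hu
    have hρu' : M.rho i * u ≤ u := mul_le_of_le_one_left hu (hM.rho_le_one i)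
    have b1 : (L + K) * |e u i - M.rho i * u| ≤ κ := by
      have h1 := h.abs_effort_sub_le hM hr0 hL'0 hmod hu huT i
      have h2 := (mul_le_mul_of_nonneg_left h1 (add_nonneg hL hK)).trans (hrD i)
      have h3 : r * ((L + K) * |e u i - M.rho i * u|) ≤ r * κ := by linarith
      exact le_of_mul_le_mul_left h3 hr0
    have b2 := hψ₂ (M.rho i * u) (e u i) i hρu (hρu'.trans huT) e1 (e2.trans huT)
    have b3 : |m i * (e u i - M.rho i * u)| ≤ K * |e u i - M.rho i * u| := by
      rw [abs_mul]
      exact mul_le_mul_of_nonneg_right (hmK i) (abs_nonneg _)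
    have b4 : |(m i - M.muT i) * (M.rho i * u)| ≤ κ * M.T := by
      rw [abs_mul, abs_of_nonneg hρu]
      exact mul_le_mul (hm i) (hρu'.trans huT) hρu hκ.le
    have b5 : |(l i - M.lamT i) * u| ≤ κ * M.T := by
      rw [abs_mul, abs_of_nonneg hu]
      exact mul_le_mul (hl i) huT hu hκ.le
    have a1 := abs_le.1 (ha u i hu huT)
    have a2 := abs_le.1 (hs (e u i) i e1 (e2.trans huT))
    have c2 := abs_le.1 b2
    have c3 := abs_le.1 b3
    have c4 := abs_le.1 b4
    have c5 := abs_le.1 b5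
    simp only [hξ, QueueParams.y]
    rw [abs_le]
    constructor <;> linarith [a1.1, a1.2, a2.1, a2.2, c2.1, c2.2, c3.1, c3.2, c4.1, c4.2, c5.1,
      c5.2]
  have hwork : ∀ u, 0 ≤ u → u ≤ M.T →
      |∑ i, M.theta i * ξ u i - M.freeWork ψ₁ ψ₂ u| ≤ M.thetaSum * ((4 + 2 * M.T) * κ) := by
    intro u hu huT
    unfold freeWork
    rw [← Finset.sum_sub_distrib]
    simp_rw [← mul_sub]
    exact abs_sum_theta_le hM fun i => hclose u i hu huT
  have hbd : ∀ u, 0 ≤ u → u ≤ M.T →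
      |∑ i, M.theta i * ξ u i| ≤ M.thetaSum * (6 * κ + L' * M.T) :=
    fun u hu huT => abs_sum_theta_le hM fun i => h.abs_xi_le hL'0 hmod hu huT i
  have hbd' : ∀ u, 0 ≤ u → u ≤ M.T → |M.freeWork ψ₁ ψ₂ u| ≤
      M.thetaSum * (6 * κ + L' * M.T) + M.thetaSum * ((4 + 2 * M.T) * κ) := by
    intro u hu huT
    have h1 := abs_le.1 (hwork u hu huT)
    have h2 := abs_le.1 (hbd u hu huT)
    rw [abs_le]
    constructor <;> linarith [h1.1, h1.2, h2.1, h2.2]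
  -- The total error is the collapse error for the modulus `6 κ` plus the Lipschitz constant `μ_i`
  -- of the allocation times the factor 2 of the Skorokhod map.
  have h1 := h.abs_sub_alloc_le hM hC hr0 hL'0 (by positivity) hmod hrL ht htT i
  have h2 := abs_reflected_sub_le hbd hbd' ht htT fun u hu hut => hwork u hu (hut.trans htT)
  rw [← h.workload_eq_reflected hM hr0.le hbd ht htT] at h2
  have h3 := (abs_alloc_sub_le hM hC (∑ i, M.theta i * q t i)
    (reflected (M.freeWork ψ₁ ψ₂) t) i).trans (mul_le_mul_of_nonneg_left h2 (hM.mu_pos i).le)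
  have h4 := abs_sub_le (q t i) (M.alloc (∑ i, M.theta i * q t i) i)
    (M.alloc (reflected (M.freeWork ψ₁ ψ₂) t) i)
  unfold trackConst
  linarith

end QueueParams

/-! ### Right-continuous controls and their cumulative effort -/

/-- The function is the pointwise limit of step functions that evaluate it at the next grid point to
the right, for grids of mesh `1 / (k + 1)`. -/
theorem measurable_of_right_continuous {g : ℝ → ℝ}
    (hg : ∀ t, ContinuousWithinAt g (Set.Ici t) t) : Measurable g := by
  have hmeas : ∀ k : ℕ, Measurable fun t : ℝ => g ((⌊(k + 1 : ℝ) * t⌋ + 1 : ℝ) / (k + 1)) := by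
    intro k
    have h1 : Measurable fun z : ℤ => g ((z + 1 : ℝ) / (k + 1)) := measurable_from_top
    exact h1.comp (Int.measurable_floor.comp (measurable_const_mul _))
  refine measurable_of_tendsto_metrizable hmeas (tendsto_pi_nhds.2 fun t => ?_)
  refine (hg t).tendsto.comp (tendsto_nhdsWithin_iff.2 ⟨?_, Eventually.of_forall fun k => ?_⟩)
  · have hlim : Tendsto (fun k : ℕ => t + 1 / ((k : ℝ) + 1)) atTop (𝓝 t) := by
      simpa using tendsto_const_nhds.add (tendsto_one_div_add_atTop_nhds_zero_nat (𝕜 := ℝ))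
    refine tendsto_of_tendsto_of_tendsto_of_le_of_le tendsto_const_nhds hlim
      (fun k => ?_) fun k => ?_
    · have hk : (0 : ℝ) < k + 1 := by positivity
      rw [le_div_iff₀ hk]
      linarith [Int.lt_floor_add_one ((k + 1 : ℝ) * t)]
    · have hk : (0 : ℝ) < k + 1 := by positivity
      have h := Int.floor_le ((k + 1 : ℝ) * t)
      have h2 : (t + 1 / ((k : ℝ) + 1)) * (k + 1) = (k + 1) * t + 1 := by
        field_simp
      rw [div_le_iff₀ hk, h2]
      linarith
  · have hk : (0 : ℝ) < k + 1 := by positivity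
    rw [Set.mem_Ici, le_div_iff₀ hk]
    linarith [Int.lt_floor_add_one ((k + 1 : ℝ) * t)]

/-- RCLL controls with values in the subprobability simplex. -/
structure IsSimplexControl {d : ℕ} (B : ℝ → Fin d → ℝ) : Prop where
  rcll : IsRCLL B
  nonneg : ∀ t i, 0 ≤ t → 0 ≤ B t i
  sum_le : ∀ t, 0 ≤ t → ∑ i, B t i ≤ 1

namespace IsSimplexControl

variable {d : ℕ} {B : ℝ → Fin d → ℝ}

theorem le_one (h : IsSimplexControl B) {t : ℝ} (ht : 0 ≤ t) (i : Fin d) : B t i ≤ 1 :=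
  (Finset.single_le_sum (f := fun j => B t j) (fun j _ => h.nonneg t j ht)
    (Finset.mem_univ i)).trans (h.sum_le t ht)

theorem intervalIntegrable (h : IsSimplexControl B) {s t : ℝ} (hs : 0 ≤ s) (ht : 0 ≤ t)
    (i : Fin d) : IntervalIntegrable (fun u => B u i) volume s t := by
  -- Nothing is known about `B` at negative times, so it is extended there by its value at zero.
  have hmeas : Measurable fun u => B (max u 0) i := by
    refine measurable_of_right_continuous fun u => ?_
    have h1 : ContinuousWithinAt (fun v => B v i) (Set.Ici (max u 0)) (max u 0) :=
      (continuous_apply i).continuousAt.comp_continuousWithinAt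
        (h.rcll.1 (max u 0) (le_max_right _ _))
    exact ContinuousWithinAt.comp (f := fun v => max v 0) h1
      (continuous_id.max continuous_const).continuousWithinAt
      fun v hv => Set.mem_Ici.2 (max_le_max_right 0 hv)
  have hBint : IntervalIntegrable (fun u => B (max u 0) i) volume s t := by
    refine IntervalIntegrable.mono_fun (f := fun _ => (1 : ℝ)) intervalIntegrable_const
      hmeas.aestronglyMeasurable (Eventually.of_forall fun u => ?_)
    have h0 := le_max_right u 0
    simp only [Real.norm_eq_abs, abs_one]
    rw [abs_of_nonneg (h.nonneg _ i h0)]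
    exact h.le_one h0 i
  refine hBint.congr_uIoo fun u hu => ?_
  have : 0 < u := lt_of_le_of_lt (le_min hs ht) hu.1
  simp [max_eq_left this.le]

theorem effort_sub (h : IsSimplexControl B) {s t : ℝ} (hs : 0 ≤ s) (ht : 0 ≤ t) (i : Fin d) :
    QueueParams.effort B t i - QueueParams.effort B s i = ∫ u in s..t, B u i :=
  intervalIntegral.integral_interval_sub_left (h.intervalIntegrable le_rfl ht i)
    (h.intervalIntegrable le_rfl hs i)

theorem effort_mono (h : IsSimplexControl B) {s t : ℝ} (hs : 0 ≤ s) (hst : s ≤ t) (i : Fin d) :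
    QueueParams.effort B s i ≤ QueueParams.effort B t i := by
  rw [← sub_nonneg, h.effort_sub hs (hs.trans hst)]
  exact intervalIntegral.integral_nonneg hst fun u hu => h.nonneg u i (hs.trans hu.1)

theorem sum_effort_sub (h : IsSimplexControl B) {s t : ℝ} (hs : 0 ≤ s) (ht : 0 ≤ t) :
    ∑ i, (QueueParams.effort B t i - QueueParams.effort B s i) = ∫ u in s..t, ∑ i, B u i := by
  rw [intervalIntegral.integral_finsetSum fun i _ => h.intervalIntegrable hs ht i]
  exact Finset.sum_congr rfl fun i _ => h.effort_sub hs ht i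

theorem sum_effort_sub_le (h : IsSimplexControl B) {s t : ℝ} (hs : 0 ≤ s) (hst : s ≤ t) :
    ∑ i, (QueueParams.effort B t i - QueueParams.effort B s i) ≤ t - s := by
  rw [h.sum_effort_sub hs (hs.trans hst)]
  have h1 : IntervalIntegrable (fun u => ∑ i, B u i) volume s t := by
    have := IntervalIntegrable.sum Finset.univ (f := fun i u => B u i) (μ := volume) (a := s)
      (b := t) fun i _ => h.intervalIntegrable hs (hs.trans hst) i
    refine this.congr_uIoo fun u _ => ?_
    simp
  have h2 := intervalIntegral.integral_mono_on hst h1 (intervalIntegrable_const (c := (1 : ℝ)))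
    fun u hu => h.sum_le u (hs.trans hu.1)
  simpa using h2

theorem effort_sub_le (h : IsSimplexControl B) {s t : ℝ} (hs : 0 ≤ s) (hst : s ≤ t) (i : Fin d) :
    QueueParams.effort B t i - QueueParams.effort B s i ≤ t - s :=
  (Finset.single_le_sum
    (f := fun j => QueueParams.effort B t j - QueueParams.effort B s j)
    (fun j _ => sub_nonneg.2 (h.effort_mono hs hst j)) (Finset.mem_univ i)).trans
    (h.sum_effort_sub_le hs hst)

theorem effort_zero (i : Fin d) : QueueParams.effort B 0 i = 0 := by
  simp [QueueParams.effort]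

theorem effort_nonneg (h : IsSimplexControl B) {t : ℝ} (ht : 0 ≤ t) (i : Fin d) :
    0 ≤ QueueParams.effort B t i := by
  rw [← effort_zero (B := B) i]
  exact h.effort_mono le_rfl ht i

theorem effort_eq_of_forall_eq_zero (h : IsSimplexControl B) {s t : ℝ} (hs : 0 ≤ s) (hst : s ≤ t)
    (i : Fin d) (h0 : ∀ u, s < u → u ≤ t → B u i = 0) :
    QueueParams.effort B t i = QueueParams.effort B s i := by
  rw [← sub_eq_zero, h.effort_sub hs (hs.trans hst),
    intervalIntegral.integral_congr_Ioo_of_le hst (g := fun _ => 0) fun u hu => h0 u hu.1 hu.2.le]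
  simp

theorem sum_effort_eq_of_forall_eq_one (h : IsSimplexControl B) {s t : ℝ} (hs : 0 ≤ s)
    (hst : s ≤ t) (h1 : ∀ u, s < u → u ≤ t → ∑ i, B u i = 1) :
    ∑ i, (QueueParams.effort B t i - QueueParams.effort B s i) = t - s := by
  rw [h.sum_effort_sub hs (hs.trans hst),
    intervalIntegral.integral_congr_Ioo_of_le hst (g := fun _ => 1) fun u hu => h1 u hu.1 hu.2.le]
  simp

/-- Convergence from above on the effort scale is what allows composition with a counting function
that is only right-constant. -/
theorem eventually_effort (h : IsSimplexControl B) {t : ℝ} (ht : 0 ≤ t) (i : Fin d) :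
    Tendsto (fun u => QueueParams.effort B u i) (𝓝[≥] t) (𝓝[≥] (QueueParams.effort B t i)) := by
  refine tendsto_nhdsWithin_iff.2 ⟨?_, ?_⟩
  · have hlim : Tendsto (fun u : ℝ => QueueParams.effort B t i + (u - t)) (𝓝[≥] t)
        (𝓝 (QueueParams.effort B t i)) := by
      have : Continuous fun u : ℝ => QueueParams.effort B t i + (u - t) := by fun_prop
      simpa using this.continuousWithinAt.tendsto (x := t) (s := Set.Ici t)
    refine tendsto_of_tendsto_of_tendsto_of_le_of_le' tendsto_const_nhds hlim ?_ ?_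
    · filter_upwards [self_mem_nhdsWithin] with u hu using h.effort_mono ht hu i
    · filter_upwards [self_mem_nhdsWithin] with u hu
      linarith [h.effort_sub_le ht hu i]
  · filter_upwards [self_mem_nhdsWithin] with u hu using h.effort_mono ht hu i

end IsSimplexControl

theorem IsCounting.eventually_eq {N : ℝ → ℕ} (h : IsCounting N) {t : ℝ} (ht : 0 ≤ t) :
    ∀ᶠ s in 𝓝[≥] t, N s = N t := by
  obtain ⟨ε, hε, hc⟩ := h.right_const t ht
  filter_upwards [Ico_mem_nhdsGE (show t < t + ε by linarith)] with s hs using hc s hs.1 hs.2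

/-! ### Feedback controls driven by counting functions -/

section Feedback

variable {d : ℕ}

/-- The queue lengths at time `x.1` when the cumulative effort is `x.2`. -/
def queueAt (A S : Fin d → ℝ → ℕ) (x : ℝ × (Fin d → ℝ)) (i : Fin d) : ℝ :=
  (A i x.1 : ℝ) - S i (x.2 i)

/-- Within `h` time units after the state `x`, a unit of time elapses or a queue changes. -/
def HasEvent (A S : Fin d → ℝ → ℕ) (Φ : (Fin d → ℝ) → Fin d → ℝ) (x : ℝ × (Fin d → ℝ))
    (h : ℝ) : Prop :=
  1 ≤ h ∨ (∃ i, A i (x.1 + h) ≠ A i x.1) ∨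
    ∃ i, S i (x.2 i + h * Φ (queueAt A S x) i) ≠ S i (x.2 i)

/-- The time until the next event. -/
noncomputable def holdingTime (A S : Fin d → ℝ → ℕ) (Φ : (Fin d → ℝ) → Fin d → ℝ)
    (x : ℝ × (Fin d → ℝ)) : ℝ := sInf {h | 0 ≤ h ∧ HasEvent A S Φ x h}

/-- The states (time, cumulative effort) at the successive events. -/
noncomputable def eventState (A S : Fin d → ℝ → ℕ) (Φ : (Fin d → ℝ) → Fin d → ℝ) :
    ℕ → ℝ × (Fin d → ℝ)
  | 0 => (0, 0)
  | k + 1 =>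
    ((eventState A S Φ k).1 + holdingTime A S Φ (eventState A S Φ k), fun i =>
      (eventState A S Φ k).2 i + holdingTime A S Φ (eventState A S Φ k) *
        Φ (queueAt A S (eventState A S Φ k)) i)

/-- The number of events up to time `t`. -/
noncomputable def eventIndex (A S : Fin d → ℝ → ℕ) (Φ : (Fin d → ℝ) → Fin d → ℝ) (t : ℝ) : ℕ :=
  sInf {k | t < (eventState A S Φ (k + 1)).1}

/-- The feedback control `B(t) = Φ(Q(t))`. -/
noncomputable def feedbackControl (A S : Fin d → ℝ → ℕ) (Φ : (Fin d → ℝ) → Fin d → ℝ) (t : ℝ) :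
    Fin d → ℝ := Φ (queueAt A S (eventState A S Φ (eventIndex A S Φ t)))

/-- The cumulative effort of the feedback control. -/
noncomputable def feedbackEffort (A S : Fin d → ℝ → ℕ) (Φ : (Fin d → ℝ) → Fin d → ℝ) (t : ℝ)
    (i : Fin d) : ℝ :=
  (eventState A S Φ (eventIndex A S Φ t)).2 i +
    (t - (eventState A S Φ (eventIndex A S Φ t)).1) * feedbackControl A S Φ t i

/-- Policies with values in the subprobability simplex. -/
structure IsPolicy (Φ : (Fin d → ℝ) → Fin d → ℝ) : Prop where
  nonneg : ∀ q i, 0 ≤ Φ q i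
  sum_le : ∀ q, ∑ i, Φ q i ≤ 1

variable {A S : Fin d → ℝ → ℕ} {Φ : (Fin d → ℝ) → Fin d → ℝ}

theorem IsPolicy.le_one (hΦ : IsPolicy Φ) (q : Fin d → ℝ) (i : Fin d) : Φ q i ≤ 1 :=
  (Finset.single_le_sum (f := fun j => Φ q j) (fun j _ => hΦ.nonneg q j)
    (Finset.mem_univ i)).trans (hΦ.sum_le q)

theorem HasEvent.mono (hA : ∀ i, IsCounting (A i)) (hS : ∀ i, IsCounting (S i)) (hΦ : IsPolicy Φ)
    {x : ℝ × (Fin d → ℝ)} {h h' : ℝ} (h0 : 0 ≤ h) (hle : h ≤ h') (he : HasEvent A S Φ x h) :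
    HasEvent A S Φ x h' := by
  rcases he with he | ⟨i, he⟩ | ⟨i, he⟩
  · exact Or.inl (he.trans hle)
  · refine Or.inr (Or.inl ⟨i, fun h1 => he ?_⟩)
    have h2 := (hA i).mono (show x.1 ≤ x.1 + h by linarith)
    have h3 := (hA i).mono (show x.1 + h ≤ x.1 + h' by linarith)
    omega
  · refine Or.inr (Or.inr ⟨i, fun h1 => he ?_⟩)
    have h4 := hΦ.nonneg (queueAt A S x) i
    have h2 := (hS i).mono (show x.2 i ≤ x.2 i + h * Φ (queueAt A S x) i by
      linarith [mul_nonneg h0 h4])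
    have h3 := (hS i).mono (show x.2 i + h * Φ (queueAt A S x) i ≤
      x.2 i + h' * Φ (queueAt A S x) i by linarith [mul_le_mul_of_nonneg_right hle h4])
    omega

/-- The artificial event after one unit of time keeps the infimum meaningful even when no queue
changes. -/
theorem holdingTime_set_nonempty (x : ℝ × (Fin d → ℝ)) :
    {h | 0 ≤ h ∧ HasEvent A S Φ x h}.Nonempty := ⟨1, zero_le_one, Or.inl le_rfl⟩

theorem holdingTime_set_bddBelow (x : ℝ × (Fin d → ℝ)) :
    BddBelow {h | 0 ≤ h ∧ HasEvent A S Φ x h} := ⟨0, fun _ h => h.1⟩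

theorem holdingTime_nonneg (x : ℝ × (Fin d → ℝ)) : 0 ≤ holdingTime A S Φ x :=
  le_csInf (holdingTime_set_nonempty x) fun _ h => h.1

theorem not_hasEvent_of_lt {x : ℝ × (Fin d → ℝ)} {h : ℝ} (h0 : 0 ≤ h)
    (hlt : h < holdingTime A S Φ x) : ¬ HasEvent A S Φ x h := fun he =>
  absurd (csInf_le (holdingTime_set_bddBelow x) ⟨h0, he⟩) (not_le.2 hlt)

/-- Once an event has occurred it persists, so rational times detect it. This reduces measurability
to countably many conditions. -/
theorem holdingTime_lt_iff (hA : ∀ i, IsCounting (A i)) (hS : ∀ i, IsCounting (S i))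
    (hΦ : IsPolicy Φ) {x : ℝ × (Fin d → ℝ)} {c : ℝ} :
    holdingTime A S Φ x < c ↔ ∃ p : ℚ, (0 : ℝ) ≤ p ∧ (p : ℝ) < c ∧ HasEvent A S Φ x p := by
  constructor
  · intro h
    obtain ⟨h', ⟨h0, he⟩, hc⟩ := exists_lt_of_csInf_lt (holdingTime_set_nonempty x) h
    obtain ⟨p, hp1, hp2⟩ := exists_rat_btwn hc
    exact ⟨p, h0.trans hp1.le, hp2, he.mono hA hS hΦ h0 hp1.le⟩
  · rintro ⟨p, h0, hc, he⟩
    exact (csInf_le (holdingTime_set_bddBelow x) ⟨h0, he⟩).trans_lt hc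

theorem eventually_not_hasEvent (hA : ∀ i, IsCounting (A i)) (hS : ∀ i, IsCounting (S i))
    (hΦ : IsPolicy Φ) {x : ℝ × (Fin d → ℝ)} (hx1 : 0 ≤ x.1) (hx2 : ∀ i, 0 ≤ x.2 i) {h : ℝ}
    (h0 : 0 ≤ h) (hno : ¬ HasEvent A S Φ x h) : ∀ᶠ h' in 𝓝[≥] h, ¬ HasEvent A S Φ x h' := by
  have hlt : h < 1 := not_le.1 fun h1 => hno (Or.inl h1)
  have hAe : ∀ i, A i (x.1 + h) = A i x.1 := fun i => by
    by_contra h1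
    exact hno (Or.inr (Or.inl ⟨i, h1⟩))
  have hSe : ∀ i, S i (x.2 i + h * Φ (queueAt A S x) i) = S i (x.2 i) := fun i => by
    by_contra h1
    exact hno (Or.inr (Or.inr ⟨i, h1⟩))
  have e1 : ∀ᶠ h' in 𝓝[≥] h, ∀ i, A i (x.1 + h') = A i x.1 := by
    refine eventually_all.2 fun i => ?_
    have ht : Tendsto (fun h' => x.1 + h') (𝓝[≥] h) (𝓝[≥] (x.1 + h)) :=
      tendsto_nhdsWithin_iff.2 ⟨((continuous_const.add continuous_id).tendsto h).mono_left
        nhdsWithin_le_nhds, by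
          filter_upwards [self_mem_nhdsWithin] with h' hh'
          exact Set.mem_Ici.2 (add_le_add_right hh' _)⟩
    filter_upwards [ht.eventually ((hA i).eventually_eq (add_nonneg hx1 h0))] with h' hh'
    rw [hh', hAe]
  have e2 : ∀ᶠ h' in 𝓝[≥] h, ∀ i, S i (x.2 i + h' * Φ (queueAt A S x) i) = S i (x.2 i) := by
    refine eventually_all.2 fun i => ?_
    have hn := hΦ.nonneg (queueAt A S x) i
    have hc : Continuous fun h' : ℝ => x.2 i + h' * Φ (queueAt A S x) i := by fun_prop
    have ht : Tendsto (fun h' => x.2 i + h' * Φ (queueAt A S x) i) (𝓝[≥] h)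
        (𝓝[≥] (x.2 i + h * Φ (queueAt A S x) i)) :=
      tendsto_nhdsWithin_iff.2 ⟨(hc.tendsto h).mono_left nhdsWithin_le_nhds, by
          filter_upwards [self_mem_nhdsWithin] with h' hh'
          exact Set.mem_Ici.2 (add_le_add_right (mul_le_mul_of_nonneg_right hh' hn) _)⟩
    filter_upwards [ht.eventually ((hS i).eventually_eq
      (add_nonneg (hx2 i) (mul_nonneg h0 hn)))] with h' hh'
    rw [hh', hSe]
  filter_upwards [e1, e2, Ico_mem_nhdsGE hlt] with h' h1 h2 h3
  rintro (h4 | ⟨i, h4⟩ | ⟨i, h4⟩)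
  · exact absurd h3.2 (not_lt.2 h4)
  · exact h4 (h1 i)
  · exact h4 (h2 i)

/-- Right-constancy of the counts makes the absence of an event persist for a short while, so the
infimum is attained. -/
theorem hasEvent_holdingTime (hA : ∀ i, IsCounting (A i)) (hS : ∀ i, IsCounting (S i))
    (hΦ : IsPolicy Φ) {x : ℝ × (Fin d → ℝ)} (hx1 : 0 ≤ x.1) (hx2 : ∀ i, 0 ≤ x.2 i) :
    HasEvent A S Φ x (holdingTime A S Φ x) := by
  by_contra hno
  have h := eventually_not_hasEvent hA hS hΦ hx1 hx2 (holdingTime_nonneg x) hno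
  obtain ⟨ε, hε, hc⟩ := (mem_nhdsGE_iff_exists_Ico_subset).1 h
  obtain ⟨h', ⟨h0, he⟩, hlt⟩ := exists_lt_of_csInf_lt (holdingTime_set_nonempty x)
    (show sInf {h | 0 ≤ h ∧ HasEvent A S Φ x h} < ε from hε)
  exact hc ⟨csInf_le (holdingTime_set_bddBelow x) ⟨h0, he⟩, hlt⟩ he

theorem holdingTime_pos (hA : ∀ i, IsCounting (A i)) (hS : ∀ i, IsCounting (S i))
    (hΦ : IsPolicy Φ) {x : ℝ × (Fin d → ℝ)} (hx1 : 0 ≤ x.1) (hx2 : ∀ i, 0 ≤ x.2 i) :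
    0 < holdingTime A S Φ x := by
  rcases (holdingTime_nonneg (A := A) (S := S) (Φ := Φ) x).lt_or_eq with h | h
  · exact h
  · exfalso
    have he := hasEvent_holdingTime hA hS hΦ hx1 hx2
    rw [← h] at he
    rcases he with he | ⟨i, he⟩ | ⟨i, he⟩
    · linarith
    · simp at he
    · simp at he

theorem eventState_bounds (hΦ : IsPolicy Φ) (k : ℕ) : 0 ≤ (eventState A S Φ k).1 ∧
    ∀ i, 0 ≤ (eventState A S Φ k).2 i ∧ (eventState A S Φ k).2 i ≤ (eventState A S Φ k).1 := by
  induction k with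
  | zero => simp [eventState]
  | succ k ih =>
    have h0 := holdingTime_nonneg (A := A) (S := S) (Φ := Φ) (eventState A S Φ k)
    refine ⟨add_nonneg ih.1 h0, fun i => ⟨?_, ?_⟩⟩
    · exact add_nonneg (ih.2 i).1 (mul_nonneg h0 (hΦ.nonneg _ i))
    · exact add_le_add (ih.2 i).2 (mul_le_of_le_one_right h0 (hΦ.le_one _ i))

/-! ### The chain of events: non-explosion and the feedback equation -/

section States

variable (hA : ∀ i, IsCounting (A i)) (hS : ∀ i, IsCounting (S i)) (hΦ : IsPolicy Φ)
include hA hS hΦ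

theorem eventTime_lt_succ (k : ℕ) :
    (eventState A S Φ k).1 < (eventState A S Φ (k + 1)).1 := by
  have h := eventState_bounds (A := A) (S := S) hΦ k
  exact lt_add_of_pos_right _ (holdingTime_pos hA hS hΦ h.1 fun i => (h.2 i).1)

theorem eventTime_strictMono : StrictMono fun k => (eventState A S Φ k).1 :=
  strictMono_nat_of_lt_succ (eventTime_lt_succ hA hS hΦ)

/-- Each event consumes a unit of time or raises some count by at least one. As efforts never exceed
time, the counts are bounded on bounded time intervals, so events cannot accumulate. -/
theorem le_eventTime_add_count (k : ℕ) : (k : ℝ) ≤ (eventState A S Φ k).1 +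
    ((∑ i, (A i (eventState A S Φ k).1 + S i ((eventState A S Φ k).2 i)) : ℕ) : ℝ) := by
  induction k with
  | zero =>
    simp only [eventState, Nat.cast_zero]
    positivity
  | succ k ih =>
    have hb := eventState_bounds (A := A) (S := S) hΦ k
    have hev := hasEvent_holdingTime hA hS hΦ hb.1 fun i => (hb.2 i).1
    set x := eventState A S Φ k with hx
    set h := holdingTime A S Φ x with hh
    have h0 : 0 ≤ h := holdingTime_nonneg x
    have hx' : eventState A S Φ (k + 1) =
        (x.1 + h, fun i => x.2 i + h * Φ (queueAt A S x) i) := rfl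
    rw [hx']
    have hAm : ∀ i, A i x.1 ≤ A i (x.1 + h) := fun i => (hA i).mono (by linarith)
    have hSm : ∀ i, S i (x.2 i) ≤ S i (x.2 i + h * Φ (queueAt A S x) i) := fun i =>
      (hS i).mono (by linarith [mul_nonneg h0 (hΦ.nonneg (queueAt A S x) i)])
    have hcase : 1 ≤ h ∨ (∑ i, (A i x.1 + S i (x.2 i))) + 1 ≤
        ∑ i, (A i (x.1 + h) + S i (x.2 i + h * Φ (queueAt A S x) i)) := by
      rcases hev with he | ⟨i, he⟩ | ⟨i, he⟩
      · exact Or.inl he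
      · refine Or.inr (Finset.sum_lt_sum (fun j _ => add_le_add (hAm j) (hSm j))
          ⟨i, Finset.mem_univ i, ?_⟩)
        have := hAm i
        have := hSm i
        omega
      · refine Or.inr (Finset.sum_lt_sum (fun j _ => add_le_add (hAm j) (hSm j))
          ⟨i, Finset.mem_univ i, ?_⟩)
        have := hAm i
        have := hSm i
        omega
    rcases hcase with hc | hc
    · have h2 : ((∑ i, (A i x.1 + S i (x.2 i)) : ℕ) : ℝ) ≤
          ((∑ i, (A i (x.1 + h) + S i (x.2 i + h * Φ (queueAt A S x) i)) : ℕ) : ℝ) :=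
        Nat.cast_le.2 (Finset.sum_le_sum fun j _ => add_le_add (hAm j) (hSm j))
      push_cast at ih h2 ⊢
      linarith
    · have h2 : (((∑ i, (A i x.1 + S i (x.2 i))) + 1 : ℕ) : ℝ) ≤
          ((∑ i, (A i (x.1 + h) + S i (x.2 i + h * Φ (queueAt A S x) i)) : ℕ) : ℝ) :=
        Nat.cast_le.2 hc
      push_cast at ih h2 ⊢
      linarith

theorem exists_lt_eventTime (t : ℝ) : ∃ k, t < (eventState A S Φ (k + 1)).1 := by
  by_contra hno
  push Not at hno
  obtain ⟨k, hk⟩ := exists_nat_gt (t + ((∑ i, (A i t + S i t) : ℕ) : ℝ))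
  have hk' : (k : ℝ) < ((k + 1 : ℕ) : ℝ) := by
    push_cast
    linarith
  have h1 := le_eventTime_add_count hA hS hΦ (k + 1)
  have h2 : ((∑ i, (A i (eventState A S Φ (k + 1)).1 + S i ((eventState A S Φ (k + 1)).2 i)) : ℕ)
      : ℝ) ≤ ((∑ i, (A i t + S i t) : ℕ) : ℝ) :=
    Nat.cast_le.2 (Finset.sum_le_sum fun i _ => add_le_add ((hA i).mono (hno k))
      ((hS i).mono ((((eventState_bounds (A := A) (S := S) hΦ (k + 1)).2 i).2).trans (hno k))))
  linarith [hno k]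

theorem eventIndex_le_iff {t : ℝ} {k : ℕ} :
    eventIndex A S Φ t ≤ k ↔ t < (eventState A S Φ (k + 1)).1 := by
  constructor
  · intro h
    have h1 : t < (eventState A S Φ (eventIndex A S Φ t + 1)).1 :=
      Nat.sInf_mem (exists_lt_eventTime hA hS hΦ t)
    exact h1.trans_le ((eventTime_strictMono hA hS hΦ).monotone (by omega))
  · intro h
    exact Nat.sInf_le h

theorem eventTime_le {t : ℝ} (ht : 0 ≤ t) : (eventState A S Φ (eventIndex A S Φ t)).1 ≤ t := by
  rcases h : eventIndex A S Φ t with _ | k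
  · simpa [eventState] using ht
  · by_contra hlt
    have := (eventIndex_le_iff hA hS hΦ).2 (not_le.1 hlt)
    omega

theorem eventIndex_eq {t : ℝ} {k : ℕ} (h1 : (eventState A S Φ k).1 ≤ t)
    (h2 : t < (eventState A S Φ (k + 1)).1) : eventIndex A S Φ t = k := by
  refine le_antisymm ((eventIndex_le_iff hA hS hΦ).2 h2) ?_
  by_contra hlt
  push Not at hlt
  obtain ⟨j, rfl⟩ : ∃ j, k = j + 1 := ⟨k - 1, by omega⟩
  have := (eventIndex_le_iff hA hS hΦ (t := t) (k := j)).1 (by omega)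
  linarith

theorem feedbackControl_eq {t : ℝ} {k : ℕ} (h1 : (eventState A S Φ k).1 ≤ t)
    (h2 : t < (eventState A S Φ (k + 1)).1) :
    feedbackControl A S Φ t = Φ (queueAt A S (eventState A S Φ k)) := by
  rw [feedbackControl, eventIndex_eq hA hS hΦ h1 h2]

theorem isSimplexControl_feedbackControl : IsSimplexControl (feedbackControl A S Φ) := by
  refine ⟨⟨fun t ht => ?_, fun t ht => ?_⟩, fun t i _ => hΦ.nonneg _ i, fun t _ => hΦ.sum_le _⟩
  · have h1 := eventTime_le hA hS hΦ ht
    have h2 := (eventIndex_le_iff hA hS hΦ (t := t)).1 le_rfl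
    refine (continuousWithinAt_const (b := feedbackControl A S Φ t)).congr_of_eventuallyEq ?_ rfl
    filter_upwards [Ico_mem_nhdsGE h2] with s hs
    exact feedbackControl_eq hA hS hΦ (h1.trans hs.1) hs.2
  -- The interval is open on the left and closed on the right, so at an event time the left limit is
  -- the value before the event.
  · obtain ⟨k, hk1, hk2⟩ : ∃ k, (eventState A S Φ k).1 < t ∧ t ≤ (eventState A S Φ (k + 1)).1 := by
      have hex : ∃ k, t ≤ (eventState A S Φ (k + 1)).1 :=
        (exists_lt_eventTime hA hS hΦ t).imp fun _ h => h.le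
      classical
      refine ⟨Nat.find hex, ?_, Nat.find_spec hex⟩
      rcases h : Nat.find hex with _ | j
      · simpa [eventState] using ht
      · have := Nat.find_min hex (m := j) (by omega)
        exact not_le.1 this
    refine ⟨Φ (queueAt A S (eventState A S Φ k)), tendsto_const_nhds.congr' ?_⟩
    filter_upwards [Ioo_mem_nhdsLT hk1] with s hs
    exact (feedbackControl_eq hA hS hΦ hs.1.le (hs.2.trans_le hk2)).symm

theorem effort_sub_of_mem {t : ℝ} {k : ℕ} (h1 : (eventState A S Φ k).1 ≤ t)
    (h2 : t ≤ (eventState A S Φ (k + 1)).1) (i : Fin d) :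
    QueueParams.effort (feedbackControl A S Φ) t i -
      QueueParams.effort (feedbackControl A S Φ) (eventState A S Φ k).1 i =
      (t - (eventState A S Φ k).1) * Φ (queueAt A S (eventState A S Φ k)) i := by
  have h0 := (eventState_bounds (A := A) (S := S) hΦ k).1
  rw [(isSimplexControl_feedbackControl hA hS hΦ).effort_sub h0 (h0.trans h1),
    intervalIntegral.integral_congr_Ioo_of_le h1
      (g := fun _ => Φ (queueAt A S (eventState A S Φ k)) i) fun u hu => ?_]
  · simp
  · simp only
    rw [feedbackControl_eq hA hS hΦ hu.1.le (hu.2.trans_le h2)]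

theorem effort_eventTime (k : ℕ) (i : Fin d) :
    QueueParams.effort (feedbackControl A S Φ) (eventState A S Φ k).1 i =
      (eventState A S Φ k).2 i := by
  induction k with
  | zero => simp [eventState, QueueParams.effort]
  | succ k ih =>
    have h := effort_sub_of_mem hA hS hΦ (eventTime_lt_succ hA hS hΦ k).le le_rfl i
    rw [ih] at h
    have h2 : (eventState A S Φ (k + 1)).1 - (eventState A S Φ k).1 =
        holdingTime A S Φ (eventState A S Φ k) := by simp [eventState]
    rw [h2] at h
    have h3 : (eventState A S Φ (k + 1)).2 i = (eventState A S Φ k).2 i +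
        holdingTime A S Φ (eventState A S Φ k) * Φ (queueAt A S (eventState A S Φ k)) i := rfl
    rw [h3]
    linarith

theorem effort_feedbackControl {t : ℝ} (ht : 0 ≤ t) (i : Fin d) :
    QueueParams.effort (feedbackControl A S Φ) t i = feedbackEffort A S Φ t i := by
  have h1 := eventTime_le hA hS hΦ ht
  have h2 := (eventIndex_le_iff hA hS hΦ (t := t)).1 le_rfl
  have h := effort_sub_of_mem hA hS hΦ h1 h2.le i
  rw [effort_eventTime hA hS hΦ] at h
  rw [feedbackEffort, feedbackControl]
  linarith

/-- The feedback control solves its defining equation. -/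
theorem feedbackControl_spec {t : ℝ} (ht : 0 ≤ t) : feedbackControl A S Φ t =
    Φ (queueAt A S (t, QueueParams.effort (feedbackControl A S Φ) t)) := by
  have h1 := eventTime_le hA hS hΦ ht
  have h2 := (eventIndex_le_iff hA hS hΦ (t := t)).1 le_rfl
  set k := eventIndex A S Φ t with hk
  set x := eventState A S Φ k with hx
  have h3 : t - x.1 < holdingTime A S Φ x := by
    have : (eventState A S Φ (k + 1)).1 = x.1 + holdingTime A S Φ x := rfl
    linarith
  -- Strictly between events no count moves, so the queue stored at the last event is still the
  -- current one.
  have hno := not_hasEvent_of_lt (sub_nonneg.2 h1) h3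
  rw [feedbackControl_eq hA hS hΦ h1 h2]
  congr 1
  funext i
  have hAe : A i t = A i x.1 := by
    by_contra hne
    exact hno (Or.inr (Or.inl ⟨i, by simpa using hne⟩))
  have hSe : S i (QueueParams.effort (feedbackControl A S Φ) t i) = S i (x.2 i) := by
    by_contra hne
    refine hno (Or.inr (Or.inr ⟨i, ?_⟩))
    rwa [effort_feedbackControl hA hS hΦ ht, feedbackEffort, feedbackControl, ← hk, ← hx] at hne
  simp only [queueAt]
  rw [hAe, hSe]

end States

/-- Uniqueness of feedback controls. -/
theorem feedback_unique (hS : ∀ i, IsCounting (S i))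
    {B B' : ℝ → Fin d → ℝ} (hB : IsSimplexControl B) (hB' : IsSimplexControl B')
    (h : ∀ t, 0 ≤ t → B t = Φ (queueAt A S (t, QueueParams.effort B t)))
    (h' : ∀ t, 0 ≤ t → B' t = Φ (queueAt A S (t, QueueParams.effort B' t))) {t : ℝ}
    (ht : 0 ≤ t) : B t = B' t := by
  obtain ⟨τ, hτ0, hτt, hno, hnear⟩ := exists_last_time
    (P := fun s => ∀ u, 0 ≤ u → u ≤ s → QueueParams.effort B u = QueueParams.effort B' u)
    (fun u h1 h2 => by
      funext i
      simp [le_antisymm h2 h1, QueueParams.effort]) ht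
  have hτ : ∀ u, 0 ≤ u → u ≤ τ → QueueParams.effort B u = QueueParams.effort B' u := by
    intro u hu huτ
    rcases huτ.lt_or_eq with hlt | rfl
    · obtain ⟨s, hs, hsτ, hlt', hP⟩ := hnear (τ - u) (by linarith)
      exact hP u hu (by linarith)
    -- At `τ` itself agreement follows from agreement at times just before, because both efforts are
    -- monotone and 1-Lipschitz.
    · funext i
      refine le_antisymm ?_ ?_ <;> refine le_of_forall_pos_le_add fun ε hε => ?_ <;>
        obtain ⟨s, hs, hsu, hlt, hP⟩ := hnear ε hε <;>
        have e1 := congrFun (hP s hs le_rfl) i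
      · linarith [hB.effort_sub_le hs hsu i, hB'.effort_mono hs hsu i]
      · linarith [hB'.effort_sub_le hs hsu i, hB.effort_mono hs hsu i]
  rcases hτt.lt_or_eq with hlt | rfl
  · exfalso
    -- Just after `τ` neither service count moves. The two controls then see the same queues and
    -- coincide, which extends the agreement of the efforts beyond `τ`.
    have e1 : ∀ᶠ u in 𝓝[≥] τ, ∀ i, S i (QueueParams.effort B u i) =
        S i (QueueParams.effort B τ i) := eventually_all.2 fun i =>
      (hB.eventually_effort hτ0 i).eventually ((hS i).eventually_eq (hB.effort_nonneg hτ0 i))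
    have e2 : ∀ᶠ u in 𝓝[≥] τ, ∀ i, S i (QueueParams.effort B' u i) =
        S i (QueueParams.effort B' τ i) := eventually_all.2 fun i =>
      (hB'.eventually_effort hτ0 i).eventually ((hS i).eventually_eq (hB'.effort_nonneg hτ0 i))
    obtain ⟨c, hc, hsub⟩ := mem_nhdsGE_iff_exists_Ico_subset.1 (e1.and e2)
    have heq : ∀ u, τ ≤ u → u < c → B u = B' u := by
      intro u hu huc
      obtain ⟨h1, h2⟩ := hsub ⟨hu, huc⟩
      rw [h u (hτ0.trans hu), h' u (hτ0.trans hu)]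
      congr 1
      funext i
      simp only [queueAt]
      rw [h1 i, h2 i, hτ τ hτ0 le_rfl]
    set v := min t ((τ + c) / 2) with hv
    have hc' : τ < c := hc
    have hv1 : τ < v := lt_min hlt (by linarith)
    have hv2 : v < c := (min_le_right _ _).trans_lt (by linarith)
    refine hno v hv1 (min_le_left _ _) fun u hu huv => ?_
    rcases le_total u τ with huτ | hτu
    · exact hτ u hu huτ
    · funext i
      have f1 := hB.effort_sub hτ0 hu i
      have f2 := hB'.effort_sub hτ0 hu i
      rw [intervalIntegral.integral_congr_Ioo_of_le hτu (g := fun s => B' s i)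
        fun s hs => congrFun (heq s hs.1.le (hs.2.trans (huv.trans_lt hv2))) i] at f1
      have f3 := congrFun (hτ τ hτ0 le_rfl) i
      linarith
  · rw [h τ ht, h' τ ht, hτ τ ht le_rfl]

/-! Measurable dependence on the data. -/

section Measurable

variable {α : Type*} [MeasurableSpace α] {A S : α → Fin d → ℝ → ℕ}

/-- The hypotheses concern counts at arbitrary measurable times, because the induction evaluates
them at the random event times and efforts. -/
theorem measurable_eventState (hA : ∀ a i, IsCounting (A a i)) (hS : ∀ a i, IsCounting (S a i))
    (hΦ : IsPolicy Φ) (hΦm : Measurable Φ)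
    (hAm : ∀ i (τ : α → ℝ), Measurable τ → Measurable fun a => A a i (τ a))
    (hSm : ∀ i (τ : α → ℝ), Measurable τ → Measurable fun a => S a i (τ a)) (k : ℕ) :
    Measurable fun a => eventState (A a) (S a) Φ k := by
  induction k with
  | zero => exact measurable_const
  | succ k ih =>
    have h1 : Measurable fun a => (eventState (A a) (S a) Φ k).1 := measurable_fst.comp ih
    have h2 : ∀ i, Measurable fun a => (eventState (A a) (S a) Φ k).2 i := fun i =>
      (measurable_pi_apply i).comp (measurable_snd.comp ih)
    have hq : Measurable fun a => queueAt (A a) (S a) (eventState (A a) (S a) Φ k) := by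
      refine measurable_pi_lambda _ fun i => ?_
      exact (measurable_from_top.comp (hAm i _ h1)).sub (measurable_from_top.comp (hSm i _ (h2 i)))
    have hp : ∀ i, Measurable fun a => Φ (queueAt (A a) (S a) (eventState (A a) (S a) Φ k)) i :=
      fun i => (measurable_pi_apply i).comp (hΦm.comp hq)
    have hh : Measurable fun a => holdingTime (A a) (S a) Φ (eventState (A a) (S a) Φ k) := by
      refine measurable_of_Iio fun c => ?_
      have : (fun a => holdingTime (A a) (S a) Φ (eventState (A a) (S a) Φ k)) ⁻¹' Set.Iio c =
          ⋃ p : ℚ, {a | (0 : ℝ) ≤ p ∧ (p : ℝ) < c ∧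
            HasEvent (A a) (S a) Φ (eventState (A a) (S a) Φ k) p} := by
        ext a
        rw [Set.mem_preimage, Set.mem_Iio, holdingTime_lt_iff (hA a) (hS a) hΦ]
        simp
      rw [this]
      refine MeasurableSet.iUnion fun p => ?_
      refine measurableSet_setOfPred.2 (measurable_const.and (measurable_const.and
        (measurable_const.or (Measurable.or (Measurable.exists fun i => Measurable.not ?_)
          (Measurable.exists fun i => Measurable.not ?_)))))
      · exact measurableSet_setOfPred.1 (measurableSet_eq_fun (hAm i _ (h1.add_const _)) (hAm i _ h1))
      · exact measurableSet_setOfPred.1 (measurableSet_eq_fun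
          (hSm i _ ((h2 i).add ((hp i).const_mul _))) (hSm i _ (h2 i)))
    refine Measurable.prodMk (h1.add hh) (measurable_pi_lambda _ fun i => ?_)
    exact (h2 i).add (hh.mul (hp i))

/-- The time may depend on the sample, which later gives joint measurability in the sample and time.
Since the event index takes countably many values, composing it with the states stays measurable. -/
theorem measurable_feedback (hA : ∀ a i, IsCounting (A a i)) (hS : ∀ a i, IsCounting (S a i))
    (hΦ : IsPolicy Φ) (hΦm : Measurable Φ)
    (hAm : ∀ i (τ : α → ℝ), Measurable τ → Measurable fun a => A a i (τ a))
    (hSm : ∀ i (τ : α → ℝ), Measurable τ → Measurable fun a => S a i (τ a)) {t : α → ℝ}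
    (ht : Measurable t) :
    (Measurable fun a => feedbackControl (A a) (S a) Φ (t a)) ∧
      ∀ i, Measurable fun a => feedbackEffort (A a) (S a) Φ (t a) i := by
  have hst := measurable_eventState hA hS hΦ hΦm hAm hSm
  have hidx : Measurable fun a => eventIndex (A a) (S a) Φ (t a) := by
    refine measurable_of_Iic fun k => ?_
    have : (fun a => eventIndex (A a) (S a) Φ (t a)) ⁻¹' Set.Iic k =
        {a | t a < (eventState (A a) (S a) Φ (k + 1)).1} := by
      ext a
      exact eventIndex_le_iff (hA a) (hS a) hΦ
    rw [this]
    exact measurableSet_lt ht (measurable_fst.comp (hst (k + 1)))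
  have hx : Measurable fun a => eventState (A a) (S a) Φ (eventIndex (A a) (S a) Φ (t a)) :=
    (measurable_from_prod_countable_left (f := fun p : α × ℕ => eventState (A p.1) (S p.1) Φ p.2)
      hst).comp (measurable_id.prodMk hidx)
  have h1 := measurable_fst.comp hx
  have h2 : ∀ i, Measurable fun a =>
      (eventState (A a) (S a) Φ (eventIndex (A a) (S a) Φ (t a))).2 i := fun i =>
    (measurable_pi_apply i).comp (measurable_snd.comp hx)
  have hc : Measurable fun a => feedbackControl (A a) (S a) Φ (t a) := by
    refine hΦm.comp (measurable_pi_lambda _ fun i => ?_)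
    exact (measurable_from_top.comp (hAm i _ h1)).sub (measurable_from_top.comp (hSm i _ (h2 i)))
  refine ⟨hc, fun i => ?_⟩
  exact (h2 i).add ((ht.sub h1).mul ((measurable_pi_apply i).comp hc))

end Measurable

end Feedback

/-! ### The generalized `cμ` rule -/

namespace QueueParams

variable {d : ℕ} (M : QueueParams d)

open Classical in
/-- The generalized `cμ` rule as a function of the queue lengths `q`, scaled by `c`. -/
noncomputable def cmuPolicy (c : ℝ) (q : Fin d → ℝ) (i : Fin d) : ℝ :=
  if (fun j => q j / c) ∈ M.region i then 1 else 0

variable {M}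

theorem mem_region_unique {q : Fin d → ℝ} {i j : Fin d} (hi : q ∈ M.region i)
    (hj : q ∈ M.region j) : i = j := by
  rcases lt_trichotomy i j with h | h | h
  · exact absurd (hj.2.2.2 i h) (not_lt.2 (hi.2.2.1 j))
  · exact h
  · exact absurd (hi.2.2.2 j h) (not_lt.2 (hj.2.2.1 i))

theorem exists_mem_region {q : Fin d → ℝ} (hq : ∀ j, 0 ≤ q j) (hne : q ≠ 0) :
    ∃ i, q ∈ M.region i := by
  classical
  obtain ⟨k, hk⟩ := Function.ne_iff.1 hne
  obtain ⟨m, -, hm⟩ := Finset.exists_max_image Finset.univ (fun j => M.mu j * M.dC j (q j))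
    ⟨k, Finset.mem_univ k⟩
  set S : Finset (Fin d) :=
    Finset.univ.filter fun i => ∀ j, M.mu j * M.dC j (q j) ≤ M.mu i * M.dC i (q i)
  have hS : S.Nonempty := ⟨m, by simpa [S] using hm⟩
  have hmin : ∀ j, M.mu j * M.dC j (q j) ≤ M.mu (S.min' hS) * M.dC (S.min' hS) (q (S.min' hS)) := by
    simpa [S] using S.min'_mem hS
  refine ⟨S.min' hS, hq, hne, hmin, fun j hj => lt_of_not_ge fun hge => ?_⟩
  have hjS : j ∈ S := by
    simp only [S, Finset.mem_filter, Finset.mem_univ, true_and]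
    exact fun l => (hmin l).trans hge
  exact absurd (S.min'_le j hjS) (not_le.2 hj)

theorem sum_cmuPolicy_of_mem {c : ℝ} {q : Fin d → ℝ} {i : Fin d}
    (hi : (fun j => q j / c) ∈ M.region i) : ∑ j, M.cmuPolicy c q j = 1 := by
  rw [Finset.sum_eq_single i]
  · simp [cmuPolicy, hi]
  · intro j _ hji
    exact if_neg fun hj => hji (mem_region_unique hj hi)
  · simp

theorem isPolicy_cmuPolicy (c : ℝ) : IsPolicy (M.cmuPolicy c) := by
  refine ⟨fun q i => ?_, fun q => ?_⟩
  · unfold cmuPolicy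
    split_ifs
    · exact zero_le_one
    · exact le_rfl
  · by_cases h : ∃ i, (fun j => q j / c) ∈ M.region i
    · obtain ⟨i, hi⟩ := h
      exact (sum_cmuPolicy_of_mem hi).le
    · have h0 : ∀ i, M.cmuPolicy c q i = 0 := fun i => if_neg fun hi => h ⟨i, hi⟩
      simp [h0]

theorem mem_region_of_cmuPolicy_ne_zero {c : ℝ} {q : Fin d → ℝ} {i : Fin d}
    (h : M.cmuPolicy c q i ≠ 0) : (fun j => q j / c) ∈ M.region i := by
  by_contra hno
  exact h (if_neg hno)

theorem sum_cmuPolicy {c : ℝ} {q : Fin d → ℝ} (hq : ∀ j, 0 ≤ q j / c)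
    (hne : (fun j => q j / c) ≠ 0) : ∑ j, M.cmuPolicy c q j = 1 :=
  sum_cmuPolicy_of_mem (exists_mem_region hq hne).choose_spec

theorem cmuPolicy_eq_zero_of_marg_lt {c : ℝ} {q : Fin d → ℝ} {i j : Fin d}
    (h : M.marg i (q i / c) < M.marg j (q j / c)) : M.cmuPolicy c q i = 0 := by
  by_contra hno
  have hr := mem_region_of_cmuPolicy_ne_zero hno
  rw [marg_of_nonneg i (hr.1 i), marg_of_nonneg j (hr.1 j)] at h
  exact absurd (hr.2.2.1 j) (not_le.2 h)

/-- Some coordinate is positive and has a positive marginal cost, so the maximal marginal cost is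
positive; at an empty class it would vanish. Thus the rule never serves an empty class. -/
theorem pos_of_mem_region (hM : M.HeavyTraffic) (hC : M.CostConditions) {q : Fin d → ℝ}
    {i : Fin d} (h : q ∈ M.region i) : 0 < q i := by
  obtain ⟨h0, hne, hmax, -⟩ := h
  obtain ⟨j, hj⟩ := Function.ne_iff.1 hne
  have hj' : 0 < q j := lt_of_le_of_ne (h0 j) (Ne.symm hj)
  have h1 : 0 < M.mu j * M.dC j (q j) := mul_pos (hM.mu_pos j) ((hC.dC_pos_iff j (h0 j)).2 hj')
  exact (hC.dC_pos_iff i (h0 i)).1 ((mul_pos_iff_of_pos_left (hM.mu_pos i)).1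
    (h1.trans_le (hmax j)))

theorem pos_of_cmuPolicy_ne_zero (hM : M.HeavyTraffic) (hC : M.CostConditions) {c : ℝ}
    (hc : 0 < c) {q : Fin d → ℝ} {i : Fin d} (h : M.cmuPolicy c q i ≠ 0) : 0 < q i :=
  (div_pos_iff_of_pos_right hc).1 (pos_of_mem_region hM hC (mem_region_of_cmuPolicy_ne_zero h))

theorem measurableSet_region (hC : M.CostConditions) (i : Fin d) :
    MeasurableSet (M.region i) := by
  have hm : ∀ j, Measurable fun q : Fin d → ℝ => M.marg j (q j) := fun j =>
    (hC.marg_continuous j).measurable.comp (measurable_pi_apply j)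
  -- On the nonnegative orthant `dC` may be replaced by `marg`, which is continuous on the whole
  -- line.
  have h1 : M.region i = {q | (∀ j, 0 ≤ q j) ∧ ¬ q = 0 ∧
      (∀ j, M.marg j (q j) ≤ M.marg i (q i)) ∧
      ∀ j, j < i → M.marg j (q j) < M.marg i (q i)} := by
    ext q
    simp only [region, Set.mem_ofPred_eq]
    refine and_congr_right fun h0 => ?_
    simp only [marg_of_nonneg _ (h0 _), ne_eq]
  rw [h1]
  refine measurableSet_setOfPred.2 (Measurable.and (Measurable.forall fun j => ?_)
    (Measurable.and (Measurable.not ?_) (Measurable.and (Measurable.forall fun j => ?_)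
      (Measurable.forall fun j => Measurable.imp measurable_const ?_))))
  · exact measurableSet_setOfPred.1 (measurableSet_le measurable_const (measurable_pi_apply j))
  · exact measurableSet_setOfPred.1 (measurableSet_eq_fun measurable_id measurable_const)
  · exact measurableSet_setOfPred.1 (measurableSet_le (hm j) (hm i))
  · exact measurableSet_setOfPred.1 (measurableSet_lt (hm j) (hm i))

theorem measurable_cmuPolicy (hC : M.CostConditions) (c : ℝ) : Measurable (M.cmuPolicy c) := by
  classical
  refine measurable_pi_lambda _ fun i => ?_
  refine Measurable.ite ?_ measurable_const measurable_const
  exact (measurable_pi_lambda _ fun j => (measurable_pi_apply j).div_const c)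
    (measurableSet_region hC i)

variable (M) in
/-- `B` follows the generalized `cμ` rule along a sample of the primitive data. -/
structure IsCMuControl (n : ℕ) (ia st : Fin d → ℕ → ℝ) (B : ℝ → Fin d → ℝ) : Prop where
  rcll : IsRCLL B
  eq : ∀ t, 0 ≤ t → B t = M.cmuPolicy (M.scale n) (M.queue n ia st B t)

theorem isCMuControl_iff {n : ℕ} {ia st : Fin d → ℕ → ℝ} {B : ℝ → Fin d → ℝ} :
    M.IsCMuControl n ia st B ↔ IsRCLL B ∧ ∀ t, 0 ≤ t → ∀ i,
      B t i = open Classical in if M.queueT n ia st B t ∈ M.region i then 1 else 0 :=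
  ⟨fun h => ⟨h.rcll, fun t ht i => by rw [h.eq t ht]; rfl⟩,
    fun h => ⟨h.1, fun t ht => funext fun i => by rw [h.2 t ht i]; rfl⟩⟩

/-- The arrival counting functions. -/
noncomputable abbrev arrCount (M : QueueParams d) (n : ℕ) (ia : Fin d → ℕ → ℝ) (i : Fin d) :
    ℝ → ℕ :=
  renewalCount (M.lamN n i) (ia i)

/-- The service counting functions. -/
noncomputable abbrev srvCount (M : QueueParams d) (n : ℕ) (st : Fin d → ℕ → ℝ) (i : Fin d) :
    ℝ → ℕ :=
  renewalCount (M.muN n i) (st i)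

theorem HeavyTraffic.scale_pos (hM : M.HeavyTraffic) {n : ℕ} (hn : 1 ≤ n) : 0 < M.scale n :=
  mul_pos (hM.b_pos n hn) (Real.sqrt_pos.2 (by exact_mod_cast hn))

theorem HeavyTraffic.isCounting_arr (hM : M.HeavyTraffic) {n : ℕ} (hn : 1 ≤ n)
    {ia : Fin d → ℕ → ℝ} (hia : IsRenewalSample ia) (i : Fin d) : IsCounting (M.arrCount n ia i) :=
  (hia i).isCounting (hM.lamN_pos n hn i)

theorem HeavyTraffic.isCounting_srv (hM : M.HeavyTraffic) {n : ℕ} (hn : 1 ≤ n)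
    {st : Fin d → ℕ → ℝ} (hst : IsRenewalSample st) (i : Fin d) :
    IsCounting (M.srvCount n st i) :=
  (hst i).isCounting (hM.muN_pos n hn i)

/-! ### Queues under the rule: uniqueness, nonnegativity and path properties -/

namespace IsCMuControl

variable {n : ℕ} {ia st : Fin d → ℕ → ℝ} {B B' : ℝ → Fin d → ℝ}

theorem isSimplexControl (h : M.IsCMuControl n ia st B) : IsSimplexControl B :=
  ⟨h.rcll, fun t i ht => by rw [h.eq t ht]; exact (isPolicy_cmuPolicy _).nonneg _ i,
    fun t ht => by rw [h.eq t ht]; exact (isPolicy_cmuPolicy _).sum_le _⟩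

theorem unique (hM : M.HeavyTraffic) (hn : 1 ≤ n) (hst : IsRenewalSample st)
    (h : M.IsCMuControl n ia st B) (h' : M.IsCMuControl n ia st B') {t : ℝ} (ht : 0 ≤ t) :
    B t = B' t :=
  feedback_unique (A := M.arrCount n ia) (hM.isCounting_srv hn hst) h.isSimplexControl
    h'.isSimplexControl h.eq h'.eq ht

theorem pos_of_ne_zero (hM : M.HeavyTraffic) (hC : M.CostConditions) (hn : 1 ≤ n)
    (h : M.IsCMuControl n ia st B) {t : ℝ} (ht : 0 ≤ t) {i : Fin d} (hi : B t i ≠ 0) :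
    0 < M.queue n ia st B t i := by
  rw [h.eq t ht] at hi
  exact pos_of_cmuPolicy_ne_zero hM hC (hM.scale_pos hn) hi

/-- After the last time with a job in class `i` there is no service. At that time itself the
departure count, which stayed below the arrivals just before, jumps by at most one. -/
theorem queue_nonneg (hM : M.HeavyTraffic) (hC : M.CostConditions) (hn : 1 ≤ n)
    (hia : IsRenewalSample ia) (hst : IsRenewalSample st) (h : M.IsCMuControl n ia st B) {t : ℝ}
    (ht : 0 ≤ t) (i : Fin d) : 0 ≤ M.queue n ia st B t i := by
  have hA := hM.isCounting_arr hn hia i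
  have hS := hM.isCounting_srv hn hst i
  have hB := h.isSimplexControl
  set A := M.arrCount n ia i
  set S := M.srvCount n st i
  have hq : ∀ s, M.queue n ia st B s i = (A s : ℝ) - S (effort B s i) := fun s => rfl
  -- The alternative `s = 0` covers a class that has been empty from the start.
  obtain ⟨τ, hτ0, hτt, hlow, hnear⟩ := exists_last_time
    (P := fun s => S (effort B s i) + 1 ≤ A s ∨ s = 0) (Or.inr rfl) ht
  have he : effort B t i = effort B τ i := by
    refine hB.effort_eq_of_forall_eq_zero hτ0 hτt i fun u hu hut => ?_
    by_contra hne
    have h1 := h.pos_of_ne_zero hM hC hn (hτ0.trans hu.le) hne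
    rw [hq, sub_pos, Nat.cast_lt] at h1
    exact hlow u hu hut (Or.inl h1)
  have hle : S (effort B τ i) ≤ A τ := by
    rcases hτ0.lt_or_eq with hpos | h0
    · have hnear' : ∀ η > 0, ∃ s, 0 ≤ s ∧ s ≤ τ ∧ τ - η < s ∧ S (effort B s i) + 1 ≤ A s := by
        intro η hη
        obtain ⟨s, hs, hsτ, hlt, hP⟩ := hnear (min η τ) (lt_min hη hpos)
        have h1 := min_le_left η τ
        have h2 := min_le_right η τ
        refine ⟨s, hs, hsτ, by linarith, hP.resolve_right fun h3 => ?_⟩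
        linarith
      have hA1 : 1 ≤ A τ := by
        obtain ⟨s, hs, hsτ, -, hP⟩ := hnear' 1 one_pos
        have := hA.mono hsτ
        omega
      -- The truncated subtraction is harmless, as `A τ ≥ 1`. Continuity of the effort turns times
      -- just before `τ` into efforts just below `effort B τ i`.
      have hj := hS.jump (effort B τ i) (A τ - 1) (hB.effort_nonneg hτ0 i) fun η hη => by
        obtain ⟨s, hs, hsτ, hlt, hP⟩ := hnear' η hη
        refine ⟨effort B s i, ?_, ?_⟩
        · linarith [hB.effort_sub_le hs hsτ i]
        · have := hA.mono hsτ
          omega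
      omega
    · rw [← h0, IsSimplexControl.effort_zero, hS.zero]
      exact Nat.zero_le _
  rw [hq, he, sub_nonneg, Nat.cast_le]
  exact hle.trans (hA.mono hτt)

/-- Centering the counts leaves the drift `n (λ_i t - μ_i e_i) / (b_n √n)`, whence the factor `√n /
b_n`; the second-order parts of the rates join the fluctuation. -/
theorem isCMuPath (hM : M.HeavyTraffic) (hC : M.CostConditions) (hn : 1 ≤ n)
    (hia : IsRenewalSample ia) (hst : IsRenewalSample st) (h : M.IsCMuControl n ia st B) :
    M.IsCMuPath (Real.sqrt n / M.b n) (M.queueT n ia st B)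
      (fun t i => M.arrT n ia t i - M.srvT n st (effort B t i) i +
        (M.lamN n i - n * M.lam i) / M.scale n * t -
        (M.muN n i - n * M.mu i) / M.scale n * effort B t i) (effort B) := by
  have hB := h.isSimplexControl
  have hsc := hM.scale_pos hn
  have hq0 : ∀ t i, 0 ≤ t → 0 ≤ M.queueT n ia st B t i := fun t i ht =>
    div_nonneg (h.queue_nonneg hM hC hn hia hst ht i) hsc.le
  refine ⟨fun t i _ => ?_, hq0, fun i => ?_, fun i => IsSimplexControl.effort_zero i,
    fun s t i hs hst' => hB.effort_mono hs hst' i, fun s t hs hst' => hB.sum_effort_sub_le hs hst',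
    fun s t hs hst' hne => ?_, fun s t i hs hst' hj => ?_⟩
  · have hb := hM.b_pos n hn
    have hsn : 0 < Real.sqrt n := Real.sqrt_pos.2 (by exact_mod_cast hn)
    have hr : Real.sqrt n / M.b n = n / M.scale n := by
      rw [scale, div_eq_div_iff hb.ne' (mul_pos hb hsn).ne']
      have : (n : ℝ) = Real.sqrt n * Real.sqrt n := (Real.mul_self_sqrt n.cast_nonneg).symm
      conv_rhs => rw [this]
      ring
    rw [hr]
    unfold queueT queue dep arrT srvT
    field_simp
    ring
  · have h1 : M.arr n ia 0 i = 0 := by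
      have := (hM.isCounting_arr hn hia i).zero
      simp only [arr]
      exact_mod_cast this
    have h2 : M.srv n st 0 i = 0 := by
      have := (hM.isCounting_srv hn hst i).zero
      simp only [srv]
      exact_mod_cast this
    simp [IsSimplexControl.effort_zero, arrT, srvT, h1, h2]
  · refine hB.sum_effort_eq_of_forall_eq_one hs hst' fun u hu hut => ?_
    have hu0 := hs.trans hu.le
    rw [h.eq u hu0]
    exact sum_cmuPolicy (fun j => hq0 u j hu0) (hne u hu hut)
  · refine hB.effort_eq_of_forall_eq_zero hs hst' i fun u hu hut => ?_
    have hu0 := hs.trans hu.le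
    obtain ⟨j, hj'⟩ := hj u hu hut
    rw [h.eq u hu0]
    exact cmuPolicy_eq_zero_of_marg_lt hj'

end IsCMuControl

theorem isCMuControl_feedbackControl (hM : M.HeavyTraffic) {n : ℕ} (hn : 1 ≤ n)
    {ia st : Fin d → ℕ → ℝ} (hia : IsRenewalSample ia) (hst : IsRenewalSample st) :
    M.IsCMuControl n ia st
      (feedbackControl (M.arrCount n ia) (M.srvCount n st) (M.cmuPolicy (M.scale n))) :=
  ⟨(isSimplexControl_feedbackControl (hM.isCounting_arr hn hia) (hM.isCounting_srv hn hst)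
    (isPolicy_cmuPolicy _)).rcll,
    fun _ ht => feedbackControl_spec (hM.isCounting_arr hn hia) (hM.isCounting_srv hn hst)
      (isPolicy_cmuPolicy _) ht⟩

end QueueParams

theorem isRenewalSample_one {d : ℕ} : IsRenewalSample fun (_ : Fin d) (_ : ℕ) => (1 : ℝ) := by
  refine fun i => ⟨fun _ => one_pos, ?_⟩
  simpa using tendsto_natCast_atTop_atTop (R := ℝ)

section Rule

variable {Ω : Type*} [MeasurableSpace Ω] {Pr : Measure Ω} {d : ℕ} {M : QueueParams d}
  {IA ST : Fin d → ℕ → Ω → ℝ} {n : ℕ}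

theorem isGenCMuRule_iff {B : Ω → ℝ → Fin d → ℝ} : IsGenCMuRule M Pr IA ST n B ↔
    ∀ᵐ ω ∂Pr, M.IsCMuControl n (fun j l => IA j l ω) (fun j l => ST j l ω) (B ω) := by
  simp only [IsGenCMuRule, QueueParams.isCMuControl_iff]

theorem exists_isGenCMuRule [IsProbabilityMeasure Pr] (hM : M.HeavyTraffic)
    (hC : M.CostConditions) (hIA : IsRenewalInput Pr IA M.varIA)
    (hST : IsRenewalInput Pr ST M.varST) (hn : 1 ≤ n) :
    ∃ B : Ω → ℝ → Fin d → ℝ, (∀ t, Measurable fun ω => B ω t) ∧ IsGenCMuRule M Pr IA ST n B ∧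
      AEMeasurable (fun ω => ∫ t in (0 : ℝ)..M.T,
        M.cost (M.queueT n (fun j l => IA j l ω) (fun j l => ST j l ω) (B ω) t)) Pr := by
  classical
  have hgood := hIA.ae_isRenewalSample.and hST.ae_isRenewalSample
  obtain ⟨G, hGsub, hGm, hG⟩ : ∃ G : Set Ω, (∀ ω ∈ G, IsRenewalSample (fun i l => IA i l ω) ∧
      IsRenewalSample fun i l => ST i l ω) ∧ MeasurableSet G ∧ ∀ᵐ ω ∂Pr, ω ∈ G := by
    obtain ⟨t, ht, htm, ht0⟩ := exists_measurable_superset_of_null (ae_iff.1 hgood)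
    refine ⟨tᶜ, fun ω hω => ?_, htm.compl, measure_eq_zero_iff_ae_notMem.1 ht0⟩
    by_contra hno
    exact hω (ht hno)
  -- Outside a measurable set of full measure the data are replaced by unit sequences, so that every
  -- sample is a renewal sample and measurability can be proved without exceptional sets.
  set ia : Ω → Fin d → ℕ → ℝ := fun ω i l => if ω ∈ G then IA i l ω else 1 with hia_def
  set st : Ω → Fin d → ℕ → ℝ := fun ω i l => if ω ∈ G then ST i l ω else 1 with hst_def
  have hia : ∀ ω, IsRenewalSample (ia ω) := by
    intro ω
    by_cases h : ω ∈ G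
    · simpa [hia_def, h] using (hGsub ω h).1
    · simpa [hia_def, h] using isRenewalSample_one
  have hst : ∀ ω, IsRenewalSample (st ω) := by
    intro ω
    by_cases h : ω ∈ G
    · simpa [hst_def, h] using (hGsub ω h).2
    · simpa [hst_def, h] using isRenewalSample_one
  have hiam : ∀ i l, Measurable fun ω => ia ω i l := fun i l =>
    Measurable.ite hGm (hIA.measurable i l) measurable_const
  have hstm : ∀ i l, Measurable fun ω => st ω i l := fun i l =>
    Measurable.ite hGm (hST.measurable i l) measurable_const
  set Φ := M.cmuPolicy (M.scale n) with hΦ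
  have hpol : IsPolicy Φ := QueueParams.isPolicy_cmuPolicy _
  have hΦm : Measurable Φ := QueueParams.measurable_cmuPolicy hC _
  have hA := fun ω => hM.isCounting_arr hn (hia ω)
  have hS := fun ω => hM.isCounting_srv hn (hst ω)
  have hae : ∀ᵐ ω ∂Pr, ia ω = (fun i l => IA i l ω) ∧ st ω = fun i l => ST i l ω := by
    filter_upwards [hG] with ω hω
    simp [hia_def, hst_def, hω]
  set B : Ω → ℝ → Fin d → ℝ := fun ω =>
    feedbackControl (M.arrCount n (ia ω)) (M.srvCount n (st ω)) Φ with hBdef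
  have hB : ∀ ω, M.IsCMuControl n (ia ω) (st ω) (B ω) := fun ω =>
    QueueParams.isCMuControl_feedbackControl hM hn (hia ω) (hst ω)
  refine ⟨B, fun t => ?_, ?_, ?_⟩
  · refine (measurable_feedback hA hS hpol hΦm (fun i τ hτ => ?_) (fun i τ hτ => ?_)
      (measurable_const (a := t))).1
    · exact measurable_renewalCount (hM.lamN_pos n hn i) (hiam i) (fun ω => hia ω i) hτ
    · exact measurable_renewalCount (hM.muN_pos n hn i) (hstm i) (fun ω => hst ω i) hτ
  · rw [isGenCMuRule_iff]
    filter_upwards [hae] with ω hω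
    rw [← hω.1, ← hω.2]
    exact hB ω
  -- For the cost integral the pair of sample and time serves as the sample, and the second
  -- coordinate as the random time. This gives the joint measurability that integration in time
  -- requires.
  · have hAm : ∀ i (τ : Ω × ℝ → ℝ), Measurable τ →
        Measurable fun a => M.arrCount n (ia a.1) i (τ a) := fun i τ hτ =>
      measurable_renewalCount (hM.lamN_pos n hn i) (fun k => (hiam i k).comp measurable_fst)
        (fun a => hia a.1 i) hτ
    have hSm : ∀ i (τ : Ω × ℝ → ℝ), Measurable τ →
        Measurable fun a => M.srvCount n (st a.1) i (τ a) := fun i τ hτ =>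
      measurable_renewalCount (hM.muN_pos n hn i) (fun k => (hstm i k).comp measurable_fst)
        (fun a => hst a.1 i) hτ
    have hE := (measurable_feedback (A := fun a : Ω × ℝ => M.arrCount n (ia a.1))
      (S := fun a : Ω × ℝ => M.srvCount n (st a.1)) (fun a => hA a.1) (fun a => hS a.1) hpol hΦm
      hAm hSm measurable_snd).2
    set F : Ω × ℝ → ℝ := fun a => ∑ i, M.C i (max (((M.arrCount n (ia a.1) i a.2 : ℝ) -
      M.srvCount n (st a.1) i (feedbackEffort (M.arrCount n (ia a.1)) (M.srvCount n (st a.1)) Φ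
        a.2 i)) / M.scale n) 0) with hF
    have hFm : Measurable F := by
      refine Finset.measurable_sum _ fun i _ => (hC.continuous_C_max i).measurable.comp ?_
      exact ((measurable_from_top.comp (hAm i _ measurable_snd)).sub
        (measurable_from_top.comp (hSm i _ (hE i)))).div_const _
    refine ⟨fun ω => ∫ t in Set.Ioc 0 M.T, F (ω, t), ?_, ?_⟩
    · exact (hFm.stronglyMeasurable.integral_prod_right
        (ν := volume.restrict (Set.Ioc 0 M.T))).measurable
    · filter_upwards [hae] with ω hω
      rw [← hω.1, ← hω.2, intervalIntegral.integral_of_le hM.T_pos.le]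
      refine setIntegral_congr_fun measurableSet_Ioc fun t ht => ?_
      simp only [hF, QueueParams.cost]
      refine Finset.sum_congr rfl fun i _ => ?_
      have h1 := ((hB ω).isCMuPath hM hC hn (hia ω) (hst ω)).nonneg t i ht.1.le
      rw [← effort_feedbackControl (hA ω) (hS ω) hpol ht.1.le]
      congr 1
      exact (max_eq_left h1).symm

theorem IsGenCMuRule.ae_unique [IsProbabilityMeasure Pr] (hM : M.HeavyTraffic)
    (hST : IsRenewalInput Pr ST M.varST) (hn : 1 ≤ n) {B B' : Ω → ℝ → Fin d → ℝ}
    (h : IsGenCMuRule M Pr IA ST n B) (h' : IsGenCMuRule M Pr IA ST n B') :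
    ∀ᵐ ω ∂Pr, ∀ t, 0 ≤ t → B ω t = B' ω t := by
  rw [isGenCMuRule_iff] at h h'
  filter_upwards [hST.ae_isRenewalSample, h, h'] with ω h1 h2 h3 t ht
  exact h2.unique hM hn h1 h3 ht

theorem IsGenCMuRule.isAdmissible (hM : M.HeavyTraffic) (hC : M.CostConditions)
    (hn : 1 ≤ n) {B : Ω → ℝ → Fin d → ℝ} (h : IsGenCMuRule M Pr IA ST n B)
    (hm : ∀ t, Measurable fun ω => B ω t) : IsAdmissible M Pr IA ST n B := by
  rw [isGenCMuRule_iff] at h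
  refine ⟨fun t _ => (hm t).aemeasurable, ?_, ?_, fun t ht => ?_, ?_⟩
  · filter_upwards [h] with ω hω using hω.rcll
  · filter_upwards [h] with ω hω t ht
    exact ⟨fun i => hω.isSimplexControl.nonneg t i ht, hω.isSimplexControl.sum_le t ht⟩
  -- The control is a Borel function of the current queue, a difference of two generators of the
  -- information at time `t`.
  · refine ⟨fun ω => M.cmuPolicy (M.scale n)
      (M.queue n (fun j l => IA j l ω) (fun j l => ST j l ω) (B ω) t), ?_, ?_⟩
    · refine (QueueParams.measurable_cmuPolicy hC _).comp ?_
      refine @measurable_pi_lambda _ _ _ (infoSigma M IA ST n B t) _ _ fun i => ?_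
      have hle : MeasurableSpace.comap (fun ω => M.arr n (fun j l => IA j l ω) t i) inferInstance ⊔
          MeasurableSpace.comap (fun ω => M.dep n (fun j l => ST j l ω) (B ω) t i) inferInstance ≤
          infoSigma M IA ST n B t :=
        (le_iSup (fun i : Fin d =>
          MeasurableSpace.comap (fun ω => M.arr n (fun j l => IA j l ω) t i) inferInstance ⊔
          MeasurableSpace.comap (fun ω => M.dep n (fun j l => ST j l ω) (B ω) t i)
            inferInstance) i).trans
          (le_iSup₂ (f := fun s (_ : s ∈ Set.Icc (0 : ℝ) t) => ⨆ i : Fin d,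
            MeasurableSpace.comap (fun ω => M.arr n (fun j l => IA j l ω) s i) inferInstance ⊔
            MeasurableSpace.comap (fun ω => M.dep n (fun j l => ST j l ω) (B ω) s i)
              inferInstance) t ⟨ht, le_rfl⟩)
      have h1 : Measurable[infoSigma M IA ST n B t] fun ω => M.arr n (fun j l => IA j l ω) t i :=
        Measurable.mono (comap_measurable _) (le_sup_left.trans hle) le_rfl
      have h2 : Measurable[infoSigma M IA ST n B t]
          fun ω => M.dep n (fun j l => ST j l ω) (B ω) t i :=
        Measurable.mono (comap_measurable _) (le_sup_right.trans hle) le_rfl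
      exact h1.sub h2
    · filter_upwards [h] with ω hω using hω.eq t ht
  · filter_upwards [h] with ω hω t ht i hi
    by_contra hne
    exact (hω.pos_of_ne_zero hM hC hn ht hne).ne' hi

end Rule

/-! ### The rate function -/

theorem extendZero_of_mem {T : ℝ} {E : Type*} [Zero E] (f : Set.Icc (0 : ℝ) T → E) {t : ℝ}
    (h : t ∈ Set.Icc (0 : ℝ) T) : extendZero f t = f ⟨t, h⟩ := dif_pos h

theorem extendZero_coe {T : ℝ} {E : Type*} [Zero E] (f : Set.Icc (0 : ℝ) T → E)
    (t : Set.Icc (0 : ℝ) T) : extendZero f t = f t := extendZero_of_mem f t.2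

theorem continuousOn_extendZero {T : ℝ} {E : Type*} [Zero E] [TopologicalSpace E]
    {f : Set.Icc (0 : ℝ) T → E} (hf : Continuous f) :
    ContinuousOn (extendZero f) (Set.Icc 0 T) := by
  rw [continuousOn_iff_continuous_domRestrict]
  refine hf.congr fun t => ?_
  rw [Set.domRestrict_apply, extendZero_coe]

theorem AbsolutelyContinuousOnInterval.apply {ι : Type*} [Fintype ι] {f : ℝ → ι → ℝ} {a b : ℝ}
    (hf : AbsolutelyContinuousOnInterval f a b) (i : ι) :
    AbsolutelyContinuousOnInterval (fun t => f t i) a b := by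
  rw [absolutelyContinuousOnInterval_iff] at hf ⊢
  intro ε hε
  obtain ⟨δ, hδ, h⟩ := hf ε hε
  refine ⟨δ, hδ, fun E hE hlt => lt_of_le_of_lt (Finset.sum_le_sum fun k _ => ?_) (h E hE hlt)⟩
  exact dist_le_pi_dist _ _ i

/-- Integrate Young's inequality `|f'| ≤ β f'² + 1 / (4 β)`. The free parameter `β` later makes the
first term small uniformly over a sublevel set. -/
theorem abs_sub_le_of_lintegral_deriv_sq_le {f : ℝ → ℝ} {T K β s t : ℝ}
    (hf : AbsolutelyContinuousOnInterval f 0 T) (hK : 0 ≤ K) (hβ : 0 < β)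
    (h : ∫⁻ u in Set.Icc (0 : ℝ) T, ENNReal.ofReal (deriv f u ^ 2) ≤ ENNReal.ofReal K)
    (hs : 0 ≤ s) (hst : s ≤ t) (htT : t ≤ T) :
    |f t - f s| ≤ β * K + (t - s) / (4 * β) := by
  have hsub : Set.uIcc s t ⊆ Set.uIcc 0 T := by
    rw [Set.uIcc_of_le hst, Set.uIcc_of_le (hs.trans (hst.trans htT))]
    exact Set.Icc_subset_Icc hs htT
  have hac := hf.mono hsub
  rw [← hac.integral_deriv_eq_sub]
  have hBint : IntegrableOn (fun u => deriv f u ^ 2) (Set.Icc 0 T) := by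
    refine ⟨((measurable_deriv f).pow_const 2).aestronglyMeasurable, ?_⟩
    rw [hasFiniteIntegral_iff_ofReal (Eventually.of_forall fun u => sq_nonneg _)]
    exact h.trans_lt ENNReal.ofReal_lt_top
  have hsq : ∫ u in Set.Icc 0 T, deriv f u ^ 2 ≤ K := by
    rw [integral_eq_lintegral_of_nonneg_ae (Eventually.of_forall fun u => sq_nonneg _)
      ((measurable_deriv f).pow_const 2).aestronglyMeasurable]
    exact ENNReal.toReal_le_of_le_ofReal hK h
  have hBint' : IntervalIntegrable (fun u => deriv f u ^ 2) volume s t := by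
    rw [intervalIntegrable_iff_integrableOn_Icc_of_le hst]
    exact hBint.mono_set (Set.Icc_subset_Icc hs htT)
  have hsq' : ∫ u in s..t, deriv f u ^ 2 ≤ K := by
    rw [intervalIntegral.integral_of_le hst]
    refine le_trans (setIntegral_mono_set hBint (Eventually.of_forall fun u => sq_nonneg _)
      (Set.Ioc_subset_Icc_self.trans (Set.Icc_subset_Icc hs htT)).eventuallyLE) hsq
  have h1 : |∫ u in s..t, deriv f u| ≤ ∫ u in s..t, (β * deriv f u ^ 2 + 1 / (4 * β)) := by
    refine (intervalIntegral.abs_integral_le_integral_abs hst).trans ?_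
    refine intervalIntegral.integral_mono_on hst hac.intervalIntegrable_deriv.abs
      ((hBint'.const_mul β).add intervalIntegrable_const) fun u _ => ?_
    have h2 : 0 ≤ β * (|deriv f u| - 1 / (2 * β)) ^ 2 := by positivity
    have h3 : β * (|deriv f u| - 1 / (2 * β)) ^ 2 =
        β * deriv f u ^ 2 + 1 / (4 * β) - |deriv f u| := by
      rw [sub_sq, sq_abs]
      field_simp
      ring
    linarith
  refine h1.trans ?_
  rw [intervalIntegral.integral_add (hBint'.const_mul β) intervalIntegrable_const,
    intervalIntegral.integral_const_mul, intervalIntegral.integral_const, smul_eq_mul]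
  have := mul_le_mul_of_nonneg_left hsq' hβ.le
  have h4 : (t - s) * (1 / (4 * β)) = (t - s) / (4 * β) := by ring
  linarith

theorem isAC₀_of_rateOne_ne_top {T : ℝ} {d : ℕ} {v : Fin d → ℝ}
    {ψ : Set.Icc (0 : ℝ) T → Fin d → ℝ} (h : rateOne v ψ ≠ ∞) : IsAC₀ ψ := by
  by_contra hno
  exact h (if_neg hno)

theorem abs_sub_le_of_rateOne_le {T : ℝ} {d : ℕ} {v : Fin d → ℝ}
    {ψ : Set.Icc (0 : ℝ) T → Fin d → ℝ} {R K β : ℝ} (hβ : 0 < β) (hR : 0 ≤ R)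
    (h : rateOne v ψ ≤ ENNReal.ofReal R) (hK : ∀ i, |v i| ≤ K) (i : Fin d)
    (s t : Set.Icc (0 : ℝ) T) :
    |ψ t i - ψ s i| ≤ β * (2 * K * R) + |(t : ℝ) - s| / (4 * β) := by
  have hac := isAC₀_of_rateOne_ne_top (h.trans_lt ENNReal.ofReal_lt_top).ne
  have hK0 : 0 ≤ K := (abs_nonneg _).trans (hK i)
  rw [rateOne, if_pos hac] at h
  have h1 := (Finset.single_le_sum (f := fun i => (∫⁻ s in Set.Icc (0 : ℝ) T,
    ENNReal.ofReal (deriv (fun t => extendZero ψ t i) s ^ 2)) / ENNReal.ofReal (2 * v i))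
    (fun j _ => zero_le) (Finset.mem_univ i)).trans h
  -- The denominator may vanish: a zero variance then forces the derivative to vanish almost
  -- everywhere, by the convention `x / 0 = ∞`.
  rw [ENNReal.div_le_iff_le_mul (Or.inr ENNReal.ofReal_ne_top) (Or.inl ENNReal.ofReal_ne_top),
    ← ENNReal.ofReal_mul hR] at h1
  have h2 : R * (2 * v i) ≤ 2 * K * R := by
    have := mul_le_mul_of_nonneg_left ((le_abs_self _).trans (hK i)) hR
    linarith
  have h3 := h1.trans (ENNReal.ofReal_le_ofReal h2)
  have key : ∀ s t : Set.Icc (0 : ℝ) T, s ≤ t →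
      |ψ t i - ψ s i| ≤ β * (2 * K * R) + |(t : ℝ) - s| / (4 * β) := by
    intro s t hst
    have hst' : (s : ℝ) ≤ t := hst
    have h4 := abs_sub_le_of_lintegral_deriv_sq_le (hac.2.apply i) (by positivity) hβ h3 s.2.1 hst'
      t.2.2
    rw [extendZero_coe, extendZero_coe] at h4
    rwa [abs_of_nonneg (sub_nonneg.2 hst')]
  rcases le_total s t with hst | hst
  · exact key s t hst
  · rw [abs_sub_comm, abs_sub_comm (t : ℝ)]
    exact key t s hst

namespace QueueParams

variable {d : ℕ} (M : QueueParams d)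

/-- A bound for the variance parameters of the rate function. -/
noncomputable def varBound : ℝ := ∑ i, (|M.lam i * M.varIA i| + |M.mu i * M.varST i|)

variable {M}

theorem varBound_nonneg : 0 ≤ M.varBound :=
  Finset.sum_nonneg fun _ _ => add_nonneg (abs_nonneg _) (abs_nonneg _)

theorem le_varBound (i : Fin d) :
    |M.lam i * M.varIA i| ≤ M.varBound ∧ |M.mu i * M.varST i| ≤ M.varBound := by
  have h := Finset.single_le_sum (f := fun i => |M.lam i * M.varIA i| + |M.mu i * M.varST i|)
    (fun j _ => add_nonneg (abs_nonneg _) (abs_nonneg _)) (Finset.mem_univ i)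
  exact ⟨(le_add_of_nonneg_right (abs_nonneg _)).trans h,
    (le_add_of_nonneg_left (abs_nonneg _)).trans h⟩

theorem norm_sub_le_of_rate_le {ψ : Set.Icc (0 : ℝ) M.T → (Fin d → ℝ) × (Fin d → ℝ)} {R β : ℝ}
    (hβ : 0 < β) (hR : 0 ≤ R) (h : M.rate ψ ≤ ENNReal.ofReal R) (s t : Set.Icc (0 : ℝ) M.T) :
    ‖ψ t - ψ s‖ ≤ β * (2 * M.varBound * R) + |(t : ℝ) - s| / (4 * β) := by
  have h0 : 0 ≤ β * (2 * M.varBound * R) + |(t : ℝ) - s| / (4 * β) := by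
    have := M.varBound_nonneg
    positivity
  rw [norm_prod_le_iff]
  constructor
  · rw [pi_norm_le_iff_of_nonneg h0]
    exact fun i => abs_sub_le_of_rateOne_le (ψ := fun t => (ψ t).1) hβ hR (le_self_add.trans h)
      (fun j => (le_varBound j).1) i s t
  · rw [pi_norm_le_iff_of_nonneg h0]
    exact fun i => abs_sub_le_of_rateOne_le (ψ := fun t => (ψ t).2) hβ hR (le_add_self.trans h)
      (fun j => (le_varBound j).2) i s t

/-- A choice of `β` proportional to `κ` gives one modulus for the whole sublevel set. It replaces
compactness of the sublevel sets in the limit argument. -/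
theorem exists_modulus_of_rate_le (R : ℝ) (hR : 0 ≤ R) {κ : ℝ} (hκ : 0 < κ) :
    ∃ L : ℝ, 0 ≤ L ∧ ∀ ψ : Set.Icc (0 : ℝ) M.T → (Fin d → ℝ) × (Fin d → ℝ),
      M.rate ψ ≤ ENNReal.ofReal R → ∀ s t, ‖ψ t - ψ s‖ ≤ κ + L * |(t : ℝ) - s| := by
  have hD : 0 < 2 * M.varBound * R + 1 := by
    have := M.varBound_nonneg
    positivity
  set β := κ / (2 * M.varBound * R + 1) with hβ
  have hβ0 : 0 < β := div_pos hκ hD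
  refine ⟨1 / (4 * β), by positivity, fun ψ hψ s t => ?_⟩
  have h := norm_sub_le_of_rate_le hβ0 hR hψ s t
  have h1 : β * (2 * M.varBound * R) ≤ κ := by
    have : β * (2 * M.varBound * R + 1) = κ := div_mul_cancel₀ _ hD.ne'
    linarith
  have h2 : |(t : ℝ) - s| / (4 * β) = 1 / (4 * β) * |(t : ℝ) - s| := by ring
  linarith

theorem rate_zero (ψ : Set.Icc (0 : ℝ) M.T → (Fin d → ℝ) × (Fin d → ℝ)) (hψ : ψ = 0) :
    M.rate ψ = 0 := by
  subst hψ
  have hext : extendZero (fun _ : Set.Icc (0 : ℝ) M.T => (0 : Fin d → ℝ)) = fun _ => 0 := by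
    funext t
    simp [extendZero]
  have key : ∀ v : Fin d → ℝ,
      rateOne v (fun _ : Set.Icc (0 : ℝ) M.T => (0 : Fin d → ℝ)) = 0 := by
    intro v
    rw [rateOne, if_pos]
    · simp [hext]
    · refine ⟨fun _ _ => rfl, ?_⟩
      rw [hext]
      exact (LipschitzWith.const (0 : Fin d → ℝ)).lipschitzOnWith.absolutelyContinuousOnInterval
  unfold rate
  exact (congrArg₂ (· + ·) (key _) (key _)).trans (add_zero 0)

theorem continuous_of_rate_ne_top {ψ : Set.Icc (0 : ℝ) M.T → (Fin d → ℝ) × (Fin d → ℝ)}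
    (h : M.rate ψ ≠ ∞) : Continuous ψ := by
  rw [Metric.continuous_iff]
  intro s ε hε
  obtain ⟨L, hL, hmod⟩ := M.exists_modulus_of_rate_le (M.rate ψ).toReal ENNReal.toReal_nonneg
    (half_pos hε)
  have hmod := hmod ψ (by rw [ENNReal.ofReal_toReal h])
  have hL1 : 0 < 2 * (L + 1) := by linarith
  refine ⟨ε / (2 * (L + 1)), div_pos hε hL1, fun t ht => ?_⟩
  rw [dist_eq_norm]
  refine (hmod s t).trans_lt ?_
  have h1 : |(t : ℝ) - s| < ε / (2 * (L + 1)) := ht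
  rw [lt_div_iff₀ hL1] at h1
  nlinarith [abs_nonneg ((t : ℝ) - s)]

theorem apply_zero_of_rate_ne_top {ψ : Set.Icc (0 : ℝ) M.T → (Fin d → ℝ) × (Fin d → ℝ)}
    (h : M.rate ψ ≠ ∞) (t : Set.Icc (0 : ℝ) M.T) (ht : (t : ℝ) = 0) : ψ t = 0 := by
  unfold rate at h
  have h1 := isAC₀_of_rateOne_ne_top (fun h' => h (by simp [h']) :
    rateOne (fun i => M.lam i * M.varIA i) (fun t => (ψ t).1) ≠ ∞)
  have h2 := isAC₀_of_rateOne_ne_top (fun h' => h (by simp [h']) :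
    rateOne (fun i => M.mu i * M.varST i) (fun t => (ψ t).2) ≠ ∞)
  exact Prod.ext (h1.1 t ht) (h2.1 t ht)

end QueueParams

/-! ### The value of the game -/

namespace QueueParams

variable {d : ℕ} (M : QueueParams d)

/-- The free workload of a path on `[0,T]`. -/
noncomputable def pathWork (ψ : Set.Icc (0 : ℝ) M.T → (Fin d → ℝ) × (Fin d → ℝ)) : ℝ → ℝ :=
  M.freeWork (extendZero fun s => (ψ s).1) (extendZero fun s => (ψ s).2)

/-- The optimal holding cost along a path of the primitives. -/
noncomputable def pathCost (ψ : Set.Icc (0 : ℝ) M.T → (Fin d → ℝ) × (Fin d → ℝ)) : ℝ :=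
  ∫ t in (0 : ℝ)..M.T, M.optCost (reflected (M.pathWork ψ) t)

/-- Total of the `μ_i`. -/
noncomputable def muSum : ℝ := ∑ i, M.mu i

variable {M}

theorem rho_mul_mem (hM : M.HeavyTraffic) (i : Fin d) {t : ℝ} (ht : t ∈ Set.Icc 0 M.T) :
    M.rho i * t ∈ Set.Icc 0 M.T :=
  ⟨mul_nonneg (hM.rho_pos i).le ht.1,
    (mul_le_of_le_one_left ht.1 (hM.rho_le_one i)).trans ht.2⟩

theorem HeavyTraffic.muSum_nonneg (hM : M.HeavyTraffic) : 0 ≤ M.muSum :=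
  Finset.sum_nonneg fun i _ => (hM.mu_pos i).le

theorem continuousOn_pathWork (hM : M.HeavyTraffic)
    {ψ : Set.Icc (0 : ℝ) M.T → (Fin d → ℝ) × (Fin d → ℝ)} (hψ : Continuous ψ) :
    ContinuousOn (M.pathWork ψ) (Set.Icc 0 M.T) := by
  have h1 : ContinuousOn (extendZero fun s => (ψ s).1) (Set.Icc 0 M.T) :=
    continuousOn_extendZero (continuous_fst.comp hψ)
  have h2 : ContinuousOn (extendZero fun s => (ψ s).2) (Set.Icc 0 M.T) :=
    continuousOn_extendZero (continuous_snd.comp hψ)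
  unfold pathWork freeWork
  refine continuousOn_finsetSum _ fun i _ => ContinuousOn.mul continuousOn_const
    (ContinuousOn.sub (ContinuousOn.add (by fun_prop) ?_) ?_)
  · exact (continuous_apply i).comp_continuousOn h1
  · refine (continuous_apply i).comp_continuousOn ?_
    exact h2.comp (f := fun t => M.rho i * t) (by fun_prop) fun t ht => rho_mul_mem hM i ht

theorem exists_bound_pathWork (hM : M.HeavyTraffic)
    {ψ : Set.Icc (0 : ℝ) M.T → (Fin d → ℝ) × (Fin d → ℝ)} (hψ : Continuous ψ) :
    ∃ K, ∀ s, 0 ≤ s → s ≤ M.T → |M.pathWork ψ s| ≤ K := by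
  obtain ⟨K, hK⟩ := isCompact_Icc.exists_bound_of_continuousOn (continuousOn_pathWork hM hψ)
  exact ⟨K, fun s h1 h2 => hK s ⟨h1, h2⟩⟩

theorem pathWork_apply (hM : M.HeavyTraffic)
    (ψ : Set.Icc (0 : ℝ) M.T → (Fin d → ℝ) × (Fin d → ℝ)) {t : ℝ} (ht : t ∈ Set.Icc 0 M.T) :
    M.pathWork ψ t = ∑ i, M.theta i *
      (M.y i * t + (ψ ⟨t, ht⟩).1 i - (ψ ⟨M.rho i * t, rho_mul_mem hM i ht⟩).2 i) := by
  unfold pathWork freeWork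
  simp_rw [extendZero_of_mem _ ht]
  refine Finset.sum_congr rfl fun i _ => ?_
  rw [extendZero_of_mem _ (rho_mul_mem hM i ht)]

theorem abs_pathWork_sub_le (hM : M.HeavyTraffic)
    {ψ ψ' : Set.Icc (0 : ℝ) M.T → (Fin d → ℝ) × (Fin d → ℝ)} {c : ℝ}
    (h : ∀ t, ‖ψ t - ψ' t‖ ≤ c) {t : ℝ} (ht : t ∈ Set.Icc 0 M.T) :
    |M.pathWork ψ t - M.pathWork ψ' t| ≤ M.thetaSum * (2 * c) := by
  rw [pathWork_apply hM ψ ht, pathWork_apply hM ψ' ht, ← Finset.sum_sub_distrib]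
  simp_rw [← mul_sub]
  refine abs_sum_theta_le hM fun i => ?_
  have h1 := abs_le.1 ((norm_le_pi_norm _ i).trans ((norm_fst_le _).trans (h ⟨t, ht⟩)))
  have h2 := abs_le.1 ((norm_le_pi_norm _ i).trans
    ((norm_snd_le _).trans (h ⟨M.rho i * t, rho_mul_mem hM i ht⟩)))
  simp only [Prod.fst_sub, Prod.snd_sub, Pi.sub_apply] at h1 h2
  rw [abs_le]
  constructor <;> linarith [h1.1, h1.2, h2.1, h2.2]

theorem abs_reflected_pathWork_sub_le (hM : M.HeavyTraffic)
    {ψ ψ' : Set.Icc (0 : ℝ) M.T → (Fin d → ℝ) × (Fin d → ℝ)} (hψ : Continuous ψ)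
    (hψ' : Continuous ψ') {c : ℝ} (h : ∀ t, ‖ψ t - ψ' t‖ ≤ c) {t : ℝ} (ht : t ∈ Set.Icc 0 M.T) :
    |reflected (M.pathWork ψ) t - reflected (M.pathWork ψ') t| ≤ 2 * (M.thetaSum * (2 * c)) := by
  obtain ⟨K, hK⟩ := exists_bound_pathWork hM hψ
  obtain ⟨K', hK'⟩ := exists_bound_pathWork hM hψ'
  exact abs_reflected_sub_le hK hK' ht.1 ht.2 fun s hs hst =>
    abs_pathWork_sub_le hM h ⟨hs, hst.trans ht.2⟩

theorem abs_cost_sub_le {u c : ℝ} (hu : 0 ≤ u)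
    (hlip : ∀ i x y, 0 ≤ x → 0 ≤ y → |M.C i x - M.C i y| ≤ u * |x - y|) {q q' : Fin d → ℝ}
    {z : Fin d → ℝ} (hq : ∀ i, 0 ≤ q i) (hq' : ∀ i, 0 ≤ q' i) (h : ∀ i, |q i - q' i| ≤ z i * c) :
    |M.cost q - M.cost q'| ≤ u * (∑ i, z i) * c := by
  unfold cost
  rw [← Finset.sum_sub_distrib, mul_assoc, Finset.sum_mul, Finset.mul_sum]
  refine (Finset.abs_sum_le_sum_abs _ _).trans (Finset.sum_le_sum fun i _ => ?_)
  exact (hlip i _ _ (hq i) (hq' i)).trans (mul_le_mul_of_nonneg_left (h i) hu)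

theorem abs_optCost_sub_le (hM : M.HeavyTraffic) (hC : M.CostConditions) {u : ℝ} (hu : 0 ≤ u)
    (hlip : ∀ i x y, 0 ≤ x → 0 ≤ y → |M.C i x - M.C i y| ≤ u * |x - y|) (w w' : ℝ) :
    |M.optCost w - M.optCost w'| ≤ u * M.muSum * |w - w'| :=
  abs_cost_sub_le hu hlip (alloc_nonneg hM hC w) (alloc_nonneg hM hC w')
    fun i => abs_alloc_sub_le hM hC w w' i

theorem continuous_optCost (hM : M.HeavyTraffic) (hC : M.CostConditions) :
    Continuous M.optCost := by
  obtain ⟨u, hu, hlip⟩ := hC.exists_lipschitz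
  refine (LipschitzWith.of_dist_le_mul
    (K := ⟨u * M.muSum, mul_nonneg hu hM.muSum_nonneg⟩) fun w w' => ?_).continuous
  exact abs_optCost_sub_le hM hC hu hlip w w'

theorem continuousOn_optCost_reflected (hM : M.HeavyTraffic) (hC : M.CostConditions)
    {ψ : Set.Icc (0 : ℝ) M.T → (Fin d → ℝ) × (Fin d → ℝ)} (hψ : Continuous ψ) :
    ContinuousOn (fun t => M.optCost (reflected (M.pathWork ψ) t)) (Set.Icc 0 M.T) :=
  (continuous_optCost hM hC).comp_continuousOn
    (continuousOn_reflected (continuousOn_pathWork hM hψ))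

theorem intervalIntegrable_of_continuousOn_Icc (hM : M.HeavyTraffic) {f : ℝ → ℝ}
    (hf : ContinuousOn f (Set.Icc 0 M.T)) : IntervalIntegrable f volume 0 M.T :=
  ContinuousOn.intervalIntegrable (by rwa [Set.uIcc_of_le hM.T_pos.le])

theorem abs_integral_sub_le (hM : M.HeavyTraffic) {f g : ℝ → ℝ} {c : ℝ}
    (hf : IntervalIntegrable f volume 0 M.T) (hg : IntervalIntegrable g volume 0 M.T)
    (h : ∀ t, 0 ≤ t → t ≤ M.T → |f t - g t| ≤ c) :
    |(∫ t in (0 : ℝ)..M.T, f t) - ∫ t in (0 : ℝ)..M.T, g t| ≤ c * M.T := by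
  rw [← intervalIntegral.integral_sub hf hg]
  have := intervalIntegral.norm_integral_le_of_norm_le_const (a := 0) (b := M.T)
    (f := fun t => f t - g t) (C := c) fun t ht => by
      rw [Set.uIoc_of_le hM.T_pos.le] at ht
      exact h t ht.1.le ht.2
  rwa [sub_zero, abs_of_pos hM.T_pos] at this

theorem abs_pathCost_sub_le (hM : M.HeavyTraffic) (hC : M.CostConditions) {u : ℝ} (hu : 0 ≤ u)
    (hlip : ∀ i x y, 0 ≤ x → 0 ≤ y → |M.C i x - M.C i y| ≤ u * |x - y|)
    {ψ ψ' : Set.Icc (0 : ℝ) M.T → (Fin d → ℝ) × (Fin d → ℝ)} (hψ : Continuous ψ)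
    (hψ' : Continuous ψ') {c : ℝ} (h : ∀ t, ‖ψ t - ψ' t‖ ≤ c) :
    |M.pathCost ψ - M.pathCost ψ'| ≤
      u * M.muSum * (2 * (M.thetaSum * (2 * c))) * M.T := by
  refine abs_integral_sub_le hM
    (intervalIntegrable_of_continuousOn_Icc hM (continuousOn_optCost_reflected hM hC hψ))
    (intervalIntegrable_of_continuousOn_Icc hM (continuousOn_optCost_reflected hM hC hψ'))
    fun t h0 hT => (abs_optCost_sub_le hM hC hu hlip _ _).trans ?_
  exact mul_le_mul_of_nonneg_left (abs_reflected_pathWork_sub_le hM hψ hψ' h ⟨h0, hT⟩)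
    (mul_nonneg hu hM.muSum_nonneg)

theorem pathCost_nonneg (hM : M.HeavyTraffic) (hC : M.CostConditions)
    (ψ : Set.Icc (0 : ℝ) M.T → (Fin d → ℝ) × (Fin d → ℝ)) : 0 ≤ M.pathCost ψ :=
  intervalIntegral.integral_nonneg hM.T_pos.le fun _ _ => optCost_nonneg hM hC _

variable (M) in
/-- The largest difference of cost and rate. -/
noncomputable def pathValue : EReal :=
  ⨆ ψ : M.PathP, ((M.pathCost ψ.1 : ℝ) : EReal) - (M.rate ψ.1 : EReal)

theorem pathCost_sub_le_pathValue
    {ψ : Set.Icc (0 : ℝ) M.T → (Fin d → ℝ) × (Fin d → ℝ)} (h : M.rate ψ ≠ ∞) :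
    ((M.pathCost ψ - (M.rate ψ).toReal : ℝ) : EReal) ≤ M.pathValue := by
  have h1 := le_iSup (fun ψ : M.PathP => ((M.pathCost ψ.1 : ℝ) : EReal) - (M.rate ψ.1 : EReal))
    ⟨⟨ψ, continuous_of_rate_ne_top h⟩, apply_zero_of_rate_ne_top h⟩
  refine le_trans (le_of_eq ?_) h1
  simp only [ContinuousMap.coe_mk]
  rw [EReal.coe_sub, EReal.coe_ennreal_toReal h]

/-- The optimal cost grows at most linearly in the sup norm of the path, and the norm is at most a
small multiple of the rate plus a constant. The zero path gives the lower bound. -/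
theorem exists_pathValue_eq (hM : M.HeavyTraffic) (hC : M.CostConditions) :
    ∃ V : ℝ, M.pathValue = (V : EReal) := by
  obtain ⟨u, hu, hlip⟩ := hC.exists_lipschitz
  set c₁ := u * M.muSum * (2 * (M.thetaSum * 2)) * M.T with hc₁
  have hc₁0 : 0 ≤ c₁ := mul_nonneg (mul_nonneg (mul_nonneg hu hM.muSum_nonneg)
    (mul_nonneg zero_le_two (mul_nonneg hM.thetaSum_nonneg zero_le_two))) hM.T_pos.le
  have hv := M.varBound_nonneg
  have hD : 0 < c₁ * (2 * M.varBound) + 1 := by positivity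
  -- With this choice the cost contributes at most one unit per unit of rate, which the subtracted
  -- rate compensates.
  set β := 1 / (c₁ * (2 * M.varBound) + 1) with hβ
  have hβ0 : 0 < β := by positivity
  have hβ1 : β * (c₁ * (2 * M.varBound)) ≤ 1 := by
    have : β * (c₁ * (2 * M.varBound) + 1) = 1 := by
      rw [hβ]
      field_simp
    linarith
  have hupper : M.pathValue ≤ ((M.pathCost 0 + c₁ * (M.T / (4 * β)) : ℝ) : EReal) := by
    refine iSup_le fun ψ => ?_
    rcases eq_or_ne (M.rate ψ.1) ∞ with htop | hne
    · rw [htop]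
      simp
    · set R := (M.rate ψ.1).toReal with hR
      have hR0 : 0 ≤ R := ENNReal.toReal_nonneg
      have hb : ∀ t, ‖ψ.1 t - (0 : Set.Icc (0 : ℝ) M.T → (Fin d → ℝ) × (Fin d → ℝ)) t‖ ≤
          β * (2 * M.varBound * R) + M.T / (4 * β) := by
        intro t
        have h1 := norm_sub_le_of_rate_le hβ0 hR0 (ENNReal.ofReal_toReal hne).ge
          ⟨0, le_rfl, hM.T_pos.le⟩ t
        rw [ψ.2 ⟨0, le_rfl, hM.T_pos.le⟩ rfl] at h1
        have h2 : |(t : ℝ) - 0| ≤ M.T := by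
          rw [sub_zero, abs_of_nonneg t.2.1]
          exact t.2.2
        have h3 : |(t : ℝ) - 0| / (4 * β) ≤ M.T / (4 * β) := by gcongr
        exact h1.trans (add_le_add_right h3 _)
      have h4 := (abs_le.1 (abs_pathCost_sub_le hM hC hu hlip ψ.1.continuous continuous_zero hb)).2
      have h5 : u * M.muSum * (2 * (M.thetaSum * (2 * (β * (2 * M.varBound * R) +
          M.T / (4 * β))))) * M.T = c₁ * (M.T / (4 * β)) + β * (c₁ * (2 * M.varBound)) * R := by
        rw [hc₁]
        ring
      rw [h5] at h4
      have h6 := mul_le_mul_of_nonneg_right hβ1 hR0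
      rw [← EReal.coe_ennreal_toReal hne, ← EReal.coe_sub, EReal.coe_le_coe_iff]
      linarith
  have hlower : ((0 : ℝ) : EReal) ≤ M.pathValue := by
    have h0 : M.rate (0 : Set.Icc (0 : ℝ) M.T → (Fin d → ℝ) × (Fin d → ℝ)) = 0 := rate_zero 0 rfl
    refine le_trans ?_ (pathCost_sub_le_pathValue (ψ := 0) (by simp [h0]))
    rw [EReal.coe_le_coe_iff, h0]
    simpa using pathCost_nonneg hM hC _
  refine ⟨M.pathValue.toReal, (EReal.coe_toReal ?_ ?_).symm⟩
  · exact (hupper.trans_lt (EReal.coe_lt_top _)).ne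
  · exact ((EReal.bot_lt_coe _).trans_le hlower).ne'

/-! Lower bound for the value: minimality of the Skorokhod map. -/

theorem extendZero_dynamics (ψ : M.PathP) (ζ : M.PathE) {t : ℝ} (ht : t ∈ Set.Icc 0 M.T)
    (i : Fin d) : extendZero (M.dynamics ψ ζ) t i = M.y i * t + (ψ.1 ⟨t, ht⟩).1 i -
      extendZero (fun s => (ψ.1 s).2) (M.rho i * t) i + ζ.1 ⟨t, ht⟩ i := by
  rw [extendZero_of_mem _ ht]
  rfl

theorem sum_theta_dynamics (hM : M.HeavyTraffic) (ψ : M.PathP) (ζ : M.PathE) {t : ℝ}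
    (ht : t ∈ Set.Icc 0 M.T) : ∑ i, M.theta i * extendZero (M.dynamics ψ ζ) t i =
      M.pathWork ψ.1 t + ∑ i, M.theta i * ζ.1 ⟨t, ht⟩ i := by
  rw [pathWork_apply hM _ ht, ← Finset.sum_add_distrib]
  refine Finset.sum_congr rfl fun i _ => ?_
  rw [extendZero_dynamics _ _ ht, extendZero_of_mem _ (rho_mul_mem hM i ht)]
  ring

theorem continuous_rhoMap (hM : M.HeavyTraffic) {f : Set.Icc (0 : ℝ) M.T → Fin d → ℝ}
    (hf : Continuous f) (i : Fin d) : Continuous fun t => M.rhoMap f t i := by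
  have h : ∀ t : Set.Icc (0 : ℝ) M.T,
      M.rhoMap f t i = f ⟨M.rho i * t, rho_mul_mem hM i t.2⟩ i := fun t => by
    rw [rhoMap, extendZero_of_mem _ (rho_mul_mem hM i t.2)]
  simp_rw [h]
  refine (continuous_apply i).comp (hf.comp ?_)
  exact Continuous.subtype_mk (by fun_prop) _

theorem continuous_dynamics (hM : M.HeavyTraffic) (ψ : M.PathP) (ζ : M.PathE) :
    Continuous (M.dynamics ψ ζ) := by
  refine continuous_pi fun i => ?_
  have h1 : Continuous fun t => M.rhoMap (fun s => (ψ.1 s).2) t i :=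
    continuous_rhoMap hM (continuous_snd.comp ψ.1.continuous) i
  have h2 : Continuous fun t => (ψ.1 t).1 i :=
    (continuous_apply i).comp (continuous_fst.comp ψ.1.continuous)
  have h3 : Continuous fun t => ζ.1 t i := (continuous_apply i).comp ζ.1.continuous
  exact (((continuous_const.mul continuous_subtype_val).add h2).sub h1).add h3

/-- The workload of the dynamics is the free workload plus the nondecreasing `θ · ζ`, so it
dominates the reflection. Monotonicity and minimality of the optimal cost finish the comparison at
each time. -/
theorem pathCost_le_integral_dynamics (hM : M.HeavyTraffic) (hC : M.CostConditions)
    (ψ : M.PathP) (ζ : M.PathE) (hpos : ∀ t i, 0 ≤ M.dynamics ψ ζ t i) :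
    M.pathCost ψ.1 ≤ ∫ t in (0 : ℝ)..M.T, M.cost (extendZero (M.dynamics ψ ζ) t) := by
  have hpos' : ∀ t, t ∈ Set.Icc 0 M.T → ∀ i, 0 ≤ extendZero (M.dynamics ψ ζ) t i := by
    intro t ht i
    rw [extendZero_of_mem _ ht]
    exact hpos _ i
  have hcont : ContinuousOn (fun t => M.cost (extendZero (M.dynamics ψ ζ) t))
      (Set.Icc 0 M.T) := by
    refine continuousOn_finsetSum _ fun i _ => ?_
    exact (hC.contDiff i).continuousOn.comp ((continuous_apply i).comp_continuousOn
      (continuousOn_extendZero (continuous_dynamics hM ψ ζ))) fun t ht => hpos' t ht i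
  refine intervalIntegral.integral_mono_on hM.T_pos.le
    (intervalIntegrable_of_continuousOn_Icc hM
      (continuousOn_optCost_reflected hM hC ψ.1.continuous))
    (intervalIntegrable_of_continuousOn_Icc hM hcont) fun t ht => ?_
  refine le_trans (optCost_mono hM hC ?_) (optCost_le_cost hM hC (hpos' t ht))
  rw [sum_theta_dynamics hM ψ ζ ht]
  set y : ℝ → ℝ := extendZero fun s => ∑ i, M.theta i * ζ.1 s i with hy
  have hyt : ∀ s (hs : s ∈ Set.Icc 0 M.T), y s = ∑ i, M.theta i * ζ.1 ⟨s, hs⟩ i :=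
    fun s hs => extendZero_of_mem _ hs
  rw [← hyt t ht]
  refine reflected_le_of_nonneg ht.1 ?_ (fun s hs hst => ?_) fun s hs hst => ?_
  · rw [hyt 0 ⟨le_rfl, hM.T_pos.le⟩]
    exact (ζ.2.1 _ rfl).ge
  · rw [hyt s ⟨hs, hst.trans ht.2⟩, hyt t ht]
    exact ζ.2.2 (Subtype.mk_le_mk.2 hst)
  · have hs' : s ∈ Set.Icc 0 M.T := ⟨hs, hst.trans ht.2⟩
    rw [hyt s hs', ← sum_theta_dynamics hM ψ ζ hs']
    exact Finset.sum_nonneg fun i _ => mul_nonneg (hM.theta_pos i).le (hpos' s hs' i)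

/-! The optimal strategy. -/

section Strategy

variable (hM : M.HeavyTraffic) (hC : M.CostConditions)

theorem pathWork_zero (hM : M.HeavyTraffic) (ψ : M.PathP) : M.pathWork ψ.1 0 = 0 := by
  have h0 : (0 : ℝ) ∈ Set.Icc 0 M.T := ⟨le_rfl, hM.T_pos.le⟩
  rw [pathWork_apply hM _ h0]
  refine Finset.sum_eq_zero fun i _ => ?_
  rw [ψ.2 ⟨0, h0⟩ rfl, ψ.2 ⟨M.rho i * 0, rho_mul_mem hM i h0⟩ (mul_zero _)]
  simp

/-- The strategy that keeps the dynamics at the optimal allocation of the reflected workload. -/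
noncomputable def optStrategy (ψ : M.PathP) : M.PathE := by
  refine ⟨⟨fun t i => M.alloc (reflected (M.pathWork ψ.1) t) i -
    (M.y i * t + (ψ.1 t).1 i - M.rhoMap (fun s => (ψ.1 s).2) t i), ?_⟩, ?_⟩
  · refine continuous_pi fun i => Continuous.sub ?_ ?_
    · refine (continuous_apply i).comp ((continuous_alloc hM hC).comp ?_)
      exact continuousOn_iff_continuous_domRestrict.1
        (continuousOn_reflected (continuousOn_pathWork hM ψ.1.continuous))
    · have h1 : Continuous fun t => M.rhoMap (fun s => (ψ.1 s).2) t i :=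
        continuous_rhoMap hM (continuous_snd.comp ψ.1.continuous) i
      have h2 : Continuous fun t => (ψ.1 t).1 i :=
        (continuous_apply i).comp (continuous_fst.comp ψ.1.continuous)
      exact ((continuous_const.mul continuous_subtype_val).add h2).sub h1
  · obtain ⟨K, hK⟩ := exists_bound_pathWork hM ψ.1.continuous
    -- The allocation of a nonnegative workload carries exactly that workload, so `θ · ζ` is
    -- reflection minus free path, which is the regulator.
    have key : ∀ t : Set.Icc (0 : ℝ) M.T, ∑ i, M.theta i *
        (M.alloc (reflected (M.pathWork ψ.1) t) i -
          (M.y i * t + (ψ.1 t).1 i - M.rhoMap (fun s => (ψ.1 s).2) t i)) =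
        regulator (M.pathWork ψ.1) t := by
      intro t
      simp_rw [mul_sub (M.theta _) (M.alloc _ _), Finset.sum_sub_distrib]
      rw [sum_theta_alloc hM hC (reflected_nonneg hK t.2.1 t.2.2)]
      have h : ∑ i, M.theta i * (M.y i * t + (ψ.1 t).1 i - M.rhoMap (fun s => (ψ.1 s).2) t i) =
          M.pathWork ψ.1 t := by
        rw [pathWork_apply hM _ t.2]
        refine Finset.sum_congr rfl fun i _ => ?_
        rw [rhoMap, extendZero_of_mem _ (rho_mul_mem hM i t.2)]
      rw [h, reflected]
      ring
    simp only [ContinuousMap.coe_mk, key]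
    refine ⟨fun t ht => ?_, fun s t hst => regulator_mono hK s.2.1 hst t.2.2⟩
    rw [ht]
    exact regulator_zero (pathWork_zero hM ψ)

theorem optStrategy_apply (ψ : M.PathP) (t : Set.Icc (0 : ℝ) M.T) (i : Fin d) :
    (optStrategy hM hC ψ).1 t i = M.alloc (reflected (M.pathWork ψ.1) t) i -
      (M.y i * t + (ψ.1 t).1 i - M.rhoMap (fun s => (ψ.1 s).2) t i) := rfl

theorem dynamics_optStrategy (ψ : M.PathP) (t : Set.Icc (0 : ℝ) M.T) (i : Fin d) :
    M.dynamics ψ (optStrategy hM hC ψ) t i = M.alloc (reflected (M.pathWork ψ.1) t) i := by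
  rw [dynamics, optStrategy_apply]
  ring

/-- The free workload, the Skorokhod map and the allocation are all Lipschitz; continuity is what
yields Borel measurability of the strategy. -/
theorem continuous_optStrategy : Continuous (optStrategy hM hC) := by
  refine (LipschitzWith.of_dist_le_mul (K := ⟨4 * M.muSum * M.thetaSum + 2, ?_⟩)
    fun ψ ψ' => ?_).continuous
  · have := mul_nonneg hM.muSum_nonneg hM.thetaSum_nonneg
    linarith
  · set c := dist ψ ψ' with hc
    have hc0 : 0 ≤ c := dist_nonneg
    have hb : ∀ t, ‖ψ.1 t - ψ'.1 t‖ ≤ c := fun t => by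
      rw [← dist_eq_norm]
      exact ContinuousMap.dist_apply_le_dist t
    have hK : 0 ≤ 4 * M.muSum * M.thetaSum + 2 := by
      have := mul_nonneg hM.muSum_nonneg hM.thetaSum_nonneg
      linarith
    refine (ContinuousMap.dist_le (mul_nonneg hK hc0)).2 fun t => ?_
    refine (dist_pi_le_iff (mul_nonneg hK hc0)).2 fun i => ?_
    rw [Real.dist_eq, optStrategy_apply, optStrategy_apply, rhoMap, rhoMap,
      extendZero_of_mem _ (rho_mul_mem hM i t.2), extendZero_of_mem _ (rho_mul_mem hM i t.2)]
    have h1 := abs_le.1 ((norm_le_pi_norm _ i).trans ((norm_fst_le _).trans (hb t)))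
    have h2 := abs_le.1 ((norm_le_pi_norm _ i).trans
      ((norm_snd_le _).trans (hb ⟨M.rho i * t, rho_mul_mem hM i t.2⟩)))
    simp only [Prod.fst_sub, Prod.snd_sub, Pi.sub_apply] at h1 h2
    have h3 := (abs_alloc_sub_le hM hC (reflected (M.pathWork ψ.1) t)
      (reflected (M.pathWork ψ'.1) t) i).trans (mul_le_mul_of_nonneg_left
        (abs_reflected_pathWork_sub_le hM ψ.1.continuous ψ'.1.continuous hb t.2)
        (hM.mu_pos i).le)
    have h4 : M.mu i ≤ M.muSum :=
      Finset.single_le_sum (fun j _ => (hM.mu_pos j).le) (Finset.mem_univ i)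
    have h5 : M.mu i * (2 * (M.thetaSum * (2 * c))) ≤ M.muSum * (2 * (M.thetaSum * (2 * c))) :=
      mul_le_mul_of_nonneg_right h4 (mul_nonneg zero_le_two
        (mul_nonneg hM.thetaSum_nonneg (mul_nonneg zero_le_two hc0)))
    have h6 := abs_le.1 (h3.trans h5)
    change |_| ≤ (4 * M.muSum * M.thetaSum + 2) * c
    rw [abs_le]
    constructor <;> linarith [h1.1, h1.2, h2.1, h2.2, h6.1, h6.2]

theorem isAdmissibleStrategy_optStrategy : M.IsAdmissibleStrategy (optStrategy hM hC) := by
  refine ⟨⟨?_, fun ψ ψ' t h s hst => ?_⟩, fun ψ t i => ?_⟩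
  · let _ : MeasurableSpace M.PathP := borel _
    let _ : MeasurableSpace M.PathE := borel _
    have _ : BorelSpace M.PathP := ⟨rfl⟩
    have _ : BorelSpace M.PathE := ⟨rfl⟩
    exact (continuous_optStrategy hM hC).measurable
  · have hw : ∀ u (hu : u ∈ Set.Icc 0 M.T), u ≤ t → M.pathWork ψ.1 u = M.pathWork ψ'.1 u := by
      intro u hu hut
      obtain ⟨h1, h2⟩ := h ⟨u, hu⟩ hut
      unfold pathWork freeWork
      refine Finset.sum_congr rfl fun i _ => ?_
      have h3 := congrFun h2 i
      simp only [rhoMap] at h3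
      rw [extendZero_of_mem _ hu, extendZero_of_mem _ hu, h1, h3]
    have hr : reflected (M.pathWork ψ.1) s = reflected (M.pathWork ψ'.1) s := by
      unfold reflected
      rw [hw s s.2 hst, regulator_congr fun u hu hus =>
        hw u ⟨hu, hus.trans s.2.2⟩ (hus.trans hst)]
    funext i
    obtain ⟨h1, h2⟩ := h s hst
    rw [optStrategy_apply, optStrategy_apply, hr, h1, h2]
  · rw [dynamics_optStrategy]
    exact alloc_nonneg hM hC _ i

theorem gameCost_optStrategy (ψ : M.PathP) : M.gameCost ψ (optStrategy hM hC ψ) =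
    ((M.pathCost ψ.1 : ℝ) : EReal) - (M.rate ψ.1 : EReal) := by
  unfold gameCost pathCost
  congr 2
  refine intervalIntegral.integral_congr fun t ht => ?_
  rw [Set.uIcc_of_le hM.T_pos.le] at ht
  simp only [optCost]
  congr 1
  funext i
  rw [extendZero_of_mem _ ht, dynamics_optStrategy]

include hM hC in
-- Both inequalities hold path by path: `optStrategy` attains the bound for every `ψ`, and no
-- admissible strategy beats it for any `ψ`.
theorem gameValue_eq_pathValue : M.gameValue = M.pathValue := by
  refine le_antisymm ?_ ?_
  · refine (iInf_le _ ⟨optStrategy hM hC, isAdmissibleStrategy_optStrategy hM hC⟩).trans ?_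
    exact iSup_mono fun ψ => (gameCost_optStrategy hM hC ψ).le
  · refine le_iInf fun α => iSup_mono fun ψ => ?_
    unfold gameCost
    refine EReal.sub_le_sub (EReal.coe_le_coe_iff.2 ?_) le_rfl
    exact pathCost_le_integral_dynamics hM hC ψ _ fun t i => α.2.2 ψ t i

end Strategy

end QueueParams

/-! ### The Skorokhod topology -/

namespace SkorokhodPath

variable {T : ℝ} {E : Type*} [NormedAddCommGroup E]

theorem InBall.self (ψ : SkorokhodPath T E) {r : ℝ} (hr : 0 < r) : ψ.InBall r ψ := by
  refine ⟨OrderIso.refl _, 0, hr, fun s t hst => ?_, fun t => by simp⟩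
  have h : (0 : ℝ) < t - s := sub_pos.2 hst
  simp [div_self h.ne']

/-- Time changes compose and the logarithms of their slopes add, so the triangle inequality holds.
Together with the strict slack `c < r` it makes the balls open. -/
theorem InBall.trans {ψ ψ' ψ'' : SkorokhodPath T E} {r r' : ℝ} (h : ψ.InBall r ψ')
    (h' : ψ'.InBall r' ψ'') : ψ.InBall (r + r') ψ'' := by
  obtain ⟨g, c, hc, h1, h2⟩ := h
  obtain ⟨g', c', hc', h1', h2'⟩ := h'
  refine ⟨g'.trans g, c + c', add_lt_add hc hc', fun s t hst => ?_, fun t => ?_⟩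
  · have e1 : (0 : ℝ) < t - s := sub_pos.2 hst
    have e2 : (0 : ℝ) < g' t - g' s := sub_pos.2 (g'.strictMono hst)
    have e3 : (0 : ℝ) < g (g' t) - g (g' s) := sub_pos.2 (g.strictMono (g'.strictMono hst))
    have h3 : ((g (g' t) : ℝ) - g (g' s)) / (t - s) =
        (g (g' t) - g (g' s)) / (g' t - g' s) * ((g' t - g' s) / (t - s)) := by
      field_simp
    simp only [OrderIso.trans_apply]
    rw [h3, Real.log_mul (div_pos e3 e2).ne' (div_pos e2 e1).ne']
    exact (abs_add_le _ _).trans (add_le_add (h1 _ _ (g'.strictMono hst)) (h1' s t hst))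
  · have h3 := (norm_sub_le_norm_sub_add_norm_sub (ψ''.toFun t) (ψ'.toFun (g' t))
      (ψ.toFun (g (g' t)))).trans (add_le_add (h2' t) (h2 (g' t)))
    simp only [OrderIso.trans_apply]
    linarith

theorem isOpen_ball (ψ : SkorokhodPath T E) (r : ℝ) : IsOpen {ψ' | ψ.InBall r ψ'} := by
  rintro ψ' ⟨g, c, hc, h1, h2⟩
  obtain ⟨c', hc1, hc2⟩ := exists_between hc
  refine ⟨r - c', by linarith, fun ψ'' h => ?_⟩
  have h3 := InBall.trans (ψ := ψ) (r := c') ⟨g, c, hc1, h1, h2⟩ h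
  rwa [add_sub_cancel] at h3

/-- An order isomorphism fixes zero, so its slopes from zero lie between `exp (-c)` and `exp c`. -/
theorem abs_orderIso_sub_le (g : Set.Icc (0 : ℝ) T ≃o Set.Icc (0 : ℝ) T) {c : ℝ}
    (h : ∀ s t : Set.Icc (0 : ℝ) T, s < t →
      |Real.log (((g t : ℝ) - (g s : ℝ)) / ((t : ℝ) - (s : ℝ)))| ≤ c) (t : Set.Icc (0 : ℝ) T) :
    |(g t : ℝ) - t| ≤ T * (Real.exp c - 1) := by
  have hT : 0 ≤ T := t.2.1.trans t.2.2
  set z : Set.Icc (0 : ℝ) T := ⟨0, le_rfl, hT⟩ with hz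
  have hg0 : (g z : ℝ) = 0 := by
    refine le_antisymm ?_ (g z).2.1
    have h1 : z ≤ g.symm z := (g.symm z).2.1
    have h2 := g.monotone h1
    rw [g.apply_symm_apply] at h2
    exact h2
  rcases t.2.1.lt_or_eq with ht | ht
  · have hzt : z < t := ht
    have h1 := h z t hzt
    rw [hg0] at h1
    simp only [hz, sub_zero] at h1
    have hgt : (0 : ℝ) < g t := lt_of_eq_of_lt hg0.symm (g.strictMono hzt)
    have hc : 0 ≤ c := (abs_nonneg _).trans h1
    have h2 := abs_le.1 h1
    have h3 : (g t : ℝ) / t ≤ Real.exp c := (Real.log_le_iff_le_exp (div_pos hgt ht)).1 h2.2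
    have h4 : Real.exp (-c) ≤ (g t : ℝ) / t := (Real.le_log_iff_exp_le (div_pos hgt ht)).1 h2.1
    rw [div_le_iff₀ ht] at h3
    rw [le_div_iff₀ ht] at h4
    have h5 := Real.add_one_le_exp c
    have h6 := Real.add_one_le_exp (-c)
    have h7 : (t : ℝ) * (Real.exp c - 1) ≤ T * (Real.exp c - 1) :=
      mul_le_mul_of_nonneg_right t.2.2 (by linarith)
    rw [abs_le]
    constructor <;> nlinarith
  · have htz : t = z := Subtype.ext ht.symm
    rw [htz, hg0]
    -- At `t = 0` only nonnegativity of the bound is claimed; the sign of `c` is known only if the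
    -- interval contains two points.
    have hc : 1 ≤ Real.exp c ∨ T = 0 := by
      rcases hT.lt_or_eq with hpos | h0
      · left
        have h1 := h z ⟨T, hT, le_rfl⟩ hpos
        exact Real.one_le_exp ((abs_nonneg _).trans h1)
      · exact Or.inr h0.symm
    simp only [hz, sub_zero, abs_zero]
    rcases hc with hc | hc
    · exact mul_nonneg hT (by linarith)
    · simp [hc]

theorem InBall.norm_sub_le {ψ p : SkorokhodPath T E} {r κ L : ℝ} (h : ψ.InBall r p)
    (hT : 0 ≤ T) (hL : 0 ≤ L)
    (hmod : ∀ s t, ‖ψ.toFun t - ψ.toFun s‖ ≤ κ + L * |(t : ℝ) - s|) (t : Set.Icc (0 : ℝ) T) :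
    ‖p.toFun t - ψ.toFun t‖ ≤ r + κ + L * (T * (Real.exp r - 1)) := by
  obtain ⟨g, c, hc, h1, h2⟩ := h
  have h3 := norm_sub_le_norm_sub_add_norm_sub (p.toFun t) (ψ.toFun (g t)) (ψ.toFun t)
  have h4 := hmod t (g t)
  have h5 := abs_orderIso_sub_le g h1 t
  have h6 : T * (Real.exp c - 1) ≤ T * (Real.exp r - 1) :=
    mul_le_mul_of_nonneg_left (sub_le_sub_right (Real.exp_le_exp.2 hc.le) 1) hT
  have h7 := mul_le_mul_of_nonneg_left (h5.trans h6) hL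
  linarith [h2 t]

/-- Small balls around paths with a given modulus are uniformly small. -/
theorem exists_radius (hT : 0 ≤ T) {κ L : ℝ} (hκ : 0 < κ) (hL : 0 ≤ L) :
    ∃ r > 0, ∀ ψ p : SkorokhodPath T E,
      (∀ s t, ‖ψ.toFun t - ψ.toFun s‖ ≤ κ + L * |(t : ℝ) - s|) → ψ.InBall r p →
      ∀ t, ‖p.toFun t - ψ.toFun t‖ ≤ 3 * κ := by
  have hev : ∀ᶠ r in 𝓝[>] (0 : ℝ), r + κ + L * (T * (Real.exp r - 1)) < 3 * κ := by
    refine Filter.Eventually.filter_mono nhdsWithin_le_nhds ?_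
    refine ContinuousAt.eventually_lt (by fun_prop) continuousAt_const ?_
    simp
    linarith
  obtain ⟨r, hr, hr0⟩ := (hev.and self_mem_nhdsWithin).exists
  exact ⟨r, hr0, fun ψ p hmod h t => (h.norm_sub_le hT hL hmod t).trans hr.le⟩

end SkorokhodPath

/-! ### Logarithmic asymptotics -/

/-- Translates the logarithmic scale into plain bounds on probabilities and integrals; the values
`0` and `∞` of `p` are included. -/
theorem inv_mul_log_le_iff {β c : ℝ} (hβ : 0 < β) {p : ℝ≥0∞} :
    ((β⁻¹ : ℝ) : EReal) * ENNReal.log p ≤ (c : EReal) ↔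
      p ≤ ENNReal.ofReal (Real.exp (β * c)) := by
  have h1 : (c : EReal) = ENNReal.log (ENNReal.ofReal (Real.exp c)) := by
    rw [ENNReal.log_ofReal_of_pos (Real.exp_pos c), Real.log_exp]
  rw [← ENNReal.log_rpow, h1, ENNReal.log_le_log_iff, ENNReal.rpow_inv_le_iff hβ,
    ENNReal.ofReal_rpow_of_pos (Real.exp_pos c), ← Real.exp_mul, mul_comm c]

theorem lt_inv_mul_log_iff {β c : ℝ} (hβ : 0 < β) {p : ℝ≥0∞} :
    (c : EReal) < ((β⁻¹ : ℝ) : EReal) * ENNReal.log p ↔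
      ENNReal.ofReal (Real.exp (β * c)) < p := by
  rw [← not_le, ← not_le, inv_mul_log_le_iff hβ]

/-- Decomposition of an exponential moment according to the size of the exponent. -/
theorem lintegral_exp_le_sum {Ω : Type*} [MeasurableSpace Ω] {Pr : Measure Ω} {G : Ω → ℝ}
    (hG : AEMeasurable G Pr) (hG0 : ∀ᵐ ω ∂Pr, 0 ≤ G ω) {β ε : ℝ} (hβ : 0 < β) (hε : 0 < ε)
    (m : ℕ) :
    ∫⁻ ω, ENNReal.ofReal (Real.exp (β * G ω)) ∂Pr ≤
      ∑ k ∈ Finset.range (m + 1), ENNReal.ofReal (Real.exp (β * ((k + 1) * ε))) *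
        Pr {ω | k * ε ≤ G ω} +
      ENNReal.ofReal (Real.exp (-(β * ((m + 1) * ε)))) *
        ∫⁻ ω, ENNReal.ofReal (Real.exp (2 * β * G ω)) ∂Pr := by
  have hset : ∀ k : ℕ, NullMeasurableSet {ω | k * ε ≤ G ω} Pr := fun k =>
    nullMeasurableSet_le aemeasurable_const hG
  have hpt : ∀ᵐ ω ∂Pr, ENNReal.ofReal (Real.exp (β * G ω)) ≤
      ∑ k ∈ Finset.range (m + 1), {ω | (k : ℝ) * ε ≤ G ω}.indicator
        (fun _ => ENNReal.ofReal (Real.exp (β * ((k + 1) * ε)))) ω +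
      ENNReal.ofReal (Real.exp (-(β * ((m + 1) * ε)))) *
        ENNReal.ofReal (Real.exp (2 * β * G ω)) := by
    filter_upwards [hG0] with ω hω
    rcases lt_or_ge (G ω) ((m + 1) * ε) with hlt | hge
    · refine le_trans ?_ le_self_add
      -- Below `(m + 1) ε` the exponent lies in a unique slice `[k ε, (k + 1) ε)`, whose upper end
      -- is charged.
      set k := ⌊G ω / ε⌋₊ with hk
      have hk1 : (k : ℝ) * ε ≤ G ω := (le_div_iff₀ hε).1 (Nat.floor_le (div_nonneg hω hε.le))
      have hk2 : G ω < (k + 1) * ε := (div_lt_iff₀ hε).1 (Nat.lt_floor_add_one _)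
      have hkm : k ∈ Finset.range (m + 1) := by
        rw [Finset.mem_range]
        have : (k : ℝ) < ((m + 1 : ℕ) : ℝ) := by
          push_cast
          by_contra hno
          push Not at hno
          nlinarith
        exact_mod_cast this
      refine le_trans ?_ (Finset.single_le_sum (f := fun k : ℕ =>
        {ω | (k : ℝ) * ε ≤ G ω}.indicator
          (fun _ => ENNReal.ofReal (Real.exp (β * ((k + 1) * ε)))) ω) (fun _ _ => zero_le) hkm)
      rw [Set.indicator_of_mem (show ω ∈ {ω | (k : ℝ) * ε ≤ G ω} from hk1)]
      exact ENNReal.ofReal_le_ofReal (Real.exp_le_exp.2 (mul_le_mul_of_nonneg_left hk2.le hβ.le))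
    -- Above `(m + 1) ε` one factor `exp (β G)` is at least `exp (β (m + 1) ε)`, so doubling the
    -- exponent gains this prefactor.
    · refine le_trans ?_ le_add_self
      rw [← ENNReal.ofReal_mul (Real.exp_pos _).le, ← Real.exp_add]
      refine ENNReal.ofReal_le_ofReal (Real.exp_le_exp.2 ?_)
      nlinarith
  refine (lintegral_mono_ae hpt).trans ?_
  have hsum : AEMeasurable (fun ω => ∑ k ∈ Finset.range (m + 1), {ω | (k : ℝ) * ε ≤ G ω}.indicator
      (fun _ => ENNReal.ofReal (Real.exp (β * ((k + 1) * ε)))) ω) Pr :=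
    Finset.aemeasurable_fun_sum _ fun k _ => aemeasurable_const.indicator₀ (hset k)
  rw [lintegral_add_left' hsum, lintegral_finsetSum' _ fun k _ =>
    aemeasurable_const.indicator₀ (hset k)]
  refine add_le_add (Finset.sum_le_sum fun k _ => ?_) ?_
  · rw [lintegral_indicator_const₀ (hset k)]
  · rw [lintegral_const_mul' _ _ ENNReal.ofReal_ne_top]

/-! ### The holding cost along a sample -/

namespace QueueParams

variable {d : ℕ} {M : QueueParams d} {n : ℕ} {ia st : Fin d → ℕ → ℝ} {B : ℝ → Fin d → ℝ}

variable (M) in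
/-- The holding cost of a sample. -/
noncomputable def sampleCost (n : ℕ) (ia st : Fin d → ℕ → ℝ) (B : ℝ → Fin d → ℝ) : ℝ :=
  ∫ t in (0 : ℝ)..M.T, M.cost (M.queueT n ia st B t)

variable (M) in
/-- The centered and scaled primitive processes. -/
noncomputable def sampleProc (n : ℕ) (ia st : Fin d → ℕ → ℝ) (t : ℝ) :
    (Fin d → ℝ) × (Fin d → ℝ) := (M.arrT n ia t, M.srvT n st t)

theorem sampleCost_congr {B' : ℝ → Fin d → ℝ} (hM : M.HeavyTraffic)
    (h : ∀ t, 0 ≤ t → B t = B' t) : M.sampleCost n ia st B = M.sampleCost n ia st B' := by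
  refine intervalIntegral.integral_congr fun t ht => ?_
  rw [Set.uIcc_of_le hM.T_pos.le] at ht
  have he : ∀ i, effort B t i = effort B' t i := by
    intro i
    refine intervalIntegral.integral_congr fun s hs => ?_
    rw [Set.uIcc_of_le ht.1] at hs
    simp only [h s hs.1]
  have hq : M.queueT n ia st B t = M.queueT n ia st B' t := by
    funext i
    simp only [queueT, queue, dep, he]
  simp only [hq]

theorem IsCMuControl.queueT_nonneg (hM : M.HeavyTraffic) (hC : M.CostConditions) (hn : 1 ≤ n)
    (hia : IsRenewalSample ia) (hst : IsRenewalSample st) (h : M.IsCMuControl n ia st B) {t : ℝ}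
    (ht : 0 ≤ t) (i : Fin d) : 0 ≤ M.queueT n ia st B t i :=
  (h.isCMuPath hM hC hn hia hst).nonneg t i ht

theorem IsCMuControl.sampleCost_nonneg (hM : M.HeavyTraffic) (hC : M.CostConditions)
    (hn : 1 ≤ n) (hia : IsRenewalSample ia) (hst : IsRenewalSample st)
    (h : M.IsCMuControl n ia st B) : 0 ≤ M.sampleCost n ia st B :=
  intervalIntegral.integral_nonneg hM.T_pos.le fun _ ht => Finset.sum_nonneg fun i _ =>
    hC.nonneg i _ (h.queueT_nonneg hM hC hn hia hst ht.1 i)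

theorem IsCMuControl.intervalIntegrable_cost (hM : M.HeavyTraffic) (hC : M.CostConditions)
    (hn : 1 ≤ n) (hia : IsRenewalSample ia) (hst : IsRenewalSample st)
    (h : M.IsCMuControl n ia st B) :
    IntervalIntegrable (fun t => M.cost (M.queueT n ia st B t)) volume 0 M.T := by
  have hB := h.isSimplexControl
  have hA := hM.isCounting_arr hn hia
  have hS := hM.isCounting_srv hn hst
  have hsc := hM.scale_pos hn
  have key : ∀ i, IntervalIntegrable (fun t => M.C i (M.queueT n ia st B t i)) volume 0 M.T := by
    intro i
    have hAm : Measurable fun t => (M.arrCount n ia i t : ℝ) :=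
      Monotone.measurable fun s t hst' => Nat.cast_le.2 ((hA i).mono hst')
    have hDm : Measurable fun t => (M.srvCount n st i (effort B (max t 0) i) : ℝ) :=
      Monotone.measurable fun s t hst' => Nat.cast_le.2 ((hS i).mono
        (hB.effort_mono (le_max_right _ _) (max_le_max_right 0 hst') i))
    have hm : Measurable fun t => M.C i (max (((M.arrCount n ia i t : ℝ) -
        M.srvCount n st i (effort B (max t 0) i)) / M.scale n) 0) :=
      (hC.continuous_C_max i).measurable.comp ((hAm.sub hDm).div_const _)
    have heq : ∀ t ∈ Set.Ioc 0 M.T, M.C i (max (((M.arrCount n ia i t : ℝ) -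
        M.srvCount n st i (effort B (max t 0) i)) / M.scale n) 0) =
        M.C i (M.queueT n ia st B t i) := by
      intro t ht
      rw [max_eq_left ht.1.le]
      congr 1
      exact max_eq_left (h.queueT_nonneg hM hC hn hia hst ht.1.le i)
    rw [intervalIntegrable_iff_integrableOn_Ioc_of_le hM.T_pos.le]
    refine IntegrableOn.congr_fun ?_ heq measurableSet_Ioc
    refine Measure.integrableOn_of_bounded (M := M.C i ((M.arrCount n ia i M.T : ℝ) / M.scale n))
      (by simp) hm.aestronglyMeasurable ?_
    filter_upwards [ae_restrict_mem measurableSet_Ioc] with t ht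
    rw [heq t ht]
    have h0 := h.queueT_nonneg hM hC hn hia hst ht.1.le i
    rw [Real.norm_eq_abs, abs_of_nonneg (hC.nonneg i _ h0)]
    refine (hC.strictMono i).monotoneOn h0
      (Set.mem_Ici.2 (div_nonneg (Nat.cast_nonneg _) hsc.le)) ?_
    refine div_le_div_of_nonneg_right ?_ hsc.le
    refine (sub_le_self _ (Nat.cast_nonneg _)).trans ?_
    exact Nat.cast_le.2 ((hA i).mono ht.2)
  have := IntervalIntegrable.sum Finset.univ
    (f := fun i t => M.C i (M.queueT n ia st B t i)) fun i _ => key i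
  refine this.congr_uIoo fun t _ => ?_
  simp [cost]

theorem tendsto_drift_atTop (hM : M.HeavyTraffic) :
    Tendsto (fun n : ℕ => Real.sqrt n / M.b n) atTop atTop := by
  have h1 : Tendsto (fun n : ℕ => M.b n / Real.sqrt n) atTop (𝓝[>] 0) := by
    refine tendsto_nhdsWithin_iff.2 ⟨hM.b_div_sqrt, ?_⟩
    filter_upwards [eventually_ge_atTop 1] with n hn
    exact div_pos (hM.b_pos n hn) (Real.sqrt_pos.2 (by exact_mod_cast hn))
  refine (tendsto_inv_nhdsGT_zero.comp h1).congr fun n => ?_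
  simp

theorem eventually_drift_close (hM : M.HeavyTraffic) {κ : ℝ} (hκ : 0 < κ) :
    ∀ᶠ n : ℕ in atTop, ∀ i, |(M.lamN n i - n * M.lam i) / M.scale n - M.lamT i| ≤ κ ∧
      |(M.muN n i - n * M.mu i) / M.scale n - M.muT i| ≤ κ := by
  refine eventually_all.2 fun i => ?_
  filter_upwards [Metric.tendsto_nhds.1 (hM.lamT_lim i) κ hκ,
    Metric.tendsto_nhds.1 (hM.muT_lim i) κ hκ] with n h1 h2
  exact ⟨h1.le, h2.le⟩

variable (M) in
/-- A bound for the second order drift parameters. -/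
noncomputable def driftBound : ℝ := ∑ i, (|M.lamT i| + |M.muT i|)

theorem driftBound_nonneg : 0 ≤ M.driftBound :=
  Finset.sum_nonneg fun _ _ => add_nonneg (abs_nonneg _) (abs_nonneg _)

theorem le_driftBound (i : Fin d) : |M.lamT i| ≤ M.driftBound ∧ |M.muT i| ≤ M.driftBound := by
  have h := Finset.single_le_sum (f := fun i => |M.lamT i| + |M.muT i|)
    (fun _ _ => add_nonneg (abs_nonneg _) (abs_nonneg _)) (Finset.mem_univ i)
  exact ⟨(le_add_of_nonneg_right (abs_nonneg _)).trans h,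
    (le_add_of_nonneg_left (abs_nonneg _)).trans h⟩

theorem abs_le_of_abs_sub_le {a b c e : ℝ} (h : |a - b| ≤ c) (hb : |b| ≤ e) : |a| ≤ e + c := by
  have h1 := abs_sub_abs_le_abs_sub a b
  linarith

theorem trackConst_nonneg (hM : M.HeavyTraffic) (i : Fin d) : 0 ≤ M.trackConst i := by
  have h1 := hM.thetaSum_nonneg
  have h2 := hM.mu_pos i
  have h3 := hM.T_pos
  have h4 := hM.collapseConst_pos i
  have h5 : 0 ≤ ∑ j, M.theta j * M.collapseConst j := Finset.sum_nonneg fun j _ =>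
    mul_nonneg (hM.theta_pos j).le (hM.collapseConst_pos j).le
  unfold trackConst collapseConst₂
  positivity

/-- Along samples whose primitive processes are close to a path with bounded rate, the holding
cost is close to the optimal cost of that path. -/
theorem exists_abs_sampleCost_sub_le (hM : M.HeavyTraffic) (hC : M.CostConditions) {R ε : ℝ}
    (hR : 0 ≤ R) (hε : 0 < ε) :
    ∃ κ₀ > 0, ∀ κ, 0 < κ → κ ≤ κ₀ → ∀ᶠ n : ℕ in atTop,
      ∀ (ia st : Fin d → ℕ → ℝ) (B : ℝ → Fin d → ℝ)
      (ψ : Set.Icc (0 : ℝ) M.T → (Fin d → ℝ) × (Fin d → ℝ)),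
      IsRenewalSample ia → IsRenewalSample st → M.IsCMuControl n ia st B →
      M.rate ψ ≤ ENNReal.ofReal R →
      (∀ t : Set.Icc (0 : ℝ) M.T, ‖M.sampleProc n ia st t - ψ t‖ ≤ κ) →
      |M.sampleCost n ia st B - M.pathCost ψ| ≤ ε := by
  obtain ⟨u, hu, hlip⟩ := hC.exists_lipschitz
  set D := u * (∑ i, M.trackConst i) * M.T with hD
  have hD0 : 0 ≤ D := mul_nonneg (mul_nonneg hu (Finset.sum_nonneg fun i _ =>
    trackConst_nonneg hM i)) hM.T_pos.le
  -- `D` is the error of the cost per unit of `κ`; the added one avoids division by zero.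
  refine ⟨ε / (D + 1), by positivity, fun κ hκ hκ₀ => ?_⟩
  have hDκ : D * κ ≤ ε := by
    rw [le_div_iff₀ (by linarith)] at hκ₀
    nlinarith
  obtain ⟨L, hL, hmod⟩ := M.exists_modulus_of_rate_le R hR hκ
  obtain ⟨r₀, hr₀⟩ := exists_abs_sub_alloc_reflected_le hM hC hκ hL
    (add_nonneg M.driftBound_nonneg hκ.le)
  filter_upwards [eventually_ge_atTop 1, (tendsto_drift_atTop hM).eventually_ge_atTop r₀,
    eventually_drift_close hM hκ] with n hn hr hdrift ia st B ψ hia hst hB hψ hclose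
  have hψc : Continuous ψ :=
    continuous_of_rate_ne_top (hψ.trans_lt ENNReal.ofReal_lt_top).ne
  have hmod' := hmod ψ hψ
  have hclose' : ∀ t i, 0 ≤ t → t ≤ M.T →
      |M.arrT n ia t i - extendZero (fun s => (ψ s).1) t i| ≤ κ ∧
      |M.srvT n st t i - extendZero (fun s => (ψ s).2) t i| ≤ κ := by
    intro t i h0 hT
    have ht : t ∈ Set.Icc 0 M.T := ⟨h0, hT⟩
    have h1 := hclose ⟨t, ht⟩
    rw [extendZero_of_mem _ ht, extendZero_of_mem _ ht]
    exact ⟨(norm_le_pi_norm _ i).trans ((norm_fst_le _).trans h1),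
      (norm_le_pi_norm _ i).trans ((norm_snd_le _).trans h1)⟩
  have hpsi : ∀ a v i, 0 ≤ a → a ≤ M.T → 0 ≤ v → v ≤ M.T →
      |extendZero (fun s => (ψ s).1) v i - extendZero (fun s => (ψ s).1) a i| ≤
        κ + L * |v - a| ∧
      |extendZero (fun s => (ψ s).2) v i - extendZero (fun s => (ψ s).2) a i| ≤
        κ + L * |v - a| := by
    intro a v i ha haT hv hvT
    have h1 := hmod' ⟨a, ha, haT⟩ ⟨v, hv, hvT⟩
    rw [extendZero_of_mem _ ⟨ha, haT⟩, extendZero_of_mem _ ⟨hv, hvT⟩,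
      extendZero_of_mem _ ⟨ha, haT⟩, extendZero_of_mem _ ⟨hv, hvT⟩]
    exact ⟨(norm_le_pi_norm _ i).trans ((norm_fst_le _).trans h1),
      (norm_le_pi_norm _ i).trans ((norm_snd_le _).trans h1)⟩
  have htrack := hr₀ _ hr _ _ _ _ (extendZero fun s => (ψ s).1) (extendZero fun s => (ψ s).2) _ _
    (hB.isCMuPath hM hC hn hia hst) (fun t i h0 hT => (hclose' t i h0 hT).1)
    (fun t i h0 hT => (hclose' t i h0 hT).2) (fun a v i h1 h2 h3 h4 => (hpsi a v i h1 h2 h3 h4).1)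
    (fun a v i h1 h2 h3 h4 => (hpsi a v i h1 h2 h3 h4).2)
    (fun i => abs_le_of_abs_sub_le (hdrift i).1 (le_driftBound i).1)
    (fun i => abs_le_of_abs_sub_le (hdrift i).2 (le_driftBound i).2)
    (fun i => (hdrift i).1) (fun i => (hdrift i).2)
  refine (abs_integral_sub_le hM (hB.intervalIntegrable_cost hM hC hn hia hst)
    (intervalIntegrable_of_continuousOn_Icc hM (continuousOn_optCost_reflected hM hC hψc))
    (c := u * (∑ i, M.trackConst i) * κ) fun t h0 hT => ?_).trans ?_
  · exact abs_cost_sub_le hu hlip (hB.queueT_nonneg hM hC hn hia hst h0)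
      (alloc_nonneg hM hC _) fun i => htrack t i h0 hT
  · calc u * (∑ i, M.trackConst i) * κ * M.T = D * κ := by rw [hD]; ring
      _ ≤ ε := hDκ

theorem abs_le_supNorm {T : ℝ} {f : ℝ → Fin d → ℝ} {K : ℝ}
    (hK : ∀ t i, 0 ≤ t → t ≤ T → |f t i| ≤ K) {t : ℝ} (h0 : 0 ≤ t) (hT : t ≤ T) (i : Fin d) :
    |f t i| ≤ supNorm T f := by
  have h1 : |f t i| ≤ Real.sqrt (∑ j, f t j ^ 2) := by
    rw [← Real.sqrt_sq_eq_abs]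
    exact Real.sqrt_le_sqrt (Finset.single_le_sum (f := fun j => f t j ^ 2)
      (fun j _ => sq_nonneg _) (Finset.mem_univ i))
  refine h1.trans (le_ciSup (f := fun s : Set.Icc (0 : ℝ) T => Real.sqrt (∑ j, f s j ^ 2))
    ⟨Real.sqrt (∑ _j : Fin d, K ^ 2), ?_⟩ ⟨t, h0, hT⟩)
  rintro _ ⟨s, rfl⟩
  refine Real.sqrt_le_sqrt (Finset.sum_le_sum fun j _ => ?_)
  rw [← sq_abs]
  exact pow_le_pow_left₀ (abs_nonneg _) (hK s j s.2.1 s.2.2) 2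

/-- A crude bound for a fixed sample. It ensures that the supremum in `supNorm` is over a bounded
set and not a default value. -/
theorem abs_centered_count_le {N : ℝ → ℕ} (hN : IsCounting N) {l c t T : ℝ} (hl : 0 ≤ l)
    (hc : 0 < c) (h0 : 0 ≤ t) (hT : t ≤ T) :
    |((N t : ℝ) - l * t) / c| ≤ (N T + l * T) / c := by
  rw [abs_div, abs_of_pos hc]
  refine div_le_div_of_nonneg_right ?_ hc.le
  have h1 : (N t : ℝ) ≤ N T := Nat.cast_le.2 (hN.mono hT)
  have h2 : l * t ≤ l * T := mul_le_mul_of_nonneg_left hT hl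
  have h3 : (0 : ℝ) ≤ N t := Nat.cast_nonneg _
  have h4 : 0 ≤ l * t := mul_nonneg hl h0
  rw [abs_le]
  constructor <;> linarith

/-- Linear growth of the holding cost in the size of the primitive processes. -/
theorem exists_sampleCost_le (hM : M.HeavyTraffic) (hC : M.CostConditions) :
    ∃ c₁ c₂ : ℝ, 0 ≤ c₂ ∧ ∀ᶠ n : ℕ in atTop, ∀ (ia st : Fin d → ℕ → ℝ) (B : ℝ → Fin d → ℝ),
      IsRenewalSample ia → IsRenewalSample st → M.IsCMuControl n ia st B →
      M.sampleCost n ia st B ≤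
        c₁ + c₂ * (supNorm M.T (M.arrT n ia) + supNorm M.T (M.srvT n st)) := by
  obtain ⟨u, hu, hlip⟩ := hC.exists_lipschitz
  set D := u * M.muSum * (2 * M.thetaSum) * M.T with hD
  have hD0 : 0 ≤ D := mul_nonneg (mul_nonneg (mul_nonneg hu hM.muSum_nonneg)
    (mul_nonneg zero_le_two hM.thetaSum_nonneg)) hM.T_pos.le
  refine ⟨D * (2 * (M.driftBound + 1) * M.T), D, hD0, ?_⟩
  filter_upwards [eventually_ge_atTop 1, (tendsto_drift_atTop hM).eventually_gt_atTop 0,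
    eventually_drift_close hM one_pos] with n hn hr hdrift ia st B hia hst hB
  have hpath := hB.isCMuPath hM hC hn hia hst
  have hsc := hM.scale_pos hn
  set a := supNorm M.T (M.arrT n ia) with ha
  set s := supNorm M.T (M.srvT n st) with hs
  have ha' : ∀ t i, 0 ≤ t → t ≤ M.T → |M.arrT n ia t i| ≤ a := by
    intro t i h0 hT
    refine abs_le_supNorm (K := ∑ j, ((M.arrCount n ia j M.T : ℝ) + M.lamN n j * M.T) / M.scale n)
      (fun t i h0 hT => ?_) h0 hT i
    refine (abs_centered_count_le (hM.isCounting_arr hn hia i) (hM.lamN_pos n hn i).le hsc h0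
      hT).trans ?_
    exact Finset.single_le_sum (f := fun j =>
      ((M.arrCount n ia j M.T : ℝ) + M.lamN n j * M.T) / M.scale n) (fun j _ =>
        div_nonneg (add_nonneg (Nat.cast_nonneg _)
          (mul_nonneg (hM.lamN_pos n hn j).le hM.T_pos.le)) hsc.le) (Finset.mem_univ i)
  have hs' : ∀ t i, 0 ≤ t → t ≤ M.T → |M.srvT n st t i| ≤ s := by
    intro t i h0 hT
    refine abs_le_supNorm (K := ∑ j, ((M.srvCount n st j M.T : ℝ) + M.muN n j * M.T) / M.scale n)
      (fun t i h0 hT => ?_) h0 hT i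
    refine (abs_centered_count_le (hM.isCounting_srv hn hst i) (hM.muN_pos n hn i).le hsc h0
      hT).trans ?_
    exact Finset.single_le_sum (f := fun j =>
      ((M.srvCount n st j M.T : ℝ) + M.muN n j * M.T) / M.scale n) (fun j _ =>
        div_nonneg (add_nonneg (Nat.cast_nonneg _)
          (mul_nonneg (hM.muN_pos n hn j).le hM.T_pos.le)) hsc.le) (Finset.mem_univ i)
  set X := a + s + 2 * (M.driftBound + 1) * M.T with hX
  have hxi : ∀ t, 0 ≤ t → t ≤ M.T → |∑ i, M.theta i * (M.arrT n ia t i -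
      M.srvT n st (effort B t i) i + (M.lamN n i - n * M.lam i) / M.scale n * t -
      (M.muN n i - n * M.mu i) / M.scale n * effort B t i)| ≤ M.thetaSum * X := by
    intro t h0 hT
    refine abs_sum_theta_le hM fun i => ?_
    have e0 := hpath.e_nonneg h0 i
    have e1 := (hpath.e_le h0 i).trans hT
    have b1 := abs_le.1 (ha' t i h0 hT)
    have b2 := abs_le.1 (hs' _ i e0 e1)
    have hdb := M.driftBound_nonneg
    have b3 : |(M.lamN n i - n * M.lam i) / M.scale n * t| ≤ (M.driftBound + 1) * M.T := by
      rw [abs_mul, abs_of_nonneg h0]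
      exact mul_le_mul (abs_le_of_abs_sub_le (hdrift i).1 (le_driftBound i).1) hT h0 (by linarith)
    have b4 : |(M.muN n i - n * M.mu i) / M.scale n * effort B t i| ≤
        (M.driftBound + 1) * M.T := by
      rw [abs_mul, abs_of_nonneg e0]
      exact mul_le_mul (abs_le_of_abs_sub_le (hdrift i).2 (le_driftBound i).2) e1 e0 (by linarith)
    have c3 := abs_le.1 b3
    have c4 := abs_le.1 b4
    rw [hX, abs_le]
    constructor <;> linarith [b1.1, b1.2, b2.1, b2.2, c3.1, c3.2, c4.1, c4.2]
  have hq : ∀ t, 0 ≤ t → t ≤ M.T → ∀ i,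
      |M.queueT n ia st B t i - 0| ≤ M.mu i * (2 * (M.thetaSum * X)) := by
    intro t h0 hT i
    rw [sub_zero, abs_of_nonneg (hpath.nonneg t i h0)]
    refine (hM.le_mu_mul (fun j => hpath.nonneg t j h0) i).trans
      (mul_le_mul_of_nonneg_left ?_ (hM.mu_pos i).le)
    -- A queue is bounded by its workload, and the reflection by twice the bound of the free path.
    rw [hpath.workload_eq_reflected hM hr.le hxi h0 hT]
    exact reflected_le hxi h0 hT
  have hcost0 : M.cost (fun _ => 0) = 0 := Finset.sum_eq_zero fun i _ => hC.zero i
  have h1 := abs_integral_sub_le hM (hB.intervalIntegrable_cost hM hC hn hia hst)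
    (intervalIntegrable_const (c := (0 : ℝ))) (c := u * M.muSum * (2 * (M.thetaSum * X)))
    fun t h0 hT => by
      have := abs_cost_sub_le hu hlip (hB.queueT_nonneg hM hC hn hia hst h0)
        (q' := fun _ => 0) (fun _ => le_rfl) (hq t h0 hT)
      rwa [hcost0] at this
  have h2 := (le_abs_self _).trans h1
  rw [intervalIntegral.integral_zero, sub_zero] at h2
  refine h2.trans (le_of_eq ?_)
  rw [hX, hD]
  ring

/-! ### The sample paths of the primitive processes -/

theorem exists_skorokhodPath (hM : M.HeavyTraffic) (hn : 1 ≤ n) (hia : IsRenewalSample ia)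
    (hst : IsRenewalSample st) :
    ∃ p : SkorokhodPath M.T ((Fin d → ℝ) × (Fin d → ℝ)),
      ∀ t, p.toFun t = M.sampleProc n ia st t := by
  have hright : ∀ {N : ℝ → ℕ} (_ : IsCounting N) (l c : ℝ) (t : Set.Icc (0 : ℝ) M.T),
      ContinuousWithinAt (fun s : Set.Icc (0 : ℝ) M.T => ((N s : ℝ) - l * s) / c)
        (Set.Ici t) t := by
    intro N hN l c t
    have h1 : ContinuousWithinAt (fun s : ℝ => (N s : ℝ)) (Set.Ici (t : ℝ)) t := by
      refine (continuousWithinAt_const (b := (N t : ℝ))).congr_of_eventuallyEq ?_ rfl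
      filter_upwards [hN.eventually_eq t.2.1] with s hs
      rw [hs]
    have h2 : ContinuousWithinAt (fun s : ℝ => ((N s : ℝ) - l * s) / c) (Set.Ici (t : ℝ)) t :=
      (h1.sub (continuous_const.mul continuous_id).continuousWithinAt).div_const c
    exact h2.comp continuous_subtype_val.continuousWithinAt fun s hs => hs
  have hleft : ∀ {N : ℝ → ℕ} (_ : IsCounting N) (l c : ℝ) (t : Set.Icc (0 : ℝ) M.T),
      ∃ z, Tendsto (fun s : Set.Icc (0 : ℝ) M.T => ((N s : ℝ) - l * s) / c) (𝓝[<] t) (𝓝 z) := by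
    intro N hN l c t
    have hmono : Monotone fun s : ℝ => (N s : ℝ) := fun s s' h => Nat.cast_le.2 (hN.mono h)
    have h1 := hmono.tendsto_nhdsLT t
    have h2 : Tendsto (fun s : ℝ => l * s) (𝓝[<] (t : ℝ)) (𝓝 (l * t)) :=
      ((continuous_const.mul continuous_id).tendsto _).mono_left nhdsWithin_le_nhds
    refine ⟨_, ((h1.sub h2).div_const c).comp (tendsto_nhdsWithin_iff.2
      ⟨(continuous_subtype_val.tendsto t).mono_left nhdsWithin_le_nhds, ?_⟩)⟩
    filter_upwards [self_mem_nhdsWithin] with s hs using hs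
  have hA := hM.isCounting_arr hn hia
  have hS := hM.isCounting_srv hn hst
  refine ⟨⟨fun t => M.sampleProc n ia st t, fun t => ?_, fun t => ?_⟩, fun _ => rfl⟩
  · exact ContinuousWithinAt.prodMk (continuousWithinAt_pi.2 fun i => hright (hA i) _ _ t)
      (continuousWithinAt_pi.2 fun i => hright (hS i) _ _ t)
  · choose z₁ hz₁ using fun i => hleft (hA i) (M.lamN n i) (M.scale n) t
    choose z₂ hz₂ using fun i => hleft (hS i) (M.muN n i) (M.scale n) t
    exact ⟨(z₁, z₂), Tendsto.prodMk_nhds (tendsto_pi_nhds.2 hz₁) (tendsto_pi_nhds.2 hz₂)⟩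

end QueueParams

/-! ### Consequences of the large deviation principle -/

section Limit

variable {Ω : Type*} [MeasurableSpace Ω] {Pr : Measure Ω} {d : ℕ} {M : QueueParams d}
  {IA ST : Fin d → ℕ → Ω → ℝ}

theorem QueueParams.HeavyTraffic.sq_b_pos (hM : M.HeavyTraffic) {n : ℕ} (hn : 1 ≤ n) :
    0 < M.b n ^ 2 := pow_pos (hM.b_pos n hn) 2

theorem ModerateLDP.eventually_le (h : ModerateLDP Pr M IA ST) (hM : M.HeavyTraffic)
    {F : Set (SkorokhodPath M.T ((Fin d → ℝ) × (Fin d → ℝ)))} (hF : IsClosed F) {γ γ' : ℝ}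
    (hγ : ∀ ψ ∈ F, (γ : EReal) ≤ (M.rate ψ.toFun : EReal)) (hγ' : γ' < γ) :
    ∀ᶠ n in atTop, Pr (pathEvent M IA ST n F) ≤
      ENNReal.ofReal (Real.exp (M.b n ^ 2 * -γ')) := by
  have h1 := h.2 F hF
  have h2 : (γ : EReal) ≤ ⨅ ψ ∈ F, (M.rate ψ.toFun : EReal) := le_iInf₂ hγ
  have h3 := h1.trans (EReal.neg_le_neg_iff.2 h2)
  have h4 : -(γ : EReal) < ((-γ' : ℝ) : EReal) := by
    rw [← EReal.coe_neg, EReal.coe_lt_coe_iff]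
    linarith
  filter_upwards [eventually_lt_of_limsup_lt (h3.trans_lt h4), eventually_ge_atTop 1]
    with n hn hn1
  exact (inv_mul_log_le_iff (hM.sq_b_pos hn1)).1 hn.le

theorem ModerateLDP.eventually_ge (h : ModerateLDP Pr M IA ST) (hM : M.HeavyTraffic)
    {G : Set (SkorokhodPath M.T ((Fin d → ℝ) × (Fin d → ℝ)))} (hG : IsOpen G)
    {ψ : SkorokhodPath M.T ((Fin d → ℝ) × (Fin d → ℝ))} (hψ : ψ ∈ G)
    (hfin : M.rate ψ.toFun ≠ ∞) {γ : ℝ} (hγ : (M.rate ψ.toFun).toReal < γ) :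
    ∀ᶠ n in atTop, ENNReal.ofReal (Real.exp (M.b n ^ 2 * -γ)) ≤
      Pr (pathEvent M IA ST n G) := by
  have h1 := h.1 G hG
  have h2 : (⨅ ψ ∈ G, (M.rate ψ.toFun : EReal)) ≤ ((M.rate ψ.toFun).toReal : EReal) := by
    rw [EReal.coe_ennreal_toReal hfin]
    exact iInf₂_le ψ hψ
  have h3 := (EReal.neg_le_neg_iff.2 h2).trans h1
  have h4 : ((-γ : ℝ) : EReal) < -((M.rate ψ.toFun).toReal : EReal) := by
    rw [← EReal.coe_neg, EReal.coe_lt_coe_iff]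
    linarith
  filter_upwards [eventually_lt_of_lt_liminf (h4.trans_le h3), eventually_ge_atTop 1]
    with n hn hn1
  exact ((lt_inv_mul_log_iff (hM.sq_b_pos hn1)).1 hn).le

theorem ExpMomentBound.exists_eventually_le (h : ExpMomentBound Pr M IA ST)
    (hM : M.HeavyTraffic) (u : ℝ) :
    ∃ K : ℝ, ∀ᶠ n in atTop, ∫⁻ ω, ENNReal.ofReal (Real.exp (M.b n ^ 2 * u *
      (supNorm M.T (M.arrT n (fun j l => IA j l ω)) +
        supNorm M.T (M.srvT n (fun j l => ST j l ω))))) ∂Pr ≤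
      ENNReal.ofReal (Real.exp (M.b n ^ 2 * K)) := by
  obtain ⟨K, hK, -⟩ := EReal.lt_iff_exists_real_btwn.1 (h u)
  refine ⟨K, ?_⟩
  filter_upwards [eventually_lt_of_limsup_lt hK, eventually_ge_atTop 1] with n hn hn1
  exact (inv_mul_log_le_iff (hM.sq_b_pos hn1)).1 hn.le

variable [IsProbabilityMeasure Pr]

/-- By uniqueness every version of the rule has almost surely the same cost as the constructed one,
for which measurability is known. -/
theorem IsGenCMuRule.aemeasurable_sampleCost (hM : M.HeavyTraffic) (hC : M.CostConditions)
    (hIA : IsRenewalInput Pr IA M.varIA) (hST : IsRenewalInput Pr ST M.varST) {n : ℕ}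
    (hn : 1 ≤ n) {B : Ω → ℝ → Fin d → ℝ} (h : IsGenCMuRule M Pr IA ST n B) :
    AEMeasurable (fun ω =>
      M.sampleCost n (fun j l => IA j l ω) (fun j l => ST j l ω) (B ω)) Pr := by
  obtain ⟨B', -, h', hm⟩ := exists_isGenCMuRule hM hC hIA hST hn
  refine hm.congr ?_
  filter_upwards [h'.ae_unique hM hST hn h] with ω hω
  exact QueueParams.sampleCost_congr hM hω

/-- Large deviation upper bound for the holding cost under the `cμ` rule. -/
theorem eventually_measure_le_sampleCost (hM : M.HeavyTraffic) (hC : M.CostConditions)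
    (hIA : IsRenewalInput Pr IA M.varIA) (hST : IsRenewalInput Pr ST M.varST)
    (hLDP : ModerateLDP Pr M IA ST) {B : ℕ → Ω → ℝ → Fin d → ℝ}
    (hB : ∀ n, 1 ≤ n → IsGenCMuRule M Pr IA ST n (B n)) {V : ℝ} (hV : M.pathValue = V)
    (x : ℝ) {ε : ℝ} (hε : 0 < ε) :
    ∀ᶠ n in atTop,
      Pr {ω | x ≤ M.sampleCost n (fun j l => IA j l ω) (fun j l => ST j l ω) (B n ω)} ≤
        ENNReal.ofReal (Real.exp (M.b n ^ 2 * (V - x + ε))) := by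
  obtain ⟨u, hu, hlip⟩ := hC.exists_lipschitz
  -- Paths with rate above `R` are already as improbable as claimed, so only the sublevel set needs
  -- analysis.
  set R := max (x - V) 0 with hR
  have hR0 : 0 ≤ R := le_max_right _ _
  obtain ⟨κ₀, hκ₀, hclose⟩ := QueueParams.exists_abs_sampleCost_sub_le hM hC hR0
    (show (0 : ℝ) < ε / 3 by positivity)
  -- `D * κ` bounds the difference of the optimal costs of two paths at distance `2 κ`.
  set D := u * M.muSum * (2 * (M.thetaSum * (2 * 2))) * M.T with hD
  have hD0 : 0 ≤ D := mul_nonneg (mul_nonneg (mul_nonneg hu hM.muSum_nonneg)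
    (mul_nonneg zero_le_two (mul_nonneg hM.thetaSum_nonneg (by norm_num)))) hM.T_pos.le
  set κ := min κ₀ (ε / 3 / (D + 1)) with hκ
  have hκ0 : 0 < κ := lt_min hκ₀ (by positivity)
  have hDκ : D * κ ≤ ε / 3 := by
    have h1 : κ * (D + 1) ≤ ε / 3 := (le_div_iff₀ (by positivity)).1 (min_le_right _ _)
    nlinarith
  obtain ⟨L, hL, hmod⟩ := M.exists_modulus_of_rate_le R hR0
    (show (0 : ℝ) < κ / 3 by positivity)
  obtain ⟨r, hr, hball⟩ := SkorokhodPath.exists_radius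
    (E := (Fin d → ℝ) × (Fin d → ℝ)) hM.T_pos.le (show (0 : ℝ) < κ / 3 by positivity) hL
  have hnear : ∀ ψ p : SkorokhodPath M.T ((Fin d → ℝ) × (Fin d → ℝ)),
      M.rate ψ.toFun ≤ ENNReal.ofReal R → ψ.InBall r p →
      ∀ t, ‖p.toFun t - ψ.toFun t‖ ≤ κ := fun ψ p h1 h2 t =>
    (hball ψ p (hmod _ h1) h2 t).trans (by linarith)
  set U := ⋃ ψ ∈ {ψ : SkorokhodPath M.T ((Fin d → ℝ) × (Fin d → ℝ)) |
    M.rate ψ.toFun ≤ ENNReal.ofReal R}, {p | ψ.InBall r p} with hU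
  set W := ⋃ ψ ∈ {ψ : SkorokhodPath M.T ((Fin d → ℝ) × (Fin d → ℝ)) |
    M.rate ψ.toFun ≤ ENNReal.ofReal R ∧ x - ε / 3 ≤ M.pathCost ψ.toFun},
    {p | ψ.InBall r p} with hW
  have hUo : IsOpen U := isOpen_biUnion fun ψ _ => ψ.isOpen_ball r
  -- `U` surrounds the sublevel set and `W` its paths of cost at least `x - ε / 3`. A point of the
  -- closed set with rate at most `R` lies in `U`, hence in the closure of `W`, so it is within `2
  -- κ` of an expensive path. Its cost is then at least `x - 2 ε / 3`, and cost minus rate is at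
  -- most `V`.
  have hrate : ∀ ψ ∈ Uᶜ ∪ closure W,
      ((x - V - 2 * (ε / 3) : ℝ) : EReal) ≤ (M.rate ψ.toFun : EReal) := by
    intro ψ hψ
    rcases lt_or_ge (ENNReal.ofReal R) (M.rate ψ.toFun) with hlt | hle
    · refine le_trans ?_ (EReal.coe_ennreal_le_coe_ennreal_iff.2 hlt.le)
      rw [EReal.coe_ennreal_ofReal, max_eq_left hR0, EReal.coe_le_coe_iff]
      have := le_max_left (x - V) 0
      linarith
    · have hψU : ψ ∈ U := Set.mem_biUnion hle (SkorokhodPath.InBall.self ψ hr)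
      have hψW : ψ ∈ closure W := hψ.resolve_left fun h => h hψU
      obtain ⟨q, hq, hqW⟩ := mem_closure_iff.1 hψW _ (ψ.isOpen_ball r)
        (SkorokhodPath.InBall.self ψ hr)
      obtain ⟨ψ', ⟨h1, h2⟩, h3⟩ := Set.mem_iUnion₂.1 hqW
      have hfin : M.rate ψ.toFun ≠ ∞ := ne_top_of_le_ne_top ENNReal.ofReal_ne_top hle
      have hfin' : M.rate ψ'.toFun ≠ ∞ := ne_top_of_le_ne_top ENNReal.ofReal_ne_top h1
      have h4 : ∀ t, ‖ψ'.toFun t - ψ.toFun t‖ ≤ 2 * κ := fun t => by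
        have e1 := hnear ψ q hle hq t
        have e2 := hnear ψ' q h1 h3 t
        have e3 := norm_sub_le_norm_sub_add_norm_sub (ψ'.toFun t) (q.toFun t) (ψ.toFun t)
        rw [norm_sub_rev _ (q.toFun t)] at e3
        linarith
      have h5 := QueueParams.abs_pathCost_sub_le hM hC hu hlip
        (QueueParams.continuous_of_rate_ne_top hfin')
        (QueueParams.continuous_of_rate_ne_top hfin) h4
      have h6 : u * M.muSum * (2 * (M.thetaSum * (2 * (2 * κ)))) * M.T = D * κ := by
        rw [hD]
        ring
      rw [h6] at h5
      have h7 := (abs_le.1 h5).2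
      have h8 := QueueParams.pathCost_sub_le_pathValue hfin
      rw [hV, EReal.coe_le_coe_iff] at h8
      rw [← EReal.coe_ennreal_toReal hfin, EReal.coe_le_coe_iff]
      linarith
  have hev := hLDP.eventually_le hM (hUo.isClosed_compl.union isClosed_closure) hrate
    (show x - V - ε < x - V - 2 * (ε / 3) by linarith)
  filter_upwards [hev, hclose κ hκ0 (min_le_left _ _), eventually_ge_atTop 1] with n hn hcl hn1
  rw [show V - x + ε = -(x - V - ε) by ring]
  refine le_trans (measure_mono_ae ?_) hn
  filter_upwards [hIA.ae_isRenewalSample, hST.ae_isRenewalSample,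
    isGenCMuRule_iff.1 (hB n hn1)] with ω hia hst hω hx
  obtain ⟨p, hp⟩ := QueueParams.exists_skorokhodPath hM hn1 hia hst
  refine ⟨p, ?_, hp⟩
  -- An expensive sample either leaves `U` or is close to a path of the sublevel set, whose cost is
  -- then at least `x - ε / 3`.
  by_cases hpU : p ∈ U
  · obtain ⟨ψ, h1, h2⟩ := Set.mem_iUnion₂.1 hpU
    have h3 := hcl _ _ _ ψ.toFun hia hst hω h1 fun t => by
      rw [← hp t]
      exact hnear ψ p h1 h2 t
    refine Or.inr (subset_closure (Set.mem_biUnion ⟨h1, ?_⟩ h2))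
    have h4 := (abs_le.1 h3).2
    have h5 : x ≤ M.sampleCost n (fun j l => IA j l ω) (fun j l => ST j l ω) (B n ω) := hx
    linarith
  · exact Or.inl hpU

theorem exists_eventually_lintegral_two_mul_le (hM : M.HeavyTraffic) (hC : M.CostConditions)
    (hIA : IsRenewalInput Pr IA M.varIA) (hST : IsRenewalInput Pr ST M.varST)
    (hExp : ExpMomentBound Pr M IA ST) {B : ℕ → Ω → ℝ → Fin d → ℝ}
    (hB : ∀ n, 1 ≤ n → IsGenCMuRule M Pr IA ST n (B n)) :
    ∃ K : ℝ, ∀ᶠ n in atTop, ∫⁻ ω, ENNReal.ofReal (Real.exp (2 * M.b n ^ 2 *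
      M.sampleCost n (fun j l => IA j l ω) (fun j l => ST j l ω) (B n ω))) ∂Pr ≤
      ENNReal.ofReal (Real.exp (M.b n ^ 2 * K)) := by
  obtain ⟨c₁, c₂, -, hgrow⟩ := QueueParams.exists_sampleCost_le hM hC
  obtain ⟨K, hK⟩ := hExp.exists_eventually_le hM (2 * c₂)
  refine ⟨2 * c₁ + K, ?_⟩
  filter_upwards [hgrow, hK, eventually_ge_atTop 1] with n hg hn hn1
  have hb := hM.sq_b_pos hn1
  rw [mul_add, Real.exp_add, ENNReal.ofReal_mul (Real.exp_pos _).le]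
  refine le_trans ?_ (mul_le_mul_right hn _)
  rw [← lintegral_const_mul' _ _ ENNReal.ofReal_ne_top]
  refine lintegral_mono_ae ?_
  filter_upwards [hIA.ae_isRenewalSample, hST.ae_isRenewalSample,
    isGenCMuRule_iff.1 (hB n hn1)] with ω hia hst hω
  rw [← ENNReal.ofReal_mul (Real.exp_pos _).le, ← Real.exp_add]
  refine ENNReal.ofReal_le_ofReal (Real.exp_le_exp.2 ?_)
  have h1 := mul_le_mul_of_nonneg_left (hg _ _ _ hia hst hω)
    (show 0 ≤ 2 * M.b n ^ 2 by positivity)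
  refine h1.trans (le_of_eq ?_)
  ring

/-- Upper half of Varadhan's argument: in each slice the exponent `(k + 1) ε` meets the probability
exponent `V - k ε + ε`, so every slice contributes at most `exp (b_n² (V + 2 ε))`. -/
theorem eventually_lintegral_le (hM : M.HeavyTraffic) (hC : M.CostConditions)
    (hIA : IsRenewalInput Pr IA M.varIA) (hST : IsRenewalInput Pr ST M.varST)
    (hLDP : ModerateLDP Pr M IA ST) (hExp : ExpMomentBound Pr M IA ST)
    {B : ℕ → Ω → ℝ → Fin d → ℝ} (hB : ∀ n, 1 ≤ n → IsGenCMuRule M Pr IA ST n (B n))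
    {V : ℝ} (hV : M.pathValue = V) {a : ℝ} (ha : V < a) :
    ∀ᶠ n in atTop, ∫⁻ ω, ENNReal.ofReal (Real.exp (M.b n ^ 2 *
      M.sampleCost n (fun j l => IA j l ω) (fun j l => ST j l ω) (B n ω))) ∂Pr ≤
      ENNReal.ofReal (Real.exp (M.b n ^ 2 * a)) := by
  set ε := (a - V) / 3 with hε
  have hε0 : 0 < ε := by
    have := sub_pos.2 ha
    positivity
  obtain ⟨K, hK⟩ := exists_eventually_lintegral_two_mul_le hM hC hIA hST hExp hB
  -- The number of slices depends only on `K`, `V` and `ε`: it makes the tail term, with exponent `K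
  -- - (m + 1) ε`, no larger than a slice. The `m + 2` terms are absorbed by `exp (b_n² ε)`.
  obtain ⟨m, hm⟩ : ∃ m : ℕ, K - V ≤ m * ε := by
    obtain ⟨m, hm⟩ := exists_nat_ge ((K - V) / ε)
    exact ⟨m, (div_le_iff₀ hε0).1 hm⟩
  have hlevel : ∀ᶠ n in atTop, ∀ k ∈ Finset.range (m + 1),
      Pr {ω | (k : ℝ) * ε ≤
        M.sampleCost n (fun j l => IA j l ω) (fun j l => ST j l ω) (B n ω)} ≤
        ENNReal.ofReal (Real.exp (M.b n ^ 2 * (V - k * ε + ε))) :=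
    (Finset.eventually_all _).2 fun k _ =>
      eventually_measure_le_sampleCost hM hC hIA hST hLDP hB hV (k * ε) hε0
  have hlarge : ∀ᶠ n in atTop, (m : ℝ) + 2 ≤ Real.exp (M.b n ^ 2 * ε) :=
    (Real.tendsto_exp_atTop.comp (((tendsto_pow_atTop two_ne_zero).comp
      hM.b_tendsto).atTop_mul_const hε0)).eventually_ge_atTop _
  filter_upwards [hK, hlevel, hlarge, eventually_ge_atTop 1] with n hn hlev hla hn1
  have hb := hM.sq_b_pos hn1
  set G : Ω → ℝ := fun ω =>
    M.sampleCost n (fun j l => IA j l ω) (fun j l => ST j l ω) (B n ω) with hG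
  have hG0 : ∀ᵐ ω ∂Pr, 0 ≤ G ω := by
    filter_upwards [hIA.ae_isRenewalSample, hST.ae_isRenewalSample,
      isGenCMuRule_iff.1 (hB n hn1)] with ω hia hst hω
    exact hω.sampleCost_nonneg hM hC hn1 hia hst
  set e := ENNReal.ofReal (Real.exp (M.b n ^ 2 * (V + 2 * ε))) with he
  have hterm : ∀ k ∈ Finset.range (m + 1),
      ENNReal.ofReal (Real.exp (M.b n ^ 2 * ((k + 1) * ε))) * Pr {ω | k * ε ≤ G ω} ≤ e := by
    intro k hk
    refine (mul_le_mul_right (hlev k hk) _).trans (le_of_eq ?_)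
    rw [← ENNReal.ofReal_mul (Real.exp_pos _).le, ← Real.exp_add, he]
    congr 2
    ring
  have htail : ENNReal.ofReal (Real.exp (-(M.b n ^ 2 * ((m + 1) * ε)))) *
      ∫⁻ ω, ENNReal.ofReal (Real.exp (2 * M.b n ^ 2 * G ω)) ∂Pr ≤ e := by
    refine (mul_le_mul_right hn _).trans ?_
    rw [← ENNReal.ofReal_mul (Real.exp_pos _).le, ← Real.exp_add, he]
    refine ENNReal.ofReal_le_ofReal (Real.exp_le_exp.2 ?_)
    nlinarith
  refine (lintegral_exp_le_sum ((hB n hn1).aemeasurable_sampleCost hM hC hIA hST hn1) hG0 hb hε0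
    m).trans ((add_le_add (Finset.sum_le_card_nsmul _ _ _ hterm) htail).trans ?_)
  have h1 : M.b n ^ 2 * a = M.b n ^ 2 * ε + M.b n ^ 2 * (V + 2 * ε) := by
    rw [hε]
    ring
  rw [h1, Real.exp_add, ENNReal.ofReal_mul (Real.exp_pos _).le, ← he, Finset.card_range,
    nsmul_eq_mul]
  calc ((m + 1 : ℕ) : ℝ≥0∞) * e + e = ENNReal.ofReal (m + 2) * e := by
        rw [show (m : ℝ) + 2 = ((m + 2 : ℕ) : ℝ) by push_cast; ring, ENNReal.ofReal_natCast]
        push_cast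
        ring
    _ ≤ _ := mul_le_mul_left (ENNReal.ofReal_le_ofReal hla) _

/-- Lower half: by Markov's inequality it suffices to bound the probability of a small ball around a
single path whose cost minus rate exceeds `a`, since the cost is nearly constant on that ball. -/
theorem eventually_le_lintegral (hM : M.HeavyTraffic) (hC : M.CostConditions)
    (hIA : IsRenewalInput Pr IA M.varIA) (hST : IsRenewalInput Pr ST M.varST)
    (hLDP : ModerateLDP Pr M IA ST) {B : ℕ → Ω → ℝ → Fin d → ℝ}
    (hB : ∀ n, 1 ≤ n → IsGenCMuRule M Pr IA ST n (B n)) {a : ℝ}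
    (ha : (a : EReal) < M.pathValue) :
    ∀ᶠ n in atTop, ENNReal.ofReal (Real.exp (M.b n ^ 2 * a)) ≤
      ∫⁻ ω, ENNReal.ofReal (Real.exp (M.b n ^ 2 *
        M.sampleCost n (fun j l => IA j l ω) (fun j l => ST j l ω) (B n ω))) ∂Pr := by
  obtain ⟨ψ, hψ⟩ := lt_iSup_iff.1 ha
  have hfin : M.rate ψ.1 ≠ ∞ := by
    intro h
    rw [h] at hψ
    simp at hψ
  rw [← EReal.coe_ennreal_toReal hfin, ← EReal.coe_sub, EReal.coe_lt_coe_iff] at hψ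
  set I := (M.rate ψ.1).toReal with hI
  -- Half of the gap is spent on the cost and half on the probability: `(pathCost - ε) - (I + ε) =
  -- a`.
  set ε := (M.pathCost ψ.1 - I - a) / 2 with hε
  have hε0 : 0 < ε := by
    have := sub_pos.2 hψ
    positivity
  have hI0 : 0 ≤ I := ENNReal.toReal_nonneg
  have hIle : M.rate ψ.1 ≤ ENNReal.ofReal I := by rw [hI, ENNReal.ofReal_toReal hfin]
  obtain ⟨κ, hκ, hclose⟩ := QueueParams.exists_abs_sampleCost_sub_le hM hC hI0 hε0
  obtain ⟨L, hL, hmod⟩ := M.exists_modulus_of_rate_le I hI0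
    (show (0 : ℝ) < κ / 3 by positivity)
  obtain ⟨r, hr, hball⟩ := SkorokhodPath.exists_radius
    (E := (Fin d → ℝ) × (Fin d → ℝ)) hM.T_pos.le (show (0 : ℝ) < κ / 3 by positivity) hL
  let p : SkorokhodPath M.T ((Fin d → ℝ) × (Fin d → ℝ)) :=
    ⟨ψ.1, fun t => ψ.1.continuous.continuousWithinAt,
      fun t => ⟨_, (ψ.1.continuous.tendsto t).mono_left nhdsWithin_le_nhds⟩⟩
  filter_upwards [hLDP.eventually_ge hM (p.isOpen_ball r) (SkorokhodPath.InBall.self p hr) hfin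
    (show I < I + ε by linarith), hclose κ hκ le_rfl, eventually_ge_atTop 1] with n hn hcl hn1
  have hb := hM.sq_b_pos hn1
  set G : Ω → ℝ := fun ω =>
    M.sampleCost n (fun j l => IA j l ω) (fun j l => ST j l ω) (B n ω) with hG
  have hGm : AEMeasurable G Pr := (hB n hn1).aemeasurable_sampleCost hM hC hIA hST hn1
  have hm : AEMeasurable (fun ω => ENNReal.ofReal (Real.exp (M.b n ^ 2 * G ω))) Pr :=
    (Real.measurable_exp.comp_aemeasurable (hGm.const_mul _)).ennreal_ofReal
  refine le_trans ?_ (mul_meas_ge_le_lintegral₀ hm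
    (ENNReal.ofReal (Real.exp (M.b n ^ 2 * (M.pathCost ψ.1 - ε)))))
  refine le_trans (le_of_eq ?_) (mul_le_mul_right (hn.trans (measure_mono_ae ?_)) _)
  · rw [← ENNReal.ofReal_mul (Real.exp_pos _).le, ← Real.exp_add]
    congr 2
    rw [hε]
    ring
  · filter_upwards [hIA.ae_isRenewalSample, hST.ae_isRenewalSample,
      isGenCMuRule_iff.1 (hB n hn1)] with ω hia hst hω hx
    obtain ⟨q, hq, hqt⟩ := hx
    have h3 := hcl _ _ _ ψ.1 hia hst hω hIle fun t => by
      have h4 := hball p q (hmod _ hIle) hq t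
      rw [hqt t] at h4
      exact h4.trans (by linarith)
    refine ENNReal.ofReal_le_ofReal (Real.exp_le_exp.2 (mul_le_mul_of_nonneg_left ?_ hb.le))
    have h5 := (abs_le.1 h3).1
    simp only [hG]
    linarith

theorem tendsto_riskCost (hM : M.HeavyTraffic) (hC : M.CostConditions)
    (hIA : IsRenewalInput Pr IA M.varIA) (hST : IsRenewalInput Pr ST M.varST)
    (hLDP : ModerateLDP Pr M IA ST) (hExp : ExpMomentBound Pr M IA ST)
    {B : ℕ → Ω → ℝ → Fin d → ℝ} (hB : ∀ n, 1 ≤ n → IsGenCMuRule M Pr IA ST n (B n)) :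
    Tendsto (fun n => riskCost M Pr IA ST n (B n)) atTop (𝓝 M.pathValue) := by
  obtain ⟨V, hV⟩ := QueueParams.exists_pathValue_eq hM hC
  refine tendsto_order.2 ⟨fun z hz => ?_, fun z hz => ?_⟩
  · obtain ⟨a, hza, haV⟩ := EReal.lt_iff_exists_real_btwn.1 hz
    obtain ⟨a', haa', ha'V⟩ := EReal.lt_iff_exists_real_btwn.1 haV
    filter_upwards [eventually_le_lintegral hM hC hIA hST hLDP hB ha'V, eventually_ge_atTop 1]
      with n hn hn1
    have hb := hM.sq_b_pos hn1
    refine hza.trans ((lt_inv_mul_log_iff hb).2 (lt_of_lt_of_le ?_ hn))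
    rw [ENNReal.ofReal_lt_ofReal_iff (Real.exp_pos _), Real.exp_lt_exp]
    exact mul_lt_mul_of_pos_left (EReal.coe_lt_coe_iff.1 haa') hb
  · obtain ⟨a, hVa, haz⟩ := EReal.lt_iff_exists_real_btwn.1 hz
    rw [hV, EReal.coe_lt_coe_iff] at hVa
    filter_upwards [eventually_lintegral_le hM hC hIA hST hLDP hExp hB hV hVa,
      eventually_ge_atTop 1] with n hn hn1
    exact ((inv_mul_log_le_iff (hM.sq_b_pos hn1)).2 hn).trans_lt haz

end Limit

/-- Asymptotic optimality of the preemptive generalized `cμ` rule: the rule determines a control,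
uniquely up to null sets, the control is admissible, and its risk-sensitive cost converges to the
(finite) value of the differential game. -/
theorem theorem2p1 {Ω : Type*} [MeasurableSpace Ω] (Pr : Measure Ω) [IsProbabilityMeasure Pr]
    {d : ℕ} (M : QueueParams d) (hM : M.HeavyTraffic) (hC : M.CostConditions)
    (IA ST : Fin d → ℕ → Ω → ℝ)
    (hIA : IsRenewalInput Pr IA M.varIA) (hST : IsRenewalInput Pr ST M.varST)
    (hLDP : ModerateLDP Pr M IA ST) (hExp : ExpMomentBound Pr M IA ST) :
    (∀ n, 1 ≤ n → ∃ B, IsAdmissible M Pr IA ST n B ∧ IsGenCMuRule M Pr IA ST n B) ∧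
    (∀ n, 1 ≤ n → ∀ B B', IsGenCMuRule M Pr IA ST n B → IsGenCMuRule M Pr IA ST n B' →
      ∀ᵐ ω ∂Pr, ∀ t, 0 ≤ t → B ω t = B' ω t) ∧
    (∃ V : ℝ, M.gameValue = (V : EReal)) ∧
    ∀ B : ℕ → Ω → ℝ → Fin d → ℝ, (∀ n, 1 ≤ n → IsGenCMuRule M Pr IA ST n (B n)) →
      Tendsto (fun n => riskCost M Pr IA ST n (B n)) atTop (𝓝 M.gameValue) := by
  refine ⟨fun n hn => ?_, fun n hn B B' h h' => h.ae_unique hM hST hn h', ?_, fun B hB => ?_⟩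
  · obtain ⟨B, hm, hB, -⟩ := exists_isGenCMuRule hM hC hIA hST hn
    exact ⟨B, hB.isAdmissible hM hC hn hm, hB⟩
  · rw [QueueParams.gameValue_eq_pathValue hM hC]
    exact QueueParams.exists_pathValue_eq hM hC
  · rw [QueueParams.gameValue_eq_pathValue hM hC]
    exact tendsto_riskCost hM hC hIA hST hLDP hExp hB
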